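/- For a polynomial $p$ with complex coefficients let $L_p=\{z\in\mathbb C:\ |p(z)|=1\}$ be its lemniscate and let $|L_p|$ denote the length (one-dimensional Hausdorff measure) of $L_p$. There is an absolute constant $C$ such that for every $n\ge 1$ and every monic polynomial $p$ of degree $n$, $$|L_p|\le 2n+C\,n^{7/8}.$$ In particular, $|L_p|\le 2n+o(n)$ as $n\to\infty$, uniformly over all monic polynomials $p$ of degree $n$: for every $\varepsilon>0$ there is $N$ such that $|L_p|\le 2n+\varepsilon n$ for every $n\ge N$ and every monic polynomial $p$ of degree $n$. -/

import Mathlib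

open MeasureTheory
open scoped ENNReal

noncomputable section

/-- The lemniscate `L_p = {z ∈ ℂ : |p(z)| = 1}` of a complex polynomial. -/
def lemniscate (p : Polynomial ℂ) : Set ℂ := {z : ℂ | ‖p.eval z‖ = 1}

/-- The length of the lemniscate: its one-dimensional Hausdorff measure
(normalised so that a segment has its usual length), with values in `[0, ∞]`. -/
def lemniscateLength (p : Polynomial ℂ) : ℝ≥0∞ :=
  Measure.hausdorffMeasure 1 (lemniscate p)

end

/-! By the coarea formula the length is controlled by the integral over the unit circle of the sum
of `1/|p'|` over the fibres of `p`, and this is detected by a weight concentrated at `|p| = 1`. Such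
a weight arises as the derivative of a ramp `ψ(|p|²)` falling from `1/2` to `-1/2`. Put `v = conj p
· p'/|p'|` and apply Stokes, `∫ ∂̄Φ = 0`, to the compactly supported field `Φ = A(|p|²) · v ·
(ψ(|p|²) + i G(μ))`, where `μ = v · conj (p''/p')` and `A` is a cutoff with `A(|p|²)|p| ≤ 1`.

With `G = 0`, the identity `∂̄v = conj p' · p'/|p'| - v · conj (p''/p') / 2` bounds the length by `∫
A |Re μ|/2`, up to a multiple of `∫ |p'|` over `K = {|p| ≤ √5}`, which is `O(√n)`. Now `p''/p'` is
the sum of `1/(z - ξ)` over the critical points, Pólya's inequality gives `|K| ≤ π 5^(1/n)`, and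
rearrangement gives `∫_K 1/|z - ξ| ≤ 2√(π|K|)`, about `2π`. The crude bound `|Re μ| ≤ |μ|` would
thus yield only `πn`.

The phase correction `G(μ) = e^{-it} h(t)`, `t = arg μ`, `h' = |cos|/2 - 1/π`, is what lowers `π` to
`2`: its angular derivative replaces `|cos t|/2` by the mean `1/π`, and `(1/π) · 2πn = 2n`. The
price is that `p''/p'` gets differentiated. It is therefore smoothed at scale `r` near the critical
points, `G` is flattened for `|μ|` below `M`, and balancing the errors gives `n^(7/8)`.

The lemmas carrying this are `lemniscateLength_le_lintegral`, `lintegral_coarea`,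
`volume_norm_eval_le`, `two_mul_re_le_of_bounds`, `lintegral_cutoff_rampDeriv_le` and
`lintegral_fiberLength_le`. -/

open Set Filter Topology Polynomial ComplexConjugate

/-! ### Local injectivity of `p`, fibre sums and the area formula -/

/-- The set of points where the derivative of `p` does not vanish. -/
def regularSet (p : ℂ[X]) : Set ℂ := {z | p.derivative.eval z ≠ 0}

lemma isOpen_regularSet (p : ℂ[X]) : IsOpen (regularSet p) :=
  isOpen_ne_fun p.derivative.continuous continuous_const

lemma finite_compl_regularSet {p : ℂ[X]} (hp : p.derivative ≠ 0) : (regularSet p)ᶜ.Finite := by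
  refine (p.derivative.roots.toFinset.finite_toSet).subset fun z hz => ?_
  simpa [regularSet, hp] using hz

lemma derivative_ne_zero_of_natDegree {p : ℂ[X]} (hn : p.natDegree ≠ 0) : p.derivative ≠ 0 := by
  intro h
  exact hn (derivative_eq_zero.1 h)

/-- Near a regular point a polynomial is, up to a factor close to one, a similarity. -/
lemma exists_nhds_antilipschitz (p : ℂ[X]) {κ : ℝ} (hκ : 1 < κ) {z : ℂ} (hz : z ∈ regularSet p) :
    ∃ U ∈ 𝓝 z, ∃ c : ℝ, 0 < c ∧ (∀ x ∈ U, ∀ y ∈ U, c * ‖x - y‖ ≤ ‖p.eval x - p.eval y‖) ∧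
      ∀ x ∈ U, ‖p.derivative.eval x‖ ≤ κ * c := by
  set a := p.derivative.eval z with ha
  have ha0 : 0 < ‖a‖ := norm_pos_iff.2 hz
  -- Solves `(1 + e)/(1 - e) = κ`: on `U` the expansion factors lie between `(1 - e)‖a‖` and `(1 +
  -- e)‖a‖`.
  set e : ℝ := (κ - 1) / (κ + 1) with he
  have he0 : 0 < e := by apply div_pos <;> linarith
  have he1 : e < 1 := by rw [he, div_lt_one] <;> linarith
  have hκe : (1 + e) = κ * (1 - e) := by rw [he]; field_simp; ring
  have h1 : HasStrictFDerivAt (fun x => p.eval x) _ z := (p.hasStrictDerivAt z).hasStrictFDerivAt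
  have h2 := h1.isLittleO.def (mul_pos he0 ha0)
  have h3 : ∀ᶠ x in 𝓝 z, ‖p.derivative.eval x‖ < (1 + e) * ‖a‖ := by
    have : Tendsto (fun x => ‖p.derivative.eval x‖) (𝓝 z) (𝓝 ‖a‖) :=
      (p.derivative.continuous.norm).tendsto z
    exact this.eventually (gt_mem_nhds (by nlinarith))
  rw [nhds_prod_eq] at h2
  obtain ⟨U, hU, hUp⟩ := (eventually_prod_self_iff (r := fun x y : ℂ =>
    ‖p.eval x - p.eval y - ContinuousLinearMap.toSpanSingleton ℂ a (x - y)‖ ≤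
      e * ‖a‖ * ‖x - y‖)).1 h2
  refine ⟨U ∩ {x | ‖p.derivative.eval x‖ < (1 + e) * ‖a‖}, inter_mem hU h3, (1 - e) * ‖a‖,
    mul_pos (by linarith) ha0, ?_, ?_⟩
  · rintro x ⟨hx, -⟩ y ⟨hy, -⟩
    have := hUp x hx y hy
    simp only [ContinuousLinearMap.toSpanSingleton_apply, smul_eq_mul] at this
    have h4 := norm_sub_norm_le ((x - y) * a) (p.eval x - p.eval y)
    rw [norm_sub_rev ((x - y) * a), norm_mul] at h4
    nlinarith
  · rintro x ⟨-, hx⟩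
    have : ‖p.derivative.eval x‖ < (1 + e) * ‖a‖ := hx
    rw [hκe] at this
    linarith

/-- The regular set is a countable union of disjoint Borel sets on which `p` is injective and close
to a similarity. -/
lemma exists_regularSet_partition (p : ℂ[X]) {κ : ℝ} (hκ : 1 < κ) :
    ∃ V : ℕ → Set ℂ, (∀ i, MeasurableSet (V i)) ∧ Pairwise (Function.onFun Disjoint V) ∧
      (⋃ i, V i) = regularSet p ∧
      ∀ i, ∃ c : ℝ, 0 < c ∧ (∀ x ∈ V i, ∀ y ∈ V i, c * ‖x - y‖ ≤ ‖p.eval x - p.eval y‖) ∧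
        ∀ x ∈ V i, ‖p.derivative.eval x‖ ≤ κ * c := by
  choose! U hU c hc h1 h2 using fun z (hz : z ∈ regularSet p) => exists_nhds_antilipschitz p hκ hz
  rcases (regularSet p).eq_empty_or_nonempty with he | hne
  · refine ⟨fun _ => ∅, fun _ => MeasurableSet.empty, fun i j _ => by simp [Function.onFun], by
      simp [he], fun i => ⟨1, one_pos, by simp, by simp⟩⟩
  obtain ⟨t, hts, htc, hcov⟩ := TopologicalSpace.countable_cover_nhdsWithin
    (f := fun z => interior (U z)) (s := regularSet p)
    (fun z hz => mem_nhdsWithin_of_mem_nhds (interior_mem_nhds.2 (hU z hz)))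
  have htne : t.Nonempty := by
    obtain ⟨z, hz⟩ := hne
    obtain ⟨y, hy, -⟩ := mem_iUnion₂.1 (hcov hz)
    exact ⟨y, hy⟩
  obtain ⟨f, rfl⟩ := htc.exists_eq_range htne
  set W : ℕ → Set ℂ := fun i => interior (U (f i)) ∩ regularSet p with hW
  have hWm : ∀ i, MeasurableSet (W i) := fun i =>
    (isOpen_interior.inter (isOpen_regularSet p)).measurableSet
  have hsub : ∀ i, disjointed W i ⊆ U (f i) := fun i =>
    (disjointed_subset W i).trans (inter_subset_left.trans interior_subset)
  have hf : ∀ i, f i ∈ regularSet p := fun i => hts ⟨i, rfl⟩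
  refine ⟨disjointed W, fun i => MeasurableSet.disjointed hWm i, disjoint_disjointed W, ?_, ?_⟩
  · rw [iUnion_disjointed]
    apply Subset.antisymm
    · exact iUnion_subset fun i => inter_subset_right
    · intro z hz
      obtain ⟨y, ⟨i, rfl⟩, hy⟩ := mem_iUnion₂.1 (hcov hz)
      exact mem_iUnion.2 ⟨i, hy, hz⟩
  · intro i
    exact ⟨c (f i), hc _ (hf i), fun x hx y hy => h1 _ (hf i) x (hsub i hx) y (hsub i hy),
      fun x hx => h2 _ (hf i) x (hsub i hx)⟩

lemma injOn_of_antilipschitz {f : ℂ → ℂ} {s : Set ℂ} {c : ℝ} (hc : 0 < c)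
    (h : ∀ x ∈ s, ∀ y ∈ s, c * ‖x - y‖ ≤ ‖f x - f y‖) : InjOn f s := by
  intro x hx y hy hxy
  have := h x hx y hy
  rw [hxy, sub_self, norm_zero] at this
  have h0 : ‖x - y‖ ≤ 0 := by
    by_contra hlt
    push Not at hlt
    nlinarith [mul_pos hc hlt]
  exact sub_eq_zero.1 (norm_le_zero_iff.1 h0)

/-- The sum of `F` over the regular points of the fibre of `p` above `w`. -/
noncomputable def fiberSum (p : ℂ[X]) (F : ℂ → ℝ≥0∞) (w : ℂ) : ℝ≥0∞ :=
  ∫⁻ z in {z | p.eval z = w} ∩ regularSet p, F z ∂Measure.count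

lemma measurableSet_fiber (p : ℂ[X]) (w : ℂ) : MeasurableSet {z | p.eval z = w} :=
  (isClosed_eq p.continuous continuous_const).measurableSet

lemma fiberSum_eq_tsum (p : ℂ[X]) (F : ℂ → ℝ≥0∞) {V : ℕ → Set ℂ} (hV : ∀ i, MeasurableSet (V i))
    (hd : Pairwise (Function.onFun Disjoint V)) (hU : (⋃ i, V i) = regularSet p) (w : ℂ) :
    fiberSum p F w = ∑' i, ∫⁻ z in {z | p.eval z = w} ∩ V i, F z ∂Measure.count := by
  rw [fiberSum, ← hU, inter_iUnion, lintegral_iUnion]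
  · exact fun i => (measurableSet_fiber p w).inter (hV i)
  · exact fun i j hij => (hd hij).mono inter_subset_right inter_subset_right

/-- On a set where `p` is injective, a fibre integral is the value at the inverse image. -/
lemma lintegral_count_fiber (p : ℂ[X]) (F : ℂ → ℝ≥0∞) {V : Set ℂ} (hinj : InjOn (p.eval ·) V) (w : ℂ) :
    ∫⁻ z in {z | p.eval z = w} ∩ V, F z ∂Measure.count =
      ((p.eval ·) '' V).indicator (fun w => F (Function.invFunOn (p.eval ·) V w)) w := by
  by_cases hw : w ∈ (p.eval ·) '' V
  · rw [indicator_of_mem hw]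
    have h1 := Function.invFunOn_mem hw
    have h2 : p.eval (Function.invFunOn (p.eval ·) V w) = w := Function.invFunOn_eq hw
    have : {z | p.eval z = w} ∩ V = {Function.invFunOn (p.eval ·) V w} := by
      ext z
      constructor
      · rintro ⟨hz, hzV⟩
        exact hinj hzV h1 (hz.trans h2.symm)
      · rintro rfl
        exact ⟨h2, h1⟩
    rw [this, Measure.restrict_singleton]
    simp
  · rw [indicator_of_notMem hw]
    have : {z | p.eval z = w} ∩ V = ∅ := by
      ext z
      simp only [mem_inter_iff, mem_ofPred_eq, mem_empty_iff_false, iff_false, not_and]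
      exact fun h1 h2 => hw ⟨z, h2, h1⟩
    simp [this]

/-- For `a > 0` the superlevel set is the image of a Borel set under an injective continuous map,
hence Borel by Lusin–Souslin. The level `a = 0` is separate because the indicator reaches it
everywhere. -/
lemma measurable_indicator_invFunOn (p : ℂ[X]) {F : ℂ → ℝ≥0∞} (hF : Measurable F) {V : Set ℂ}
    (hV : MeasurableSet V) (hinj : InjOn (p.eval ·) V) :
    Measurable (((p.eval ·) '' V).indicator (fun w => F (Function.invFunOn (p.eval ·) V w))) := by
  have him : ∀ B, MeasurableSet B → B ⊆ V → MeasurableSet ((p.eval ·) '' B) := fun B hB hBV =>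
    hB.image_of_continuousOn_injOn p.continuous.continuousOn (hinj.mono hBV)
  apply measurable_of_Ici
  intro a
  rcases eq_or_ne a 0 with rfl | ha
  · convert MeasurableSet.univ
    simp
  · convert him (V ∩ F ⁻¹' (Ici a)) (hV.inter (hF measurableSet_Ici)) inter_subset_left using 1
    ext w
    simp only [mem_preimage, mem_Ici, mem_image, mem_inter_iff]
    constructor
    · intro hw
      by_cases hwV : w ∈ (p.eval ·) '' V
      · rw [indicator_of_mem hwV] at hw
        exact ⟨_, ⟨Function.invFunOn_mem hwV, hw⟩, Function.invFunOn_eq hwV⟩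
      · rw [indicator_of_notMem hwV] at hw
        exact absurd (le_zero_iff.1 hw) ha
    · rintro ⟨z, ⟨hzV, hz⟩, rfl⟩
      rw [indicator_of_mem (mem_image_of_mem (p.eval ·) hzV)]
      rwa [hinj.leftInvOn_invFunOn hzV]

lemma abs_det_smulRight_complex (a : ℂ) :
    |((ContinuousLinearMap.toSpanSingleton ℂ a).restrictScalars ℝ).det| = ‖a‖ ^ 2 := by
  have : ((ContinuousLinearMap.toSpanSingleton ℂ a).restrictScalars ℝ).det = ‖a‖ ^ 2 := by
    rw [ContinuousLinearMap.det, ← LinearMap.det_toMatrix Complex.basisOneI, Matrix.det_fin_two]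
    simp [LinearMap.toMatrix_apply, ← Complex.normSq_eq_norm_sq, Complex.normSq_apply]
  rw [this, abs_of_nonneg (by positivity)]

lemma lintegral_area_formula_piece (p : ℂ[X]) (F : ℂ → ℝ≥0∞) {V : Set ℂ}
    (hV : MeasurableSet V) (hinj : InjOn (p.eval ·) V) :
    ∫⁻ z in V, F z * ENNReal.ofReal (‖p.derivative.eval z‖ ^ 2) =
      ∫⁻ w, ((p.eval ·) '' V).indicator (fun w => F (Function.invFunOn (p.eval ·) V w)) w := by
  have hmeas : MeasurableSet ((p.eval ·) '' V) :=
    hV.image_of_continuousOn_injOn p.continuous.continuousOn hinj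
  rw [lintegral_indicator hmeas, lintegral_image_eq_lintegral_abs_det_fderiv_mul volume hV
    (fun z _ => ((p.hasDerivAt z).hasFDerivAt.restrictScalars ℝ).hasFDerivWithinAt) hinj]
  refine setLIntegral_congr_fun hV fun z hz => ?_
  rw [abs_det_smulRight_complex, mul_comm, hinj.leftInvOn_invFunOn hz]

/-- The area formula for the map `z ↦ p z`. -/
lemma lintegral_area_formula (p : ℂ[X]) {F : ℂ → ℝ≥0∞} (hF : Measurable F) :
    ∫⁻ z in regularSet p, F z * ENNReal.ofReal (‖p.derivative.eval z‖ ^ 2) =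
      ∫⁻ w, fiberSum p F w := by
  obtain ⟨V, hV, hd, hU, hc⟩ := exists_regularSet_partition p (κ := 2) (by norm_num)
  have hinj : ∀ i, InjOn (p.eval ·) (V i) := fun i => by
    obtain ⟨c, hc0, h1, -⟩ := hc i
    exact injOn_of_antilipschitz hc0 h1
  simp_rw [fiberSum_eq_tsum p F hV hd hU, lintegral_count_fiber p F (hinj _)]
  rw [lintegral_tsum fun i => (measurable_indicator_invFunOn p hF (hV i) (hinj i)).aemeasurable,
    ← hU, lintegral_iUnion hV hd]
  exact tsum_congr fun i => lintegral_area_formula_piece p F (hV i) (hinj i)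

/-! ### Length as an integral of the fibre density; semicontinuity in the radius -/

/-- The density of the length of the level curves of `|p|`, summed over the fibres of `p`. -/
noncomputable def fiberLength (p : ℂ[X]) : ℂ → ℝ≥0∞ :=
  fiberSum p fun z => ENNReal.ofReal ‖p.derivative.eval z‖⁻¹

lemma measurable_inv_norm_derivative (p : ℂ[X]) :
    Measurable fun z => ENNReal.ofReal ‖p.derivative.eval z‖⁻¹ :=
  (p.derivative.continuous.measurable.norm.inv).ennreal_ofReal

lemma finite_fiber {p : ℂ[X]} (hn : p.natDegree ≠ 0) (w : ℂ) : {z | p.eval z = w}.Finite := by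
  have h : p - C w ≠ 0 := by
    intro h
    rw [sub_eq_zero.1 h] at hn
    exact hn (natDegree_C w)
  refine ((p - C w).roots.toFinset.finite_toSet).subset fun z hz => ?_
  have hz' : p.eval z = w := hz
  simp [h, hz']

lemma fiberSum_eq_sum (p : ℂ[X]) (F : ℂ → ℝ≥0∞) {w : ℂ} {s : Finset ℂ}
    (hs : (s : Set ℂ) = {z | p.eval z = w} ∩ regularSet p) :
    fiberSum p F w = ∑ z ∈ s, F z := by
  rw [fiberSum, ← hs, lintegral_finset]
  simp

lemma sum_le_fiberSum (p : ℂ[X]) (F : ℂ → ℝ≥0∞) {w : ℂ} {s : Finset ℂ}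
    (hs : (s : Set ℂ) ⊆ {z | p.eval z = w} ∩ regularSet p) :
    ∑ z ∈ s, F z ≤ fiberSum p F w := by
  calc ∑ z ∈ s, F z = ∫⁻ z in (s : Set ℂ), F z ∂Measure.count := by
        rw [lintegral_finset]; simp
    _ ≤ _ := lintegral_mono_set hs

/-- As `p` is open, every regular preimage of `w₀` persists as a regular preimage of nearby `w`, and
disjoint neighbourhoods keep these distinct. Further preimages of `w`, born near critical points,
only add to the sum. Continuity cannot be expected at critical values, and the lemniscate may pass
through critical points. -/
lemma lowerSemicontinuous_fiberLength {p : ℂ[X]} (hn : p.natDegree ≠ 0) :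
    LowerSemicontinuous (fiberLength p) := by
  intro w₀ y hy
  set g : ℂ → ℝ≥0∞ := fun z => ENNReal.ofReal ‖p.derivative.eval z‖⁻¹ with hg
  have hfin : ({z | p.eval z = w₀} ∩ regularSet p).Finite := (finite_fiber hn w₀).inter_of_left _
  set s := hfin.toFinset with hs
  have hscoe : (s : Set ℂ) = {z | p.eval z = w₀} ∩ regularSet p := hfin.coe_toFinset
  have hsreg : ∀ z ∈ s, p.derivative.eval z ≠ 0 := fun z hz => (hfin.mem_toFinset.1 hz).2
  rw [fiberLength, fiberSum_eq_sum p g hscoe] at hy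
  -- the values of `g` may be moved independently
  have hcont : Tendsto (fun f : ℂ → ℂ => ∑ z ∈ s, g (f z)) (Filter.pi fun z => 𝓝 z)
      (𝓝 (∑ z ∈ s, g z)) := by
    refine tendsto_finsetSum s fun z hz => ?_
    have h1 : ContinuousAt g z := by
      apply ENNReal.continuous_ofReal.continuousAt.comp
      exact (p.derivative.continuous.norm.continuousAt).inv₀ (norm_ne_zero_iff.2 (hsreg z hz))
    exact h1.tendsto.comp (tendsto_eval_pi _ z)
  have hev := hcont.eventually (lt_mem_nhds hy)
  obtain ⟨I, -, U, hU, hIU⟩ := Filter.mem_pi.1 hev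
  obtain ⟨D, hD, hdisj⟩ := s.finite_toSet.t2_separation
  set W : ℂ → Set ℂ := fun z => interior (U z) ∩ D z ∩ regularSet p with hW
  have hWopen : ∀ z, IsOpen (W z) := fun z =>
    (isOpen_interior.inter (hD z).2).inter (isOpen_regularSet p)
  have hmap := (p.isOpenQuotientMap_eval hn).isOpenMap
  have : ∀ᶠ w in 𝓝 w₀, ∀ z ∈ s, w ∈ (fun x => p.eval x) '' W z := by
    rw [Filter.eventually_all_finset]
    intro z hz
    have hz' : p.eval z = w₀ := (hfin.mem_toFinset.1 hz).1
    refine (hmap _ (hWopen z)).mem_nhds ⟨z, ⟨⟨mem_interior_iff_mem_nhds.2 (hU z), (hD z).1⟩,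
      hsreg z hz⟩, hz'⟩
  filter_upwards [this] with w hw
  choose! f hfW hfw using hw
  have hinj : Set.InjOn f s := by
    intro a ha b hb hab
    by_contra hne
    have := hdisj ha hb hne
    exact disjoint_left.1 this (hfW a ha).1.2 (hab ▸ (hfW b hb).1.2)
  classical
  have h1 : ∑ z ∈ s, g (f z) ≤ fiberSum p g w := by
    rw [← Finset.sum_image (f := g) hinj]
    apply sum_le_fiberSum
    intro x hx
    rw [Finset.coe_image] at hx
    obtain ⟨z, hz, rfl⟩ := hx
    exact ⟨hfw z hz, (hfW z hz).2⟩
  refine lt_of_lt_of_le ?_ h1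
  have h2 : (fun z => if z ∈ s then f z else z) ∈ Set.pi I U := by
    intro z _
    by_cases hz : z ∈ s
    · simpa [hz] using interior_subset (hfW z hz).1.1
    · simpa [hz] using mem_of_mem_nhds (hU z)
  have h3 := hIU h2
  have h4 : ∑ z ∈ s, g (if z ∈ s then f z else z) = ∑ z ∈ s, g (f z) :=
    Finset.sum_congr rfl fun z hz => by rw [if_pos hz]
  rw [← h4]
  exact h3

lemma norm_exp_mul_I_sub_le (a b : ℝ) :
    ‖Complex.exp (a * Complex.I) - Complex.exp (b * Complex.I)‖ ≤ |a - b| := by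
  have h : Complex.exp (a * Complex.I) - Complex.exp (b * Complex.I) =
      Complex.exp (b * Complex.I) * (Complex.exp (Complex.I * ((a - b : ℝ) : ℂ)) - 1) := by
    rw [mul_sub, ← Complex.exp_add]
    push_cast
    ring_nf
  rw [h, norm_mul, Complex.norm_exp_ofReal_mul_I, one_mul]
  exact Real.norm_exp_I_mul_ofReal_sub_one_le

/-- The piece is the image of a set of angles under a local inverse of `p`, which is
`c⁻¹`-Lipschitz. The bound `|p'| ≤ κ c` then trades `c⁻¹` for the density `κ/|p'|`. -/
lemma hausdorffMeasure_lemniscate_piece (p : ℂ[X]) {κ c : ℝ} (hκ : 1 < κ) {V : Set ℂ}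
    (hV : MeasurableSet V) (hVreg : V ⊆ regularSet p) (hc : 0 < c)
    (h1 : ∀ x ∈ V, ∀ y ∈ V, c * ‖x - y‖ ≤ ‖p.eval x - p.eval y‖)
    (h2 : ∀ x ∈ V, ‖p.derivative.eval x‖ ≤ κ * c) :
    Measure.hausdorffMeasure 1 (lemniscate p ∩ V) ≤ ENNReal.ofReal κ *
      ∫⁻ θ in Ioc (-Real.pi) Real.pi, ∫⁻ z in {z | p.eval z = Complex.exp (θ * Complex.I)} ∩ V,
        ENNReal.ofReal ‖p.derivative.eval z‖⁻¹ ∂Measure.count := by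
  have hinj : InjOn (p.eval ·) V := injOn_of_antilipschitz hc h1
  set E : ℝ → ℂ := fun θ => Complex.exp (θ * Complex.I) with hE
  have hEc : Continuous E := by fun_prop
  set q := Function.invFunOn (p.eval ·) V with hq
  set B := (p.eval ·) '' V with hB
  have hBm : MeasurableSet B := hV.image_of_continuousOn_injOn p.continuous.continuousOn hinj
  set A : Set ℝ := Ioc (-Real.pi) Real.pi ∩ E ⁻¹' B with hA
  have hAm : MeasurableSet A := measurableSet_Ioc.inter (hEc.measurable hBm)
  have hlip : LipschitzOnWith (Real.toNNReal c⁻¹) (q ∘ E) A := by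
    refine LipschitzOnWith.of_dist_le_mul fun x hx y hy => ?_
    have hqx : q (E x) ∈ V := Function.invFunOn_mem hx.2
    have hqy : q (E y) ∈ V := Function.invFunOn_mem hy.2
    have e1 : p.eval (q (E x)) = E x := Function.invFunOn_eq hx.2
    have e2 : p.eval (q (E y)) = E y := Function.invFunOn_eq hy.2
    have h3 := h1 _ hqx _ hqy
    rw [e1, e2] at h3
    have h4 := h3.trans (norm_exp_mul_I_sub_le x y)
    rw [Real.coe_toNNReal _ (by positivity), dist_eq_norm, Real.dist_eq, Function.comp,
      Function.comp, inv_mul_eq_div, le_div_iff₀ hc]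
    linarith
  have hsub : lemniscate p ∩ V ⊆ (q ∘ E) '' A := by
    rintro z ⟨hz, hzV⟩
    have hz1 : ‖p.eval z‖ = 1 := hz
    have hEz : E (Complex.arg (p.eval z)) = p.eval z := by
      have := Complex.norm_mul_exp_arg_mul_I (p.eval z)
      rwa [hz1, Complex.ofReal_one, one_mul] at this
    refine ⟨Complex.arg (p.eval z), ⟨Complex.arg_mem_Ioc _, ?_⟩, ?_⟩
    · rw [mem_preimage, hEz]; exact ⟨z, hzV, rfl⟩
    · rw [Function.comp, hEz]; exact hinj.leftInvOn_invFunOn hzV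
  calc Measure.hausdorffMeasure 1 (lemniscate p ∩ V)
      ≤ Measure.hausdorffMeasure 1 ((q ∘ E) '' A) := measure_mono hsub
    _ ≤ (Real.toNNReal c⁻¹ : ℝ≥0∞) ^ (1 : ℝ) * Measure.hausdorffMeasure 1 A :=
        hlip.hausdorffMeasure_image_le zero_le_one
    _ = ∫⁻ θ in A, ENNReal.ofReal c⁻¹ := by
        rw [ENNReal.rpow_one, hausdorffMeasure_real, setLIntegral_const]; rfl
    _ ≤ ∫⁻ θ in A, ENNReal.ofReal κ * ENNReal.ofReal ‖p.derivative.eval (q (E θ))‖⁻¹ := by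
        refine setLIntegral_mono_ae' hAm (Eventually.of_forall fun θ hθ => ?_)
        rw [← ENNReal.ofReal_mul (by linarith)]
        apply ENNReal.ofReal_le_ofReal
        have hqV : q (E θ) ∈ V := Function.invFunOn_mem hθ.2
        have hpos : 0 < ‖p.derivative.eval (q (E θ))‖ := norm_pos_iff.2 (hVreg hqV)
        have := h2 _ hqV
        rw [inv_eq_one_div, ← div_eq_mul_inv, div_le_div_iff₀ hc hpos]
        linarith
    _ = _ := by
        rw [lintegral_const_mul' _ _ ENNReal.ofReal_ne_top, hA, inter_comm, 
          ← Measure.restrict_restrict (hEc.measurable hBm), 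
          ← lintegral_indicator (hEc.measurable hBm)]
        simp_rw [lintegral_count_fiber p _ hinj]
        rfl

/-- The length of the lemniscate is at most the integral of the fibre density over the circle. -/
lemma lemniscateLength_le_lintegral {p : ℂ[X]} (hn : p.natDegree ≠ 0) :
    lemniscateLength p ≤
      ∫⁻ θ in Ioc (-Real.pi) Real.pi, fiberLength p (Complex.exp (θ * Complex.I)) := by
  -- The partition depends on `κ`, but the integral on the right does not, so `κ` may tend to `1` at
  -- the end.
  have key : ∀ κ : ℝ, 1 < κ → lemniscateLength p ≤ ENNReal.ofReal κ *
      ∫⁻ θ in Ioc (-Real.pi) Real.pi, fiberLength p (Complex.exp (θ * Complex.I)) := by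
    intro κ hκ
    obtain ⟨V, hV, hd, hU, hc⟩ := exists_regularSet_partition p hκ
    have hinj : ∀ i, InjOn (p.eval ·) (V i) := fun i => by
      obtain ⟨c, hc0, h1, -⟩ := hc i
      exact injOn_of_antilipschitz hc0 h1
    have hcover : lemniscate p ⊆ (regularSet p)ᶜ ∪ ⋃ i, lemniscate p ∩ V i := by
      intro z hz
      by_cases h : z ∈ regularSet p
      · rw [← hU] at h
        obtain ⟨i, hi⟩ := mem_iUnion.1 h
        exact Or.inr (mem_iUnion.2 ⟨i, hz, hi⟩)
      · exact Or.inl h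
    have hzero : Measure.hausdorffMeasure 1 (regularSet p)ᶜ = 0 := by
      have := Measure.nullSingletonClass_hausdorff ℂ (d := 1) one_pos
      exact (finite_compl_regularSet (derivative_ne_zero_of_natDegree hn)).measure_zero _
    calc lemniscateLength p
        ≤ Measure.hausdorffMeasure 1 ((regularSet p)ᶜ ∪ ⋃ i, lemniscate p ∩ V i) :=
          measure_mono hcover
      _ ≤ 0 + ∑' i, Measure.hausdorffMeasure 1 (lemniscate p ∩ V i) := by
          refine (measure_union_le _ _).trans ?_
          rw [hzero]
          gcongr
          exact measure_iUnion_le _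
      _ ≤ ∑' i, ENNReal.ofReal κ * ∫⁻ θ in Ioc (-Real.pi) Real.pi,
            ∫⁻ z in {z | p.eval z = Complex.exp (θ * Complex.I)} ∩ V i,
              ENNReal.ofReal ‖p.derivative.eval z‖⁻¹ ∂Measure.count := by
          rw [zero_add]
          refine ENNReal.tsum_le_tsum fun i => ?_
          obtain ⟨c, hc0, h1, h2⟩ := hc i
          exact hausdorffMeasure_lemniscate_piece p hκ (hV i) (hU ▸ subset_iUnion V i) hc0 h1 h2
      _ = _ := by
          rw [ENNReal.tsum_mul_left, ← lintegral_tsum]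
          · simp_rw [fiberLength, fiberSum_eq_tsum p _ hV hd hU]
          · intro i
            simp_rw [lintegral_count_fiber p _ (hinj i)]
            exact ((measurable_indicator_invFunOn p (measurable_inv_norm_derivative p) (hV i)
              (hinj i)).comp (by fun_prop)).aemeasurable
  have hlim : Tendsto (fun κ : ℝ => ENNReal.ofReal κ *
      ∫⁻ θ in Ioc (-Real.pi) Real.pi, fiberLength p (Complex.exp (θ * Complex.I))) (𝓝[>] 1)
      (𝓝 (1 * ∫⁻ θ in Ioc (-Real.pi) Real.pi, fiberLength p (Complex.exp (θ * Complex.I)))) := by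
    apply ENNReal.Tendsto.mul_const
    · rw [← ENNReal.ofReal_one]
      exact (ENNReal.continuous_ofReal.tendsto 1).mono_left nhdsWithin_le_nhds
    · exact Or.inl one_ne_zero
  rw [one_mul] at hlim
  exact ge_of_tendsto hlim (by filter_upwards [self_mem_nhdsWithin] with κ hκ using key κ hκ)

/-- The angular integral of the fibre density is lower semicontinuous in the radius. -/
lemma eventually_lt_lintegral_fiberLength {p : ℂ[X]} (hn : p.natDegree ≠ 0) {b : ℝ≥0∞}
    (hb : b < ∫⁻ θ in Ioc (-Real.pi) Real.pi, fiberLength p (Complex.exp (θ * Complex.I))) :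
    ∀ᶠ ρ : ℝ in 𝓝 1,
      b < ∫⁻ θ in Ioc (-Real.pi) Real.pi, fiberLength p (ρ * Complex.exp (θ * Complex.I)) := by
  have hlsc := lowerSemicontinuous_fiberLength hn
  -- The negation supplies a sequence of radii, to which Fatou's lemma applies.
  by_contra hcon
  rw [Filter.not_eventually] at hcon
  obtain ⟨ρ, hρ, hρb⟩ := Filter.exists_seq_forall_of_frequently hcon
  have hle : ∀ θ : ℝ, fiberLength p (Complex.exp (θ * Complex.I)) ≤
      liminf (fun k => fiberLength p (ρ k * Complex.exp (θ * Complex.I))) atTop := by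
    intro θ
    have ht : Tendsto (fun k => (ρ k : ℂ) * Complex.exp (θ * Complex.I)) atTop
        (𝓝 (Complex.exp (θ * Complex.I))) := by
      have : Tendsto (fun k => (ρ k : ℂ)) atTop (𝓝 ((1 : ℝ) : ℂ)) :=
        (Complex.continuous_ofReal.tendsto 1).comp hρ
      simpa using this.mul_const (Complex.exp (θ * Complex.I))
    refine le_of_forall_lt fun y hy => ?_
    obtain ⟨y', hy1, hy2⟩ := exists_between hy
    exact hy1.trans_le (le_liminf_of_le (by isBoundedDefault)
      ((ht.eventually (hlsc _ y' hy2)).mono fun k hk => hk.le))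
  have := calc
    ∫⁻ θ in Ioc (-Real.pi) Real.pi, fiberLength p (Complex.exp (θ * Complex.I))
      ≤ ∫⁻ θ in Ioc (-Real.pi) Real.pi,
          liminf (fun k => fiberLength p (ρ k * Complex.exp (θ * Complex.I))) atTop :=
        lintegral_mono hle
    _ ≤ liminf (fun k => ∫⁻ θ in Ioc (-Real.pi) Real.pi,
          fiberLength p (ρ k * Complex.exp (θ * Complex.I))) atTop := by
        apply lintegral_liminf_le
        intro k
        exact hlsc.measurable.comp (by fun_prop)
    _ ≤ b := by
        refine liminf_le_of_le (by isBoundedDefault) fun y hy => ?_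
        obtain ⟨k, hk⟩ := hy.exists
        exact hk.trans (not_lt.1 (hρb k))
  exact absurd hb (not_lt.2 this)

/-! ### Coarea formula and the Dirichlet integral over a sublevel set -/

lemma volume_compl_regularSet {p : ℂ[X]} (hn : p.natDegree ≠ 0) :
    volume (regularSet p)ᶜ = 0 :=
  (finite_compl_regularSet (derivative_ne_zero_of_natDegree hn)).measure_zero _

lemma setLIntegral_regularSet {p : ℂ[X]} (hn : p.natDegree ≠ 0) (F : ℂ → ℝ≥0∞) :
    ∫⁻ z in regularSet p, F z = ∫⁻ z, F z := by
  rw [Measure.restrict_eq_self_of_ae_mem]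
  exact measure_eq_zero_iff_ae_notMem.1 (volume_compl_regularSet hn) |>.mono fun z hz => by
    simpa using hz

/-- A coarea formula for `p`. -/
lemma lintegral_coarea {p : ℂ[X]} (hn : p.natDegree ≠ 0) {H : ℂ → ℝ≥0∞} (hH : Measurable H) :
    ∫⁻ z, H (p.eval z) * ENNReal.ofReal ‖p.derivative.eval z‖ = ∫⁻ w, H w * fiberLength p w := by
  have h := lintegral_area_formula p (F := fun z => H (p.eval z) *
    ENNReal.ofReal ‖p.derivative.eval z‖⁻¹)
    ((hH.comp p.continuous.measurable).mul (measurable_inv_norm_derivative p))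
  rw [← setLIntegral_regularSet hn]
  convert h using 1
  · refine setLIntegral_congr_fun (isOpen_regularSet p).measurableSet fun z hz => ?_
    rw [mul_assoc, ← ENNReal.ofReal_mul (by positivity)]
    congr 2
    have : ‖p.derivative.eval z‖ ≠ 0 := norm_ne_zero_iff.2 hz
    field_simp
  · refine lintegral_congr fun w => ?_
    rw [fiberLength, fiberSum, fiberSum, ← lintegral_const_mul _ (measurable_inv_norm_derivative p)]
    refine setLIntegral_congr_fun ((measurableSet_fiber p w).inter
      (isOpen_regularSet p).measurableSet) fun z hz => ?_
    have : p.eval z = w := hz.1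
    simp only [this]

lemma fiberSum_one_le {p : ℂ[X]} (hn : p.natDegree ≠ 0) (w : ℂ) :
    fiberSum p 1 w ≤ p.natDegree := by
  classical
  have h : p - C w ≠ 0 := by
    intro h
    rw [sub_eq_zero.1 h] at hn
    exact hn (natDegree_C w)
  have hfin : ({z | p.eval z = w} ∩ regularSet p).Finite := (finite_fiber hn w).inter_of_left _
  rw [fiberSum_eq_sum p 1 hfin.coe_toFinset]
  simp only [Pi.one_apply, Finset.sum_const, nsmul_eq_mul, mul_one, Nat.cast_le]
  calc hfin.toFinset.card ≤ (p - C w).roots.toFinset.card := by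
        refine Finset.card_le_card fun z hz => ?_
        have hz' : p.eval z = w := (hfin.mem_toFinset.1 hz).1
        simp [h, hz']
    _ ≤ (p - C w).roots.card := Multiset.toFinset_card_le _
    _ ≤ (p - C w).natDegree := card_roots' _
    _ = p.natDegree := natDegree_sub_C

/-- The integral is the area of the disc of radius `R` counted with the multiplicity of `p`, which
is at most the degree. It serves to control `∫ |p'|`. -/
lemma lintegral_norm_derivative_sq_le {p : ℂ[X]} (hn : p.natDegree ≠ 0) {R : ℝ} (hR : 0 ≤ R) :
    ∫⁻ z in {z | ‖p.eval z‖ ≤ R}, ENNReal.ofReal (‖p.derivative.eval z‖ ^ 2) ≤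
      ENNReal.ofReal (Real.pi * R ^ 2 * p.natDegree) := by
  have hm : MeasurableSet {z : ℂ | ‖p.eval z‖ ≤ R} :=
    (isClosed_le p.continuous.norm continuous_const).measurableSet
  set F : ℂ → ℝ≥0∞ := {z : ℂ | ‖p.eval z‖ ≤ R}.indicator 1 with hF
  have h := lintegral_area_formula p (F := F) (measurable_one.indicator hm)
  rw [setLIntegral_regularSet hn] at h
  have h1 : ∀ w, fiberSum p F w ≤ (Metric.closedBall (0 : ℂ) R).indicator
      (fun _ => (p.natDegree : ℝ≥0∞)) w := by
    intro w
    by_cases hw : w ∈ Metric.closedBall (0 : ℂ) R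
    · rw [indicator_of_mem hw]
      refine le_trans (lintegral_mono fun z => ?_) (fiberSum_one_le hn w)
      exact indicator_le_self' (fun _ _ => zero_le) z
    · rw [indicator_of_notMem hw, fiberSum]
      apply le_of_eq
      rw [setLIntegral_congr_fun (g := fun _ => 0) ((measurableSet_fiber p w).inter
        (isOpen_regularSet p).measurableSet) _, lintegral_zero]
      intro z hz
      have hz' : p.eval z = w := hz.1
      rw [hF, indicator_of_notMem]
      simpa [hz'] using hw
  calc _ = ∫⁻ z, F z * ENNReal.ofReal (‖p.derivative.eval z‖ ^ 2) := by
        rw [← lintegral_indicator hm]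
        refine lintegral_congr fun z => ?_
        by_cases hz : z ∈ {z : ℂ | ‖p.eval z‖ ≤ R}
        · rw [hF, indicator_of_mem hz, indicator_of_mem hz, Pi.one_apply, one_mul]
        · rw [hF, indicator_of_notMem hz, indicator_of_notMem hz, zero_mul]
    _ ≤ ∫⁻ w, (Metric.closedBall (0 : ℂ) R).indicator (fun _ => (p.natDegree : ℝ≥0∞)) w := by
        rw [h]; exact lintegral_mono h1
    _ = _ := by
        rw [lintegral_indicator Metric.isClosed_closedBall.measurableSet, setLIntegral_const,
          Complex.volume_closedBall, ENNReal.ofReal_mul (by positivity),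
          ENNReal.ofReal_mul Real.pi_pos.le, ENNReal.ofReal_natCast, ENNReal.ofReal_pow hR,
          mul_comm, mul_comm (ENNReal.ofReal Real.pi)]
        congr 2
        rw [ENNReal.ofReal, Real.toNNReal_of_nonneg Real.pi_pos.le]; rfl

/-! ### Rearrangement bounds and the Ahlfors–Beurling inequality -/

lemma lintegral_ofReal_sub_mul {a c : ℝ} (ha : 0 ≤ a) (hc : 0 < c) :
    ∫⁻ r in Ioi (0 : ℝ), ENNReal.ofReal (a - c * r) = ENNReal.ofReal (a ^ 2 / (2 * c)) := by
  have hac : 0 ≤ a / c := by positivity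
  have h0 : ∀ r ∈ Ioi (a / c), ENNReal.ofReal (a - c * r) = 0 := fun r hr => by
    rw [ENNReal.ofReal_eq_zero]
    have := (div_lt_iff₀ hc).1 hr
    linarith
  rw [← Ioc_union_Ioi_eq_Ioi hac, lintegral_union measurableSet_Ioi
    (Set.disjoint_left.2 fun r hr hr' => not_lt.2 hr.2 hr'),
    setLIntegral_congr_fun measurableSet_Ioi h0, lintegral_zero, add_zero,
    ← ofReal_integral_eq_lintegral_ofReal]
  · congr 1
    rw [← intervalIntegral.integral_of_le hac, intervalIntegral.integral_sub (by simp)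
      (Continuous.intervalIntegrable (by fun_prop) _ _), intervalIntegral.integral_const_mul,
      integral_id, intervalIntegral.integral_const]
    simp only [smul_eq_mul]
    field_simp
    ring
  · exact (Continuous.integrableOn_Ioc (by fun_prop))
  · rw [EventuallyLE, ae_restrict_iff' measurableSet_Ioc]
    refine Eventually.of_forall fun r hr => ?_
    have := (le_div_iff₀ hc).1 hr.2
    simp only [Pi.zero_apply]
    linarith

lemma lintegral_polar (f : ℂ → ℝ≥0∞) (hf : Measurable f) :
    ∫⁻ z, f z = ∫⁻ θ in Ioo (-Real.pi) Real.pi, ∫⁻ r in Ioi (0 : ℝ),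
      ENNReal.ofReal r * f (r * Complex.exp (θ * Complex.I)) := by
  rw [← Complex.lintegral_comp_polarCoord_symm, polarCoord_target, Measure.volume_eq_prod,
    ← Measure.prod_restrict, lintegral_prod_symm]
  · simp only [smul_eq_mul, Complex.polarCoord_symm_apply, Complex.exp_mul_I, Complex.ofReal_cos,
      Complex.ofReal_sin]
  · refine Measurable.aemeasurable ?_
    simp only [smul_eq_mul, Complex.polarCoord_symm_apply]
    apply Measurable.mul (by fun_prop)
    apply hf.comp
    fun_prop

/-- The positive part lives on the disc of radius `1/c`. This is the excess term of the bathtub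
argument: on any set the kernel is at most `c` plus this positive part. -/
lemma lintegral_ofReal_inv_norm_sub {c : ℝ} (hc : 0 < c) (ξ : ℂ) :
    ∫⁻ z : ℂ, ENNReal.ofReal (‖z - ξ‖⁻¹ - c) = ENNReal.ofReal (Real.pi / c) := by
  rw [lintegral_sub_right_eq_self (fun z : ℂ => ENNReal.ofReal (‖z‖⁻¹ - c)) ξ,
    lintegral_polar _ (by fun_prop)]
  have h : ∀ θ : ℝ, ∫⁻ r in Ioi (0 : ℝ), ENNReal.ofReal r *
      ENNReal.ofReal (‖(r : ℂ) * Complex.exp (θ * Complex.I)‖⁻¹ - c) =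
      ENNReal.ofReal (1 / (2 * c)) := by
    intro θ
    rw [← one_pow 2, ← lintegral_ofReal_sub_mul zero_le_one hc]
    refine setLIntegral_congr_fun measurableSet_Ioi fun r hr => ?_
    have hr' : 0 < r := hr
    rw [norm_mul, Complex.norm_exp_ofReal_mul_I, mul_one, Complex.norm_real, Real.norm_eq_abs,
      abs_of_pos hr', ← ENNReal.ofReal_mul hr'.le]
    congr 1
    field_simp
  simp_rw [h]
  rw [setLIntegral_const, Real.volume_Ioo, ← ENNReal.ofReal_mul (by positivity)]
  congr 1
  field_simp
  ring

lemma lintegral_cos_pos_sq {c : ℝ} (hc : 0 < c) :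
    ∫⁻ θ in Ioo (-Real.pi) Real.pi, ENNReal.ofReal ((max (Real.cos θ) 0) ^ 2 / (2 * c)) =
      ENNReal.ofReal (Real.pi / (4 * c)) := by
  have hpi := Real.pi_pos
  have h1 : ∀ θ ∈ Ioo (-Real.pi) Real.pi, ENNReal.ofReal ((max (Real.cos θ) 0) ^ 2 / (2 * c)) =
      (Ioc (-(Real.pi / 2)) (Real.pi / 2)).indicator
        (fun θ => ENNReal.ofReal (Real.cos θ ^ 2 / (2 * c))) θ := by
    intro θ hθ
    by_cases h : θ ∈ Ioc (-(Real.pi / 2)) (Real.pi / 2)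
    · rw [indicator_of_mem h, max_eq_left (Real.cos_nonneg_of_mem_Icc ⟨h.1.le, h.2⟩)]
    · rw [indicator_of_notMem h, max_eq_right]
      · simp
      · rw [mem_Ioc, not_and_or, not_lt, not_le] at h
        rcases h with h | h
        · rw [← Real.cos_neg]
          exact Real.cos_nonpos_of_pi_div_two_le_of_le (by linarith) (by linarith [hθ.1])
        · exact Real.cos_nonpos_of_pi_div_two_le_of_le h.le (by linarith [hθ.2])
  rw [setLIntegral_congr_fun measurableSet_Ioo h1, setLIntegral_indicator measurableSet_Ioc,
    inter_eq_left.2, ← ofReal_integral_eq_lintegral_ofReal]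
  · congr 1
    rw [← intervalIntegral.integral_of_le (by linarith), intervalIntegral.integral_div,
      integral_cos_sq]
    simp only [Real.cos_pi_div_two, Real.cos_neg, zero_mul, sub_zero]
    field_simp
    ring
  · exact Continuous.integrableOn_Ioc (by fun_prop)
  · exact Eventually.of_forall fun θ => by
      simp only [Pi.zero_apply]; positivity
  · exact fun θ hθ => ⟨by linarith [hθ.1], by linarith [hθ.2]⟩

/-- The bathtub excess for the kernel `Re (1/z)`, whose superlevel set at height `c` is a disc of
diameter `1/c` through the origin. In polar coordinates the radial integrand is at most the positive
part of `max (cos θ) 0 - c r`. -/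
lemma lintegral_ofReal_re_inv_sub {c : ℝ} (hc : 0 < c) :
    ∫⁻ z : ℂ, ENNReal.ofReal ((z⁻¹).re - c) ≤ ENNReal.ofReal (Real.pi / (4 * c)) := by
  rw [lintegral_polar _ (by fun_prop), ← lintegral_cos_pos_sq hc]
  refine lintegral_mono fun θ => ?_
  rw [← lintegral_ofReal_sub_mul (le_max_right _ _) hc]
  refine setLIntegral_mono_ae' measurableSet_Ioi (Eventually.of_forall fun r hr => ?_)
  have hr' : 0 < r := hr
  rw [← ENNReal.ofReal_mul hr'.le]
  apply ENNReal.ofReal_le_ofReal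
  have : (((r : ℂ) * Complex.exp (θ * Complex.I))⁻¹).re = r⁻¹ * Real.cos θ := by
    rw [mul_inv, ← Complex.exp_neg, ← Complex.ofReal_inv, Complex.re_ofReal_mul,
      ← neg_mul, ← Complex.ofReal_neg, Complex.exp_ofReal_mul_I_re, Real.cos_neg]
  rw [this, mul_sub, ← mul_assoc, mul_inv_cancel₀ hr'.ne', one_mul, mul_comm r c]
  linarith [le_max_left (Real.cos θ) 0]

/-- Among the sets of given area, a centred disc maximises the integral of `1 / |z - ξ|`. -/
lemma lintegral_inv_norm_le {K : Set ℂ} {A : ℝ} (hA : 0 < A)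
    (hK : volume K ≤ ENNReal.ofReal A) (ξ : ℂ) :
    ∫⁻ z in K, ENNReal.ofReal ‖z - ξ‖⁻¹ ≤ ENNReal.ofReal (2 * √(Real.pi * A)) := by
  have hpi := Real.pi_pos
  -- The reciprocal radius of the disc of area `A`; both terms of `cA + π/c` then equal `√(πA)`.
  set c := √(Real.pi / A) with hc
  have hc0 : 0 < c := Real.sqrt_pos.2 (by positivity)
  calc ∫⁻ z in K, ENNReal.ofReal ‖z - ξ‖⁻¹
      ≤ ∫⁻ z in K, (ENNReal.ofReal c + ENNReal.ofReal (‖z - ξ‖⁻¹ - c)) := by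
        refine lintegral_mono fun z => ?_
        refine le_trans (ENNReal.ofReal_le_ofReal ?_) ENNReal.ofReal_add_le
        linarith
    _ ≤ ENNReal.ofReal c * ENNReal.ofReal A + ENNReal.ofReal (Real.pi / c) := by
        rw [lintegral_add_left measurable_const, setLIntegral_const]
        gcongr
        rw [← lintegral_ofReal_inv_norm_sub hc0 ξ]
        exact setLIntegral_le_lintegral _ _
    _ = _ := by
        rw [← ENNReal.ofReal_mul hc0.le, ← ENNReal.ofReal_add (by positivity) (by positivity)]
        congr 1
        have hs : 0 < √A := Real.sqrt_pos.2 hA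
        have hp : 0 < √Real.pi := Real.sqrt_pos.2 hpi
        rw [hc, Real.sqrt_div hpi.le, Real.sqrt_mul hpi.le]
        field_simp
        rw [Real.sq_sqrt hA.le, Real.sq_sqrt hpi.le]
        ring

lemma ofReal_integral_le_lintegral_ofReal {α : Type*} {m : MeasurableSpace α} {μ : Measure α}
    (f : α → ℝ) : ENNReal.ofReal (∫ x, f x ∂μ) ≤ ∫⁻ x, ENNReal.ofReal (f x) ∂μ := by
  by_cases hf : Integrable f μ
  · apply ENNReal.ofReal_le_of_le_toReal
    rw [integral_eq_lintegral_pos_part_sub_lintegral_neg_part hf]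
    linarith [ENNReal.toReal_nonneg (a := ∫⁻ x, ENNReal.ofReal (-f x) ∂μ)]
  · rw [integral_undef hf]
    simp

lemma integrableOn_inv_sub {K : Set ℂ} (hK : volume K ≠ ∞) (z : ℂ) :
    IntegrableOn (fun w => (z - w)⁻¹) K := by
  refine ⟨by fun_prop, ?_⟩
  rw [hasFiniteIntegral_iff_norm]
  have h1 := lintegral_inv_norm_le (K := K) (A := (volume K).toReal + 1) (by positivity)
    (by rw [ENNReal.le_ofReal_iff_toReal_le hK (by positivity)]; linarith) z
  refine lt_of_le_of_lt ?_ (h1.trans_lt ENNReal.ofReal_lt_top)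
  refine lintegral_mono fun w => ?_
  rw [norm_inv, norm_sub_rev]

/-- The Ahlfors–Beurling inequality for the Cauchy transform of the area measure of a set. -/
lemma norm_integral_inv_sub_le {K : Set ℂ} {A : ℝ} (hA : 0 < A)
    (hK : volume K ≤ ENNReal.ofReal A) (z : ℂ) :
    ‖∫ w in K, (z - w)⁻¹‖ ≤ √(Real.pi * A) := by
  have hpi := Real.pi_pos
  have hKt : volume K ≠ ∞ := ne_top_of_le_ne_top ENNReal.ofReal_ne_top hK
  set J := ∫ w in K, (z - w)⁻¹ with hJ
  rcases eq_or_ne J 0 with h0 | h0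
  · rw [h0, norm_zero]; positivity
  have hn : (‖J‖ : ℂ) ≠ 0 := by exact_mod_cast norm_ne_zero_iff.2 h0
  -- A rotation making the transform a positive real, so that only the real part of the kernel
  -- counts.
  set u : ℂ := ‖J‖ / J with hu
  have hu1 : ‖u‖ = 1 := by
    rw [hu, norm_div, Complex.norm_real, norm_norm, div_self (norm_ne_zero_iff.2 h0)]
  have hu0 : u ≠ 0 := norm_ne_zero_iff.1 (by rw [hu1]; exact one_ne_zero)
  have hInt := integrableOn_inv_sub hKt z
  have hJre : ‖J‖ = ∫ w in K, (((z - w) / u)⁻¹).re := by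
    have h1 : u * J = ‖J‖ := by rw [hu]; field_simp
    have h2 : ∫ w in K, ((z - w) / u)⁻¹ = u * J := by
      rw [hJ, ← integral_const_mul]
      refine integral_congr_ae (Eventually.of_forall fun w => ?_)
      simp only [inv_div]
      rw [div_eq_mul_inv]
    have h3 : IntegrableOn (fun w => ((z - w) / u)⁻¹) K := by
      refine (hInt.const_mul u).congr (Eventually.of_forall fun w => ?_)
      simp only [inv_div]
      rw [div_eq_mul_inv]
    have h4 := integral_re h3
    simp only [RCLike.re_to_complex] at h4
    rw [h4, h2, h1, Complex.ofReal_re]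
  -- Chosen so that the extremal disc `{Re (1/y) > c}` has area `A`; then `cA` and `π/(4c)` are both
  -- `√(πA)/2`.
  set c := √(Real.pi / A) / 2 with hc
  have hc0 : 0 < c := by have := Real.sqrt_pos.2 (div_pos hpi hA); positivity
  set φ : ℂ → ℝ≥0∞ := fun y => ENNReal.ofReal ((y⁻¹).re - c) with hφ
  have hrot : ∫⁻ w, φ ((z - w) / u) = ∫⁻ y, φ y := by
    rw [lintegral_sub_left_eq_self (fun y : ℂ => φ (y / u)) z]
    have hmem : u⁻¹ ∈ Submonoid.unitSphere ℂ :=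
      mem_sphere_zero_iff_norm.2 (by rw [norm_inv, hu1, inv_one])
    obtain ⟨a, ha⟩ : ∃ a : Circle, (a : ℂ) = u⁻¹ := ⟨⟨u⁻¹, hmem⟩, rfl⟩
    have hmp := (rotation a).measurePreserving
    have := hmp.lintegral_comp (f := φ) (by fun_prop)
    rw [← this]
    refine lintegral_congr fun y => ?_
    rw [rotation_apply, ha, div_eq_inv_mul]
  have hle : ENNReal.ofReal ‖J‖ ≤ ENNReal.ofReal √(Real.pi * A) := by
    calc ENNReal.ofReal ‖J‖ ≤ ∫⁻ w in K, ENNReal.ofReal ((((z - w) / u)⁻¹).re) := by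
          rw [hJre]
          exact ofReal_integral_le_lintegral_ofReal _
      _ ≤ ∫⁻ w in K, (ENNReal.ofReal c + φ ((z - w) / u)) := by
          refine lintegral_mono fun w => ?_
          refine le_trans (ENNReal.ofReal_le_ofReal ?_) ENNReal.ofReal_add_le
          linarith
      _ ≤ ENNReal.ofReal c * ENNReal.ofReal A + ENNReal.ofReal (Real.pi / (4 * c)) := by
          rw [lintegral_add_left measurable_const, setLIntegral_const]
          gcongr
          refine (setLIntegral_le_lintegral _ _).trans ?_
          rw [hrot]
          exact lintegral_ofReal_re_inv_sub hc0
      _ = _ := by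
          rw [← ENNReal.ofReal_mul hc0.le, ← ENNReal.ofReal_add (by positivity) (by positivity)]
          congr 1
          have hs : 0 < √A := Real.sqrt_pos.2 hA
          have hp : 0 < √Real.pi := Real.sqrt_pos.2 hpi
          rw [hc, Real.sqrt_div hpi.le, Real.sqrt_mul hpi.le]
          field_simp
          rw [Real.sq_sqrt hA.le, Real.sq_sqrt hpi.le]
          ring
  exact (ENNReal.ofReal_le_ofReal_iff (by positivity)).1 hle

/-! ### Pólya's area inequality by the maximum principle -/

/-- The Cauchy transform of a compact set, in the coordinate `1 / z`, is holomorphic. -/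
lemma differentiableAt_integral_inv_one_sub_mul {K : Set ℂ} (hK : IsCompact K) {ζ₀ : ℂ}
    (h : ∀ w ∈ K, 1 - w * ζ₀ ≠ 0) :
    DifferentiableAt ℂ (fun ζ => ∫ w in K, (1 - w * ζ)⁻¹) ζ₀ := by
  obtain ⟨m, hm, hmK⟩ : ∃ m > 0, ∀ w ∈ K, m ≤ ‖1 - w * ζ₀‖ := by
    rcases K.eq_empty_or_nonempty with rfl | hne
    · exact ⟨1, one_pos, by simp⟩
    obtain ⟨w, hw, hmin⟩ := hK.exists_isMinOn hne (f := fun w => ‖1 - w * ζ₀‖) (by fun_prop)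
    exact ⟨_, norm_pos_iff.2 (h w hw), fun w' hw' => hmin hw'⟩
  obtain ⟨B, hB0, hB⟩ := hK.isBounded.exists_pos_norm_le
  have hlow : ∀ w ∈ K, ∀ ζ ∈ Metric.ball ζ₀ (m / (2 * B)), m / 2 ≤ ‖1 - w * ζ‖ := by
    intro w hw ζ hζ
    have h1 : ‖w * (ζ - ζ₀)‖ ≤ m / 2 := by
      rw [norm_mul]
      have h2 : ‖ζ - ζ₀‖ ≤ m / (2 * B) := by
        rw [← dist_eq_norm]; exact (Metric.mem_ball.1 hζ).le
      calc ‖w‖ * ‖ζ - ζ₀‖ ≤ B * (m / (2 * B)) := by gcongr; exact hB w hw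
        _ = m / 2 := by field_simp
    have h3 : 1 - w * ζ₀ = (1 - w * ζ) + w * (ζ - ζ₀) := by ring
    have h4 := hmK w hw
    rw [h3] at h4
    linarith [norm_add_le (1 - w * ζ) (w * (ζ - ζ₀))]
  have hKm := hK.measurableSet
  refine (hasDerivAt_integral_of_dominated_loc_of_deriv_le (μ := volume.restrict K)
    (F := fun ζ w => (1 - w * ζ)⁻¹) (F' := fun ζ w => w / (1 - w * ζ) ^ 2)
    (bound := fun _ => B / (m / 2) ^ 2)
    (Metric.ball_mem_nhds ζ₀ (show 0 < m / (2 * B) by positivity))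
    (Eventually.of_forall fun ζ => by fun_prop) ?_
    (Measurable.aestronglyMeasurable (by fun_prop)) ?_ ?_ ?_).2.differentiableAt
  · refine ContinuousOn.integrableOn_compact hK ?_
    exact ContinuousOn.inv₀ (by fun_prop) h
  · rw [ae_restrict_iff' hKm]
    refine Eventually.of_forall fun w hw ζ hζ => ?_
    rw [norm_div, norm_pow]
    have := hlow w hw ζ hζ
    gcongr
    exact hB w hw
  · have : IsFiniteMeasure (volume.restrict K) := ⟨by simpa using hK.measure_lt_top⟩
    exact integrable_const _
  · rw [ae_restrict_iff' hKm]
    refine Eventually.of_forall fun w hw ζ hζ => ?_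
    have h0 : 1 - w * ζ ≠ 0 := by
      intro h0
      have := hlow w hw ζ hζ
      rw [h0, norm_zero] at this
      linarith
    have h1 : HasDerivAt (fun ζ => 1 - w * ζ) (-w) ζ := by
      simpa using ((hasDerivAt_id ζ).const_mul w).const_sub 1
    have h2 := h1.fun_inv h0
    rwa [neg_neg] at h2

lemma isCompact_norm_eval_le {p : ℂ[X]} (hn : p.natDegree ≠ 0) (R : ℝ) :
    IsCompact {z | ‖p.eval z‖ ≤ R} := by
  have hdeg : 0 < p.degree := natDegree_pos_iff_degree_pos.1 (Nat.pos_of_ne_zero hn)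
  have ht := p.tendsto_norm_atTop hdeg (tendsto_norm_cocompact_atTop (E := ℂ))
  have := (ht.eventually (eventually_gt_atTop R))
  obtain ⟨T, hT, hTs⟩ := mem_cocompact.1 this
  refine hT.of_isClosed_subset (isClosed_le p.continuous.norm continuous_const) fun z hz => ?_
  by_contra hzT
  exact absurd (show R < ‖p.eval z‖ from hTs hzT) (not_lt.2 hz)

/-- In the coordinate `ζ = 1/z`, with `q` the reversed polynomial, `U` is `{|p| > R'}` with infinity
placed at `0`, and `ζ F(ζ)` is the Cauchy transform of `K` at `1/ζ`. The function `Fⁿ q` is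
holomorphic there because `R' > R` keeps `1/ζ` off `K`. It equals `Aⁿ` at `0`, since `p` is monic.
On the frontier `|q| = R'|ζ|ⁿ`, so `|Fⁿ q| = |ζF|ⁿ R'`, which Ahlfors–Beurling bounds. The condition
`p(0) = 0` keeps `1/ζ` away from `0`, making `U` bounded. -/
lemma volume_norm_eval_le_of_eval_zero {p : ℂ[X]} (hp : p.Monic) (hn : p.natDegree ≠ 0)
    (h0 : p.eval 0 = 0) {R R' : ℝ} (hR : 0 < R) (hR' : R < R') :
    (volume {z | ‖p.eval z‖ ≤ R}).toReal ^ p.natDegree ≤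
      √(Real.pi * (volume {z | ‖p.eval z‖ ≤ R}).toReal) ^ p.natDegree * R' := by
  have hR'0 : 0 < R' := hR.trans hR'
  set n := p.natDegree with hndef
  set K := {z | ‖p.eval z‖ ≤ R} with hKdef
  have hK : IsCompact K := isCompact_norm_eval_le hn R
  set A := (volume K).toReal with hAdef
  rcases (ENNReal.toReal_nonneg (a := volume K)).eq_or_lt with hA0 | hA0
  · rw [← hAdef] at hA0
    rw [← hA0, zero_pow hn]
    positivity
  set q := p.reverse with hq
  have hq0 : q.eval 0 = 1 := by
    rw [← coeff_zero_eq_eval_zero, coeff_zero_reverse]; exact hp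
  have hqp : ∀ ζ : ℂ, ζ ≠ 0 → q.eval ζ = ζ ^ n * p.eval ζ⁻¹ := by
    intro ζ hζ
    have hu : IsUnit ζ := isUnit_iff_ne_zero.2 hζ
    have : Invertible ζ⁻¹ := invertibleOfNonzero (inv_ne_zero hζ)
    have h := eval₂_reverse_mul_pow (RingHom.id ℂ) ζ⁻¹ p
    simp only [invOf_eq_inv, inv_inv] at h
    change q.eval ζ * ζ⁻¹ ^ n = p.eval ζ⁻¹ at h
    rw [← h, mul_comm (q.eval ζ), ← mul_assoc, ← mul_pow, mul_inv_cancel₀ hζ, one_pow, one_mul]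
  set F : ℂ → ℂ := fun ζ => ∫ w in K, (1 - w * ζ)⁻¹ with hF
  set U : Set ℂ := {ζ | R' * ‖ζ‖ ^ n < ‖q.eval ζ‖} with hU
  set U' : Set ℂ := {ζ | R' * ‖ζ‖ ^ n ≤ ‖q.eval ζ‖} with hU'
  have hcl : closure U ⊆ U' :=
    closure_minimal (fun ζ (hζ : R' * ‖ζ‖ ^ n < ‖q.eval ζ‖) => le_of_lt hζ)
      (isClosed_le (by fun_prop) (q.continuous.norm))
  have hUo : IsOpen U := isOpen_lt (by fun_prop) (q.continuous.norm)
  have hpU' : ∀ ζ ∈ U', ζ ≠ 0 → R' ≤ ‖p.eval ζ⁻¹‖ := by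
    intro ζ hζ hζ0
    have h1 : R' * ‖ζ‖ ^ n ≤ ‖q.eval ζ‖ := hζ
    rw [hqp ζ hζ0, norm_mul, norm_pow, mul_comm] at h1
    have h2 : 0 < ‖ζ‖ ^ n := pow_pos (norm_pos_iff.2 hζ0) n
    exact le_of_mul_le_mul_left h1 h2
  have hne : ∀ ζ ∈ U', ∀ w ∈ K, 1 - w * ζ ≠ 0 := by
    intro ζ hζ w hw h
    have hζ0 : ζ ≠ 0 := by rintro rfl; simp at h
    have hw' : w = ζ⁻¹ := eq_inv_of_mul_eq_one_left (sub_eq_zero.1 h).symm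
    have h1 := hpU' ζ hζ hζ0
    rw [← hw'] at h1
    have h2 : ‖p.eval w‖ ≤ R := hw
    linarith
  have hdF : ∀ ζ ∈ U', DifferentiableAt ℂ (fun ζ => F ζ ^ n * q.eval ζ) ζ := fun ζ hζ =>
    ((differentiableAt_integral_inv_one_sub_mul hK (hne ζ hζ)).pow n).mul q.differentiableAt
  have hbdd : Bornology.IsBounded U := by
    have hev : ∀ᶠ z in 𝓝 (0 : ℂ), ‖p.eval z‖ < R' := by
      have : Tendsto (fun z => ‖p.eval z‖) (𝓝 0) (𝓝 ‖p.eval 0‖) := p.continuous.norm.tendsto 0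
      rw [h0, norm_zero] at this
      exact this.eventually (gt_mem_nhds (by linarith))
    obtain ⟨d, hd, hdb⟩ := Metric.eventually_nhds_iff.1 hev
    refine (Metric.isBounded_closedBall (x := (0 : ℂ)) (r := d⁻¹)).subset fun ζ hζ => ?_
    rw [mem_closedBall_zero_iff]
    rcases eq_or_ne ζ 0 with rfl | hζ0
    · simp [hd.le]
    have h1 := hpU' ζ (hcl (subset_closure hζ)) hζ0
    by_contra hlt
    have h2 : dist ζ⁻¹ 0 < d := by
      rw [dist_zero_right, norm_inv]
      exact inv_lt_of_inv_lt₀ hd (not_le.1 hlt)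
    linarith [hdb h2]
  have hfr : ∀ ζ ∈ frontier U, ‖F ζ ^ n * q.eval ζ‖ ≤ √(Real.pi * A) ^ n * R' := by
    intro ζ hζ
    have hζU' : ζ ∈ U' := hcl hζ.1
    have hζU : ζ ∉ U := by
      have := hζ.2
      rwa [hUo.interior_eq] at this
    have hζ0 : ζ ≠ 0 := by
      rintro rfl
      apply hζU
      simp [hU, hq0, hn]
    have hqeq : ‖q.eval ζ‖ = R' * ‖ζ‖ ^ n := le_antisymm (not_lt.1 hζU) hζU'
    have hFe : ζ * F ζ = ∫ w in K, (ζ⁻¹ - w)⁻¹ := by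
      rw [hF, ← integral_const_mul]
      refine integral_congr_ae (Eventually.of_forall fun w => ?_)
      have : ζ⁻¹ - w = ζ⁻¹ * (1 - w * ζ) := by field_simp
      simp only
      rw [this, mul_inv, inv_inv]
    have hAB := norm_integral_inv_sub_le (K := K) hA0
      (by rw [ENNReal.ofReal_toReal hK.measure_lt_top.ne]) ζ⁻¹
    rw [← hFe, norm_mul] at hAB
    rw [norm_mul, norm_pow, hqeq]
    calc ‖F ζ‖ ^ n * (R' * ‖ζ‖ ^ n) = (‖ζ‖ * ‖F ζ‖) ^ n * R' := by rw [mul_pow]; ring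
      _ ≤ _ := by gcongr
  have h0U : (0 : ℂ) ∈ U := by simp [hU, hq0, hn]
  have hmain := Complex.norm_le_of_forall_mem_frontier_norm_le hbdd
    (f := fun ζ => F ζ ^ n * q.eval ζ)
    (DifferentiableOn.diffContOnCl fun ζ hζ => (hdF ζ (hcl hζ)).differentiableWithinAt)
    hfr (subset_closure h0U)
  have hF0 : F 0 = A := by
    simp [hF, hAdef, Measure.real]
  have hA0' : |A| = A := abs_of_pos hA0
  simpa [hF0, hq0, hA0'] using hmain

/-- Pólya's inequality for the area of a lemniscate domain. -/
lemma volume_norm_eval_le {p : ℂ[X]} (hp : p.Monic) (hn : p.natDegree ≠ 0) {R : ℝ} (hR : 0 < R) :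
    volume {z | ‖p.eval z‖ ≤ R} ≤ ENNReal.ofReal (Real.pi * (R ^ (1 / p.natDegree : ℝ)) ^ 2) := by
  set n := p.natDegree with hndef
  obtain ⟨z₀, hz₀⟩ := IsAlgClosed.exists_root p
    (natDegree_pos_iff_degree_pos.1 (Nat.pos_of_ne_zero hn)).ne'
  -- Translation of a root to the origin, as the preceding lemma requires; areas do not change.
  set P := p.comp (X + C z₀) with hP
  have hPm : P.Monic := hp.comp_X_add_C z₀
  have hPn : P.natDegree = n := by rw [hP, natDegree_comp, natDegree_X_add_C, mul_one]
  have hPe : ∀ z, P.eval z = p.eval (z + z₀) := fun z => by simp [hP]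
  have hvol : volume {z | ‖p.eval z‖ ≤ R} = volume {z | ‖P.eval z‖ ≤ R} := by
    simp_rw [hPe]
    exact (measure_preimage_add_right volume z₀ {z | ‖p.eval z‖ ≤ R}).symm
  have hPcomp := isCompact_norm_eval_le (p := P) (by rw [hPn]; exact hn) R
  rw [hvol]
  set A := (volume {z | ‖P.eval z‖ ≤ R}).toReal with hA
  have hA0 : 0 ≤ A := ENNReal.toReal_nonneg
  have key : ∀ R', R < R' → A ^ n ≤ √(Real.pi * A) ^ n * R' := by
    intro R' hR'
    have := volume_norm_eval_le_of_eval_zero hPm (by rw [hPn]; exact hn)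
      (by rw [hPe, zero_add]; exact hz₀) hR hR'
    rwa [hPn] at this
  have key' : A ^ n ≤ √(Real.pi * A) ^ n * R := by
    have ht : Tendsto (fun R' : ℝ => √(Real.pi * A) ^ n * R') (𝓝[>] R) (𝓝 (√(Real.pi * A) ^ n * R)) :=
      (Continuous.tendsto (by fun_prop) R).mono_left nhdsWithin_le_nhds
    exact ge_of_tendsto ht (by filter_upwards [self_mem_nhdsWithin] with R' h using key R' h)
  rw [ENNReal.le_ofReal_iff_toReal_le hPcomp.measure_lt_top.ne (by positivity)]
  set t := R ^ (1 / n : ℝ) with ht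
  have ht0 : 0 ≤ t := by positivity
  have htn : t ^ n = R := by
    rw [ht, ← Real.rpow_natCast, ← Real.rpow_mul hR.le, one_div_mul_cancel (by exact_mod_cast hn),
      Real.rpow_one]
  rw [← htn, ← mul_pow] at key'
  have h1 : A ≤ √(Real.pi * A) * t := le_of_pow_le_pow_left₀ hn (by positivity) key'
  change A ≤ _
  rcases hA0.eq_or_lt with h | h
  · rw [← h]; positivity
  have h2 : A * A ≤ (√(Real.pi * A) * t) * (√(Real.pi * A) * t) :=
    mul_le_mul h1 h1 hA0 (by positivity)
  have h3 : (√(Real.pi * A) * t) * (√(Real.pi * A) * t) = A * (Real.pi * t ^ 2) := by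
    rw [mul_mul_mul_comm, Real.mul_self_sqrt (by positivity)]; ring
  rw [h3] at h2
  exact le_of_mul_le_mul_left h2 h

/-! ### Wirtinger calculus and the Stokes formula -/

/-- `f` is real differentiable at `z` with Wirtinger derivatives `∂f = a` and `∂̄f = b`. -/
def HasWirtingerAt (f : ℂ → ℂ) (a b z : ℂ) : Prop :=
  HasFDerivAt f (a • ContinuousLinearMap.id ℝ ℂ + b • (Complex.conjCLE : ℂ →L[ℝ] ℂ)) z

namespace HasWirtingerAt

lemma of_hasFDerivAt {f : ℂ → ℂ} {L : ℂ →L[ℝ] ℂ} {a b z : ℂ} (h : HasFDerivAt f L z)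
    (hL : ∀ y, L y = a * y + b * conj y) : HasWirtingerAt f a b z := by
  have : L = a • ContinuousLinearMap.id ℝ ℂ + b • (Complex.conjCLE : ℂ →L[ℝ] ℂ) := by
    refine ContinuousLinearMap.ext fun y => ?_
    rw [hL]
    simp
  rwa [HasWirtingerAt, ← this]

lemma of_hasDerivAt {f : ℂ → ℂ} {a z : ℂ} (h : HasDerivAt f a z) : HasWirtingerAt f a 0 z :=
  of_hasFDerivAt (h.hasFDerivAt.restrictScalars ℝ) fun y => by simp [mul_comm]

lemma const (c z : ℂ) : HasWirtingerAt (fun _ => c) 0 0 z :=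
  of_hasDerivAt (hasDerivAt_const z c)

lemma congr_deriv {f : ℂ → ℂ} {a b a' b' z : ℂ} (h : HasWirtingerAt f a b z) (ha : a = a')
    (hb : b = b') : HasWirtingerAt f a' b' z := by
  subst ha hb; exact h

lemma conj_comp {f : ℂ → ℂ} {a b z : ℂ} (h : HasWirtingerAt f a b z) :
    HasWirtingerAt (fun z => conj (f z)) (conj b) (conj a) z :=
  of_hasFDerivAt (Complex.conjCLE.toContinuousLinearMap.hasFDerivAt.comp z h) fun y => by
    simp [add_comm]

lemma add {f g : ℂ → ℂ} {a b c d z : ℂ} (h : HasWirtingerAt f a b z)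
    (h' : HasWirtingerAt g c d z) : HasWirtingerAt (fun z => f z + g z) (a + c) (b + d) z :=
  of_hasFDerivAt (HasFDerivAt.fun_add h h') fun y => by simp; ring

lemma mul {f g : ℂ → ℂ} {a b c d z : ℂ} (h : HasWirtingerAt f a b z)
    (h' : HasWirtingerAt g c d z) :
    HasWirtingerAt (fun z => f z * g z) (a * g z + f z * c) (b * g z + f z * d) z :=
  of_hasFDerivAt (HasFDerivAt.fun_mul h h') fun y => by simp; ring

lemma sum {ι : Type*} (s : Finset ι) {f : ι → ℂ → ℂ} {a b : ι → ℂ} {z : ℂ}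
    (h : ∀ i ∈ s, HasWirtingerAt (f i) (a i) (b i) z) :
    HasWirtingerAt (fun z => ∑ i ∈ s, f i z) (∑ i ∈ s, a i) (∑ i ∈ s, b i) z :=
  of_hasFDerivAt (HasFDerivAt.fun_sum h) fun y => by
    simp [Finset.sum_add_distrib, Finset.sum_mul]

lemma comp {f g : ℂ → ℂ} {a b c d z : ℂ} (h : HasWirtingerAt g c d (f z))
    (h' : HasWirtingerAt f a b z) :
    HasWirtingerAt (fun z => g (f z)) (c * a + d * starRingEnd ℂ b)
      (c * b + d * starRingEnd ℂ a) z :=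
  of_hasFDerivAt (HasFDerivAt.comp z h h') fun y => by simp; ring

/-- The differential of a real-valued function has zero imaginary part, so it commutes with taking
real parts and is merely scaled by `φ'`; the conjugate terms of `comp` do not appear. -/
lemma comp_real {f : ℂ → ℝ} {φ : ℝ → ℝ} {φ' : ℝ} {a b z : ℂ}
    (h : HasWirtingerAt (fun z => (f z : ℂ)) a b z) (hφ : HasDerivAt φ φ' (f z)) :
    HasWirtingerAt (fun z => (φ (f z) : ℂ)) (φ' * a) (φ' * b) z := by
  have h1 : HasFDerivAt f _ z := (Complex.reCLM.hasFDerivAt.comp z h :)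
  have him : HasFDerivAt (fun _ : ℂ => (0 : ℝ)) _ z := (Complex.imCLM.hasFDerivAt.comp z h :)
  have him0 := him.unique (hasFDerivAt_const (0 : ℝ) z)
  have h2 := hφ.comp_hasFDerivAt z h1
  refine of_hasFDerivAt (Complex.ofRealCLM.hasFDerivAt.comp z h2) fun y => ?_
  have him1 : (a * y + b * starRingEnd ℂ y).im = 0 := by
    have := congrArg (fun L : ℂ →L[ℝ] ℝ => L y) him0
    simpa using this
  have hre : (((a * y + b * starRingEnd ℂ y).re : ℝ) : ℂ) = a * y + b * starRingEnd ℂ y := by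
    apply Complex.ext
    · simp
    · rw [him1]; simp
  have : (φ' : ℂ) * a * y + φ' * b * starRingEnd ℂ y = φ' * (a * y + b * starRingEnd ℂ y) := by ring
  rw [this, ← hre]
  simp
  ring

end HasWirtingerAt

/-- The Wirtinger derivative `∂̄f`. -/
noncomputable def dbar (f : ℂ → ℂ) (z : ℂ) : ℂ :=
  (fderiv ℝ f z 1 + Complex.I * fderiv ℝ f z Complex.I) / 2

lemma HasWirtingerAt.dbar_eq {f : ℂ → ℂ} {a b z : ℂ} (h : HasWirtingerAt f a b z) :
    dbar f z = b := by
  rw [dbar, HasFDerivAt.fderiv h]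
  simp only [add_apply, smul_apply, ContinuousLinearMap.id_apply, smul_eq_mul, mul_one,
    ContinuousLinearEquiv.coe_coe, Complex.conjCLE_apply, map_one, Complex.conj_I]
  ring_nf
  rw [Complex.I_sq]
  ring

lemma integrable_fderiv_apply {f : ℂ → ℂ} (hf : ContDiff ℝ 1 f) (hc : HasCompactSupport f) (v : ℂ) :
    Integrable fun z => fderiv ℝ f z v := by
  apply Continuous.integrable_of_hasCompactSupport
  · exact (hf.continuous_fderiv one_ne_zero).clm_apply continuous_const
  · exact hc.fderiv_apply ℝ v

lemma integrable_dbar {f : ℂ → ℂ} (hf : ContDiff ℝ 1 f) (hc : HasCompactSupport f) :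
    Integrable (dbar f) :=
  ((integrable_fderiv_apply hf hc 1).add
    ((integrable_fderiv_apply hf hc Complex.I).const_mul Complex.I)).div_const 2

lemma integral_fderiv_apply_eq_zero {f : ℂ → ℂ} (hf : ContDiff ℝ 1 f) (hc : HasCompactSupport f)
    (v : ℂ) : ∫ z, fderiv ℝ f z v = 0 := by
  have h := integral_mul_fderiv_eq_neg_fderiv_mul_of_integrable (μ := (volume : Measure ℂ)) (𝕜 := ℂ)
    (f := fun _ : ℂ => (1 : ℂ)) (g := f) (v := v) (by simp)
    (by simpa using integrable_fderiv_apply hf hc v)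
    (by simpa using hf.continuous.integrable_of_hasCompactSupport hc)
    (fun x _ => differentiableAt_const _) (fun x _ => (hf.differentiable one_ne_zero) x)
  simpa using h

/-- The integral of `∂̄f` vanishes for compactly supported `f`. -/
lemma integral_dbar_eq_zero {f : ℂ → ℂ} (hf : ContDiff ℝ 1 f) (hc : HasCompactSupport f) :
    ∫ z, dbar f z = 0 := by
  unfold dbar
  rw [integral_div, integral_add (integrable_fderiv_apply hf hc 1)
    ((integrable_fderiv_apply hf hc Complex.I).const_mul Complex.I), integral_const_mul,
    integral_fderiv_apply_eq_zero hf hc, integral_fderiv_apply_eq_zero hf hc]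
  simp

/-! ### The phase function -/

/-- The periodic primitive of `|cos| / 2 - 1 / π`. -/
noncomputable def cosPrimitive (t : ℝ) : ℝ := ∫ u in (0 : ℝ)..t, (|Real.cos u| / 2 - 1 / Real.pi)

lemma hasDerivAt_cosPrimitive (t : ℝ) :
    HasDerivAt cosPrimitive (|Real.cos t| / 2 - 1 / Real.pi) t := by
  have hc : Continuous fun u : ℝ => |Real.cos u| / 2 - 1 / Real.pi := by fun_prop
  exact intervalIntegral.integral_hasDerivAt_right (hc.intervalIntegrable _ _)
    (hc.stronglyMeasurableAtFilter _ _) hc.continuousAt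

lemma contDiff_cosPrimitive : ContDiff ℝ 1 cosPrimitive := by
  rw [contDiff_one_iff_deriv]
  refine ⟨fun t => (hasDerivAt_cosPrimitive t).differentiableAt, ?_⟩
  have : deriv cosPrimitive = fun t => |Real.cos t| / 2 - 1 / Real.pi :=
    funext fun t => (hasDerivAt_cosPrimitive t).deriv
  rw [this]
  fun_prop

lemma integral_abs_cos : ∫ u in (0 : ℝ)..Real.pi, |Real.cos u| = 2 := by
  have hpi := Real.pi_pos
  have hi : ∀ a b : ℝ, IntervalIntegrable (fun u => |Real.cos u|) volume a b := fun a b =>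
    Continuous.intervalIntegrable (by fun_prop) _ _
  rw [← intervalIntegral.integral_add_adjacent_intervals (hi 0 (Real.pi / 2)) (hi _ _)]
  have h1 : ∫ u in (0 : ℝ)..(Real.pi / 2), |Real.cos u| = 1 := by
    rw [intervalIntegral.integral_congr (g := Real.cos), integral_cos]
    · simp
    · intro u hu
      rw [uIcc_of_le (by linarith)] at hu
      exact abs_of_nonneg (Real.cos_nonneg_of_mem_Icc ⟨by linarith [hu.1], hu.2⟩)
  have h2 : ∫ u in (Real.pi / 2)..Real.pi, |Real.cos u| = 1 := by
    rw [intervalIntegral.integral_congr (g := fun u => -Real.cos u),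
      intervalIntegral.integral_neg, integral_cos]
    · simp
    · intro u hu
      rw [uIcc_of_le (by linarith)] at hu
      exact abs_of_nonpos (Real.cos_nonpos_of_pi_div_two_le_of_le hu.1 (by linarith [hu.2]))
  rw [h1, h2]
  norm_num

/-- The mean of `|cos|/2` over a period is `1/π`, so the integrand has mean zero. This mean is the
source of the constant `2` in the theorem. -/
lemma cosPrimitive_periodic : Function.Periodic cosPrimitive Real.pi := by
  have hc : Continuous fun u : ℝ => |Real.cos u| / 2 - 1 / Real.pi := by fun_prop
  have hper : Function.Periodic (fun u : ℝ => |Real.cos u| / 2 - 1 / Real.pi) Real.pi := by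
    intro u
    simp [Real.cos_add_pi]
  intro t
  have h1 : cosPrimitive (t + Real.pi) = cosPrimitive t +
      ∫ u in t..(t + Real.pi), (|Real.cos u| / 2 - 1 / Real.pi) :=
    (intervalIntegral.integral_add_adjacent_intervals (hc.intervalIntegrable _ _)
      (hc.intervalIntegrable _ _)).symm
  rw [h1, hper.intervalIntegral_add_eq t 0, zero_add, intervalIntegral.integral_sub
    (Continuous.intervalIntegrable (by fun_prop) _ _) (by simp), intervalIntegral.integral_div,
    integral_abs_cos]
  simp [Real.pi_ne_zero]

lemma abs_cosPrimitive_deriv_le (t : ℝ) : |(|Real.cos t| / 2 - 1 / Real.pi)| ≤ 1 / 2 := by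
  have h1 := abs_nonneg (Real.cos t)
  have h2 := Real.abs_cos_le_one t
  have h3 : 1 / Real.pi ≤ 1 / 2 := one_div_le_one_div_of_le two_pos Real.two_le_pi
  have h4 : 0 < 1 / Real.pi := by positivity
  rw [abs_le]
  constructor <;> linarith

lemma abs_cosPrimitive_le (t : ℝ) : |cosPrimitive t| ≤ 2 := by
  obtain ⟨s, hs, hst⟩ := cosPrimitive_periodic.exists_mem_Ico₀ Real.pi_pos t
  rw [hst, cosPrimitive, ← Real.norm_eq_abs]
  refine (intervalIntegral.norm_integral_le_of_norm_le_const (C := 1 / 2)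
    fun u _ => abs_cosPrimitive_deriv_le u).trans ?_
  rw [sub_zero, abs_of_nonneg hs.1]
  linarith [hs.2, Real.pi_le_four]

/-- `cosPrimitive ∘ arg` is even because `cosPrimitive` is `π`-periodic. -/
lemma cosPrimitive_arg_neg (μ : ℂ) :
    cosPrimitive (Complex.arg (-μ)) = cosPrimitive (Complex.arg μ) := by
  rcases eq_or_ne μ 0 with rfl | hμ
  · simp
  rcases lt_trichotomy μ.im 0 with h | h | h
  · rw [Complex.arg_neg_eq_arg_add_pi_of_im_neg h, cosPrimitive_periodic]
  · rcases lt_trichotomy μ.re 0 with h' | h' | h'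
    · have hμ' : μ = (μ.re : ℂ) := by apply Complex.ext <;> simp [h]
      have h1 : Complex.arg μ = 0 + Real.pi := by
        rw [hμ', Complex.arg_ofReal_of_neg h', zero_add]
      have h2 : Complex.arg (-μ) = 0 := by
        rw [hμ', ← Complex.ofReal_neg, Complex.arg_ofReal_of_nonneg (by linarith)]
      rw [h1, h2, cosPrimitive_periodic]
    · exact absurd (Complex.ext h' h) hμ
    · have hμ' : μ = (μ.re : ℂ) := by apply Complex.ext <;> simp [h]
      have h1 : Complex.arg μ = 0 := by
        rw [hμ', Complex.arg_ofReal_of_nonneg h'.le]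
      have h2 : Complex.arg (-μ) = 0 + Real.pi := by
        rw [hμ', ← Complex.ofReal_neg, Complex.arg_ofReal_of_neg (by linarith), zero_add]
      rw [h1, h2, cosPrimitive_periodic]
  · rw [Complex.arg_neg_eq_arg_sub_pi_of_im_pos h, cosPrimitive_periodic.sub_eq]

/-- On the slit plane `arg` is the smooth function `Im log`. A nonzero point on the branch cut is
carried into the slit plane by `μ ↦ -μ`, under which the function is invariant. -/
lemma contDiffAt_cosPrimitive_arg {μ : ℂ} (hμ : μ ≠ 0) :
    ContDiffAt ℝ 1 (fun μ => cosPrimitive (Complex.arg μ)) μ := by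
  have key : ∀ ν ∈ Complex.slitPlane,
      ContDiffAt ℝ 1 (fun μ => cosPrimitive (Complex.arg μ)) ν := by
    intro ν hν
    have h1 : ContDiffAt ℝ 1 (fun μ => (Complex.log μ).im) ν :=
      Complex.imCLM.contDiff.contDiffAt.comp ν ((Complex.contDiffAt_log hν).restrict_scalars ℝ)
    simp only [Complex.log_im] at h1
    exact contDiff_cosPrimitive.contDiffAt.comp ν h1
  by_cases h : μ ∈ Complex.slitPlane
  · exact key μ h
  · have h' : -μ ∈ Complex.slitPlane := by
      rw [Complex.mem_slitPlane_iff, not_or, not_lt, not_not] at h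
      rw [Complex.mem_slitPlane_iff]
      left
      rw [Complex.neg_re, Left.neg_pos_iff]
      exact lt_of_le_of_ne h.1 fun h0 => hμ (Complex.ext h0 h.2)
    have h2 : ContDiffAt ℝ 1 (fun μ => cosPrimitive (Complex.arg (-μ))) μ :=
      (key (-μ) h').comp μ contDiff_neg.contDiffAt
    simpa only [cosPrimitive_arg_neg] using h2

/-- From `arg = (log - conj log)/(2i)` on the slit plane, with the same reflection across the cut.
-/
lemma hasWirtingerAt_cosPrimitive_arg {μ : ℂ} (hμ : μ ≠ 0) :
    HasWirtingerAt (fun μ => (cosPrimitive (Complex.arg μ) : ℂ))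
      ((|Real.cos (Complex.arg μ)| / 2 - 1 / Real.pi : ℝ) / (2 * Complex.I * μ))
      (-((|Real.cos (Complex.arg μ)| / 2 - 1 / Real.pi : ℝ) / (2 * Complex.I * conj μ))) μ := by
  have key : ∀ ν ∈ Complex.slitPlane, HasWirtingerAt (fun μ => (cosPrimitive (Complex.arg μ) : ℂ))
      ((|Real.cos (Complex.arg ν)| / 2 - 1 / Real.pi : ℝ) / (2 * Complex.I * ν))
      (-((|Real.cos (Complex.arg ν)| / 2 - 1 / Real.pi : ℝ) / (2 * Complex.I * conj ν))) ν := by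
    intro ν hν
    have hν0 : ν ≠ 0 := Complex.slitPlane_ne_zero hν
    have hl := HasWirtingerAt.of_hasDerivAt (Complex.hasDerivAt_log hν)
    have harg : HasWirtingerAt (fun μ => (Complex.arg μ : ℂ)) (1 / (2 * Complex.I * ν))
        (-(1 / (2 * Complex.I * conj ν))) ν := by
      have h1 := (HasWirtingerAt.const (1 / (2 * Complex.I)) ν).mul
        (hl.add ((HasWirtingerAt.const (-1) ν).mul hl.conj_comp))
      have h2 : (fun z => 1 / (2 * Complex.I) * (Complex.log z + -1 * conj (Complex.log z))) =
          fun μ => (Complex.arg μ : ℂ) := by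
        funext z
        rw [neg_one_mul, ← sub_eq_add_neg, Complex.sub_conj, Complex.log_im]
        have := Complex.I_ne_zero
        push_cast
        field_simp
      rw [h2] at h1
      refine h1.congr_deriv ?_ ?_
      · simp; ring
      · simp; ring
    refine (harg.comp_real (hasDerivAt_cosPrimitive _)).congr_deriv ?_ ?_
    · rw [mul_one_div]
    · rw [mul_neg, mul_one_div]
  by_cases h : μ ∈ Complex.slitPlane
  · exact key μ h
  · have h' : -μ ∈ Complex.slitPlane := by
      rw [Complex.mem_slitPlane_iff, not_or, not_lt, not_not] at h
      rw [Complex.mem_slitPlane_iff]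
      left
      rw [Complex.neg_re, Left.neg_pos_iff]
      exact lt_of_le_of_ne h.1 fun h0 => hμ (Complex.ext h0 h.2)
    have h2 := (key (-μ) h').comp (HasWirtingerAt.of_hasDerivAt (hasDerivAt_neg μ))
    simp only [cosPrimitive_arg_neg] at h2
    have hcos : |Real.cos (Complex.arg (-μ))| = |Real.cos (Complex.arg μ)| := by
      rw [Complex.cos_arg hμ, Complex.cos_arg (neg_ne_zero.2 hμ), norm_neg, Complex.neg_re, neg_div,
        abs_neg]
    rw [hcos] at h2
    have hμ' : conj μ ≠ 0 := (_root_.map_ne_zero _).2 hμ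
    have := Complex.I_ne_zero
    refine h2.congr_deriv ?_ ?_
    · simp; field_simp
    · simp; field_simp

/-- The bounded phase function `G(μ) = e^{-it} h(t)`, `t = arg μ`, regularised at scale `M`. -/
noncomputable def phaseFun (M : ℝ) (μ : ℂ) : ℂ :=
  conj μ * (((√(Complex.normSq μ) / (Complex.normSq μ + M ^ 2) : ℝ) : ℂ) *
    (cosPrimitive (Complex.arg μ) : ℂ))

/-- The angular derivative of the phase function. -/
noncomputable def phaseDeriv (M : ℝ) (μ : ℂ) : ℝ :=
  ‖μ‖ / (‖μ‖ ^ 2 + M ^ 2) * (|Real.cos (Complex.arg μ)| / 2 - 1 / Real.pi)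

lemma phaseFun_eq (M : ℝ) (μ : ℂ) : phaseFun M μ =
    conj μ * (((‖μ‖ / (‖μ‖ ^ 2 + M ^ 2) : ℝ) : ℂ) * (cosPrimitive (Complex.arg μ) : ℂ)) := by
  rw [phaseFun, Complex.normSq_eq_norm_sq, Real.sqrt_sq (norm_nonneg _)]

lemma hasWirtingerAt_normSq_comp {f : ℂ → ℂ} {a b z : ℂ} (h : HasWirtingerAt f a b z) :
    HasWirtingerAt (fun z => (Complex.normSq (f z) : ℂ)) (a * conj (f z) + f z * conj b)
      (b * conj (f z) + f z * conj a) z := by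
  have := h.mul h.conj_comp
  simpa only [Complex.mul_conj] using this

lemma hasWirtingerAt_id (z : ℂ) : HasWirtingerAt (fun z => z) 1 0 z :=
  HasWirtingerAt.of_hasDerivAt (hasDerivAt_id z)

lemma norm_phaseFun_le {M : ℝ} (hM : 0 < M) (μ : ℂ) : ‖phaseFun M μ‖ ≤ 2 := by
  rw [phaseFun_eq, norm_mul, norm_mul, RCLike.norm_conj, Complex.norm_real, Complex.norm_real,
    Real.norm_eq_abs, Real.norm_eq_abs, abs_of_nonneg (by positivity), ← mul_assoc]
  have h1 : ‖μ‖ * (‖μ‖ / (‖μ‖ ^ 2 + M ^ 2)) ≤ 1 := by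
    rw [← mul_div_assoc, div_le_one (by positivity)]
    nlinarith [sq_nonneg M]
  calc _ ≤ 1 * 2 := mul_le_mul h1 (abs_cosPrimitive_le _) (abs_nonneg _) zero_le_one
    _ = 2 := by norm_num

lemma norm_phaseFun_le_sq {M : ℝ} (hM : 0 < M) (μ : ℂ) : ‖phaseFun M μ‖ ≤ 2 / M ^ 2 * ‖μ‖ ^ 2 := by
  rw [phaseFun_eq, norm_mul, norm_mul, RCLike.norm_conj, Complex.norm_real, Complex.norm_real,
    Real.norm_eq_abs, Real.norm_eq_abs, abs_of_nonneg (by positivity), ← mul_assoc]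
  have h1 : ‖μ‖ * (‖μ‖ / (‖μ‖ ^ 2 + M ^ 2)) ≤ ‖μ‖ ^ 2 / M ^ 2 := by
    rw [← mul_div_assoc, ← pow_two]
    gcongr
    nlinarith [sq_nonneg ‖μ‖]
  calc _ ≤ ‖μ‖ ^ 2 / M ^ 2 * 2 :=
        mul_le_mul h1 (abs_cosPrimitive_le _) (abs_nonneg _) (by positivity)
    _ = _ := by ring

/-- The Wirtinger derivatives of the phase function: size, and the angular derivative. -/
lemma exists_hasWirtingerAt_phaseFun {M : ℝ} (hM : 0 < M) (μ : ℂ) :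
    ∃ α β : ℂ, HasWirtingerAt (phaseFun M) α β μ ∧ ‖α‖ ≤ 6 * (‖μ‖ / (‖μ‖ ^ 2 + M ^ 2)) ∧
      ‖β‖ ≤ 6 * (‖μ‖ / (‖μ‖ ^ 2 + M ^ 2)) ∧
      phaseFun M μ + μ * α - conj μ * β = -Complex.I * conj μ * phaseDeriv M μ := by
  -- At the origin `arg` is singular, but the function is bounded by a multiple of `|μ|²`, so its
  -- derivative there is `0`.
  rcases eq_or_ne μ 0 with rfl | hμ
  · refine ⟨0, 0, ?_, by simp, by simp, by simp [phaseFun]⟩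
    refine HasWirtingerAt.of_hasFDerivAt (L := 0) ?_ (by simp)
    rw [hasFDerivAt_iff_isLittleO_nhds_zero]
    have h0 : phaseFun M 0 = 0 := by simp [phaseFun]
    simp only [zero_add, h0, sub_zero, zero_apply]
    refine (Asymptotics.IsBigO.of_bound (2 / M ^ 2) (Eventually.of_forall fun x => ?_) :
      phaseFun M =O[𝓝 0] fun x : ℂ => ‖x‖ ^ 2).trans_isLittleO ?_
    · rw [norm_pow, norm_norm]; exact norm_phaseFun_le_sq hM x
    · exact Asymptotics.isLittleO_norm_pow_id one_lt_two
  · set R := ‖μ‖ with hR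
    have hR0 : 0 < R := norm_pos_iff.2 hμ
    set u := cosPrimitive (Complex.arg μ) with hu
    set u' := |Real.cos (Complex.arg μ)| / 2 - 1 / Real.pi with hu'
    have hnsq : Complex.normSq μ = R ^ 2 := Complex.normSq_eq_norm_sq μ
    set D := R ^ 2 + M ^ 2 with hD
    have hD0 : 0 < D := by positivity
    have hφ : HasDerivAt (fun x : ℝ => √x / (x + M ^ 2))
        ((1 / (2 * R) * D - R * 1) / D ^ 2) (Complex.normSq μ) := by
      have h1 : HasDerivAt (fun x : ℝ => √x) (1 / (2 * R)) (Complex.normSq μ) := by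
        convert Real.hasDerivAt_sqrt (x := Complex.normSq μ) (by rw [hnsq]; positivity) using 3
        rw [hnsq, Real.sqrt_sq hR0.le]
      have h2 : HasDerivAt (fun x : ℝ => x + M ^ 2) 1 (Complex.normSq μ) :=
        (hasDerivAt_id _).add_const _
      have h3 := h1.fun_div h2 (by rw [hnsq]; positivity)
      rw [hnsq, Real.sqrt_sq hR0.le] at h3
      rwa [hnsq]
    have hcalc := (hasWirtingerAt_id μ).conj_comp.mul
      (((hasWirtingerAt_normSq_comp (hasWirtingerAt_id μ)).comp_real hφ).mul
        (hasWirtingerAt_cosPrimitive_arg hμ))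
    have hμ' : conj μ ≠ 0 := (_root_.map_ne_zero _).2 hμ
    have hI := Complex.I_ne_zero
    have hR2 : (R : ℂ) ^ 2 = μ * conj μ := by
      rw [Complex.mul_conj, hnsq]; push_cast; rfl
    have hRc : (R : ℂ) ≠ 0 := by exact_mod_cast hR0.ne'
    have hDc : (D : ℂ) ≠ 0 := by exact_mod_cast hD0.ne'
    have hsq : √(Complex.normSq μ) / (Complex.normSq μ + M ^ 2) = R / D := by
      rw [hnsq, Real.sqrt_sq hR0.le]
    have hG : phaseFun M μ = conj μ * ((R / D : ℝ) * u) := phaseFun_eq M μ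
    have hB : |1 / 2 - R ^ 2 / D| ≤ 3 / 2 := by
      have h1 : R ^ 2 / D ≤ 1 := by rw [div_le_one hD0]; nlinarith [sq_nonneg M]
      have h2 : 0 ≤ R ^ 2 / D := by positivity
      rw [abs_le]; constructor <;> linarith
    have hau := abs_cosPrimitive_le (Complex.arg μ)
    have hau' := abs_cosPrimitive_deriv_le (Complex.arg μ)
    have hun : ‖conj μ / μ‖ = 1 := by
      rw [norm_div, RCLike.norm_conj, div_self hR0.ne']
    have hα : HasWirtingerAt (phaseFun M)
        (conj μ / μ * ((R / D : ℝ) * ((1 / 2 - R ^ 2 / D : ℝ) * u + (-Complex.I) * (1 / 2 * u' : ℝ))))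
        ((R / D : ℝ) * ((1 : ℝ) * u + (1 / 2 - R ^ 2 / D : ℝ) * u + Complex.I * (1 / 2 * u' : ℝ))) μ := by
      have hI2 : ∀ x : ℂ, (2 * Complex.I * x)⁻¹ = -Complex.I / 2 * x⁻¹ := fun x => by
        rw [mul_inv, mul_inv, Complex.inv_I]; ring
      have hφ' : μ * conj μ * (((1 / (2 * R) * D - R * 1) / D ^ 2 : ℝ) : ℂ) =
          (R / D : ℝ) * (1 / 2 - R ^ 2 / D : ℝ) := by
        rw [← hR2]
        push_cast
        field_simp
      have hm : μ * μ⁻¹ = 1 := mul_inv_cancel₀ hμ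
      have hm' : conj μ * (conj μ)⁻¹ = 1 := mul_inv_cancel₀ hμ'
      refine hcalc.congr_deriv ?_ ?_
      · simp only [hsq, map_zero, ← hu, ← hu', div_eq_mul_inv (u' : ℂ), hI2,
          div_eq_mul_inv (conj μ) μ]
        generalize (((1 / (2 * R) * D - R * 1) / D ^ 2 : ℝ) : ℂ) = f at *
        push_cast at hφ' ⊢
        linear_combination (conj μ * μ⁻¹ * u) * hφ' - (conj μ) ^ 2 * f * u * hm
      · simp only [hsq, map_one, ← hu, ← hu', div_eq_mul_inv (u' : ℂ), hI2]
        generalize (((1 / (2 * R) * D - R * 1) / D ^ 2 : ℝ) : ℂ) = f at *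
        push_cast at hφ' ⊢
        linear_combination u * hφ' + (R / D * u' * (Complex.I / 2)) * hm'
    have hnorm : ∀ x y : ℝ, ‖(x : ℂ) + Complex.I * (y : ℂ)‖ ≤ |x| + |y| := fun x y => by
      refine (norm_add_le _ _).trans ?_
      rw [norm_mul, Complex.norm_I, one_mul, Complex.norm_real, Complex.norm_real]
      rfl
    have hRD : 0 ≤ R / D := by positivity
    have hu'2 : |1 / 2 * u'| ≤ 1 / 4 := by
      rw [abs_mul, abs_of_pos (by norm_num : (0 : ℝ) < 1 / 2)]; linarith
    have hBu : |(1 / 2 - R ^ 2 / D) * u| ≤ 3 := by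
      rw [abs_mul]
      have := mul_le_mul hB hau (abs_nonneg _) (by norm_num)
      linarith
    refine ⟨_, _, hα, ?_, ?_, ?_⟩
    · rw [norm_mul, hun, one_mul, norm_mul, Complex.norm_real, Real.norm_eq_abs, abs_of_nonneg hRD,
        mul_comm]
      refine mul_le_mul_of_nonneg_right ?_ hRD
      have h1 := hnorm ((1 / 2 - R ^ 2 / D) * u) (-(1 / 2 * u'))
      rw [abs_neg] at h1
      have h2 : ((1 / 2 - R ^ 2 / D : ℝ) : ℂ) * u + -Complex.I * (1 / 2 * u' : ℝ) =
          (((1 / 2 - R ^ 2 / D) * u : ℝ) : ℂ) + Complex.I * ((-(1 / 2 * u') : ℝ) : ℂ) := by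
        push_cast; ring
      rw [h2]
      linarith
    · rw [norm_mul, Complex.norm_real, Real.norm_eq_abs, abs_of_nonneg hRD, mul_comm]
      refine mul_le_mul_of_nonneg_right ?_ hRD
      have h1 := hnorm (u + (1 / 2 - R ^ 2 / D) * u) (1 / 2 * u')
      have h2 : ((1 : ℝ) : ℂ) * u + ((1 / 2 - R ^ 2 / D : ℝ) : ℂ) * u + Complex.I * (1 / 2 * u' : ℝ) =
          ((u + (1 / 2 - R ^ 2 / D) * u : ℝ) : ℂ) + Complex.I * ((1 / 2 * u' : ℝ) : ℂ) := by
        push_cast; ring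
      rw [h2]
      linarith [abs_add_le u ((1 / 2 - R ^ 2 / D) * u)]
    -- The operator `μ∂ - conj μ · ∂̄` is `-i` times the angular derivative. On the factor `conj μ`
    -- it gives `-conj μ`, which the added `phaseFun M μ` cancels, leaving only the derivative of
    -- the periodic primitive.
    · rw [hG, phaseDeriv, ← hu', ← hR, ← hD]
      have hm : μ * (conj μ / μ) = conj μ := by field_simp
      rw [← mul_assoc μ, hm]
      push_cast
      ring

lemma continuous_fderiv_phaseFun_zero {M : ℝ} (hM : 0 < M) :
    ContinuousAt (fderiv ℝ (phaseFun M)) 0 := by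
  have hb : ∀ μ, ‖fderiv ℝ (phaseFun M) μ‖ ≤ 12 / M ^ 2 * ‖μ‖ := by
    intro μ
    obtain ⟨α, β, h, hα, hβ, -⟩ := exists_hasWirtingerAt_phaseFun hM μ
    have hle : ‖μ‖ / (‖μ‖ ^ 2 + M ^ 2) ≤ ‖μ‖ / M ^ 2 := by
      gcongr
      nlinarith [sq_nonneg ‖μ‖]
    refine ContinuousLinearMap.opNorm_le_bound _ (by positivity) fun y => ?_
    rw [HasFDerivAt.fderiv h]
    simp only [add_apply, smul_apply, ContinuousLinearMap.id_apply, smul_eq_mul,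
      ContinuousLinearEquiv.coe_coe, Complex.conjCLE_apply]
    refine (norm_add_le _ _).trans ?_
    rw [norm_mul, norm_mul, RCLike.norm_conj, ← add_mul]
    refine mul_le_mul_of_nonneg_right ?_ (norm_nonneg y)
    calc ‖α‖ + ‖β‖ ≤ 12 * (‖μ‖ / M ^ 2) := by linarith
      _ = 12 / M ^ 2 * ‖μ‖ := by ring
  have h0 : fderiv ℝ (phaseFun M) 0 = 0 := by
    have := hb 0
    rw [norm_zero, mul_zero] at this
    exact norm_le_zero_iff.1 this
  rw [ContinuousAt, h0]
  refine squeeze_zero_norm hb ?_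
  have : Tendsto (fun μ : ℂ => 12 / M ^ 2 * ‖μ‖) (𝓝 0) (𝓝 (12 / M ^ 2 * ‖(0 : ℂ)‖)) :=
    Continuous.tendsto (by fun_prop) 0
  simpa using this

lemma contDiffAt_phaseFun {M : ℝ} (hM : 0 < M) {μ : ℂ} (hμ : μ ≠ 0) :
    ContDiffAt ℝ 1 (phaseFun M) μ := by
  have h1 : ContDiffAt ℝ 1 (fun μ : ℂ => ‖μ‖ / (‖μ‖ ^ 2 + M ^ 2)) μ :=
    (contDiffAt_norm ℝ hμ).fun_div (((contDiffAt_norm ℝ hμ).pow 2).add contDiffAt_const)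
      (by positivity)
  have h2 : ContDiffAt ℝ 1 (fun μ : ℂ => ((‖μ‖ / (‖μ‖ ^ 2 + M ^ 2) : ℝ) : ℂ)) μ :=
    Complex.ofRealCLM.contDiff.contDiffAt.comp μ h1
  have h3 : ContDiffAt ℝ 1 (fun μ : ℂ => (cosPrimitive (Complex.arg μ) : ℂ)) μ :=
    Complex.ofRealCLM.contDiff.contDiffAt.comp μ (contDiffAt_cosPrimitive_arg hμ)
  have h4 : ContDiffAt ℝ 1 (fun μ : ℂ => conj μ) μ := Complex.conjCLE.contDiff.contDiffAt
  rw [funext (phaseFun_eq M)]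
  exact h4.mul (h2.mul h3)

lemma contDiff_phaseFun {M : ℝ} (hM : 0 < M) : ContDiff ℝ 1 (phaseFun M) := by
  rw [contDiff_one_iff_fderiv]
  constructor
  · intro μ
    obtain ⟨α, β, h, -⟩ := exists_hasWirtingerAt_phaseFun hM μ
    exact HasFDerivAt.differentiableAt h
  · rw [continuous_iff_continuousAt]
    intro μ
    rcases eq_or_ne μ 0 with rfl | hμ
    · exact continuous_fderiv_phaseFun_zero hM
    · exact (contDiffAt_phaseFun hM hμ).continuousAt_fderiv one_ne_zero

lemma abs_phaseDeriv_mul_le {M : ℝ} (hM : 0 < M) (μ : ℂ) : ‖μ‖ * |phaseDeriv M μ| ≤ 1 / 2 := by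
  rw [phaseDeriv, abs_mul, abs_of_nonneg (by positivity : 0 ≤ ‖μ‖ / (‖μ‖ ^ 2 + M ^ 2)), ← mul_assoc]
  have h1 : ‖μ‖ * (‖μ‖ / (‖μ‖ ^ 2 + M ^ 2)) ≤ 1 := by
    rw [← mul_div_assoc, div_le_one (by positivity)]
    nlinarith [sq_nonneg M]
  calc _ ≤ 1 * (1 / 2) :=
        mul_le_mul h1 (abs_cosPrimitive_deriv_le _) (abs_nonneg _) zero_le_one
    _ = 1 / 2 := by norm_num

/-- The phase function replaces `|Re μ| / 2` by its angular mean `|μ| / π`. -/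
lemma abs_re_sub_phaseDeriv_le {M : ℝ} (hM : 0 < M) (μ : ℂ) :
    |μ.re| / 2 - ‖μ‖ ^ 2 * phaseDeriv M μ ≤ ‖μ‖ / Real.pi + M := by
  have hre : |μ.re| = ‖μ‖ * |Real.cos (Complex.arg μ)| := by
    rw [← Complex.norm_mul_cos_arg μ, abs_mul, abs_of_nonneg (norm_nonneg _)]
  set c := |Real.cos (Complex.arg μ)| with hc
  have hc0 : 0 ≤ c := abs_nonneg _
  have hc1 : c ≤ 1 := Real.abs_cos_le_one _
  set R := ‖μ‖ with hR
  have hR0 : 0 ≤ R := norm_nonneg _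
  have hD : 0 < R ^ 2 + M ^ 2 := by positivity
  have h1 : R ^ 2 * (R / (R ^ 2 + M ^ 2)) = R - R * M ^ 2 / (R ^ 2 + M ^ 2) := by
    field_simp
    ring
  -- The part of `R` lost to the regularisation; `RM ≤ R² + M²` bounds it by `M`, whatever the size
  -- of `μ`.
  set e := R * M ^ 2 / (R ^ 2 + M ^ 2) with he
  have he0 : 0 ≤ e := by positivity
  have heM : e ≤ M := by
    rw [he, div_le_iff₀ hD]
    nlinarith [sq_nonneg (R - M), mul_pos hM hM, mul_nonneg hR0 hM.le]
  have hpi : 0 < 1 / Real.pi := by positivity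
  rw [phaseDeriv, ← mul_assoc, h1, hre]
  have h2 : R * c / 2 - (R - e) * (c / 2 - 1 / Real.pi) = R / Real.pi + e * (c / 2 - 1 / Real.pi) := by
    ring
  rw [h2]
  have h3 : e * (c / 2 - 1 / Real.pi) ≤ M * 1 :=
    (mul_le_mul_of_nonneg_left (by linarith) he0).trans
      (mul_le_mul_of_nonneg_right heM zero_le_one)
  linarith

/-! ### Cutoff, ramp, smoothed logarithmic derivative and direction -/

/-- A `C¹` cutoff with `A(1) = 1` and `A(x) √x ≤ 1`. -/
noncomputable def cutoff (x : ℝ) : ℝ := (max (5 - x) 0) ^ 2 / 16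

/-- A smooth decreasing ramp from `1/2` to `-1/2` around `1`. -/
noncomputable def ramp (δ x : ℝ) : ℝ := -(1 / Real.pi) * Real.arctan ((x - 1) / δ)

/-- The derivative of `-ramp δ`. -/
noncomputable def rampDeriv (δ x : ℝ) : ℝ :=
  (1 / Real.pi) * (1 / (1 + ((x - 1) / δ) ^ 2) * (1 / δ))

lemma hasDerivAt_max_zero_sq (x : ℝ) : HasDerivAt (fun x : ℝ => (max x 0) ^ 2) (2 * max x 0) x := by
  rcases lt_trichotomy x 0 with h | rfl | h
  · rw [max_eq_right h.le, mul_zero]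
    refine (hasDerivAt_const x (0 : ℝ)).congr_of_eventuallyEq ?_
    filter_upwards [gt_mem_nhds h] with y hy
    rw [max_eq_right hy.le]; norm_num
  · rw [max_self, mul_zero, hasDerivAt_iff_isLittleO_nhds_zero]
    simp only [zero_add, max_self, smul_zero, sub_zero]
    refine (Asymptotics.IsBigO.of_bound 1 (Eventually.of_forall fun y => ?_) :
      _ =O[𝓝 (0 : ℝ)] fun y : ℝ => ‖y‖ ^ 2).trans_isLittleO
        (Asymptotics.isLittleO_norm_pow_id one_lt_two)
    have h1 : |max y 0| ≤ |y| := by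
      rcases le_total y 0 with hy | hy
      · rw [max_eq_right hy, abs_zero]; exact abs_nonneg _
      · rw [max_eq_left hy]
    have h2 := pow_le_pow_left₀ (abs_nonneg _) h1 2
    simpa using h2
  · rw [max_eq_left h.le]
    have h1 : HasDerivAt (fun y : ℝ => y ^ 2) (2 * x) x := by
      simpa using hasDerivAt_pow 2 x
    refine h1.congr_of_eventuallyEq ?_
    filter_upwards [lt_mem_nhds h] with y hy
    rw [max_eq_left hy.le]

lemma hasDerivAt_cutoff (x : ℝ) : HasDerivAt cutoff (-(max (5 - x) 0) / 8) x := by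
  have h1 : HasDerivAt (fun x : ℝ => 5 - x) (-1) x := by
    simpa using (hasDerivAt_id x).const_sub 5
  have h2 := ((hasDerivAt_max_zero_sq (5 - x)).comp x h1).div_const 16
  refine h2.congr_deriv ?_
  ring

lemma contDiff_cutoff : ContDiff ℝ 1 cutoff := by
  rw [contDiff_one_iff_deriv]
  refine ⟨fun x => (hasDerivAt_cutoff x).differentiableAt, ?_⟩
  rw [show deriv cutoff = fun x => -(max (5 - x) 0) / 8 from
    funext fun x => (hasDerivAt_cutoff x).deriv]
  fun_prop

lemma cutoff_nonneg (x : ℝ) : 0 ≤ cutoff x := by unfold cutoff; positivity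

lemma cutoff_eq_zero {x : ℝ} (hx : 5 < x) : cutoff x = 0 := by
  rw [cutoff, max_eq_right (by linarith)]; norm_num

lemma cutoff_le {x : ℝ} (hx : 0 ≤ x) : cutoff x ≤ 25 / 16 := by
  have h1 : max (5 - x) 0 ≤ 5 := max_le (by linarith) (by norm_num)
  have h2 : 0 ≤ max (5 - x) 0 := le_max_right _ _
  unfold cutoff
  nlinarith

lemma cutoff_one : cutoff 1 = 1 := by
  rw [cutoff, max_eq_left (by norm_num)]; norm_num

/-- The constant `5` in `cutoff` is the one for which `t (5 - t²)²` has its maximum on `[0, √5]` at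
`t = 1`. The main term thereby enters with coefficient at most `1`, although the cutoff extends well
beyond the lemniscate. -/
lemma cutoff_sq_mul_le {t : ℝ} (ht : 0 ≤ t) : cutoff (t ^ 2) * t ≤ 1 := by
  rcases le_or_gt (t ^ 2) 5 with h | h
  · rw [cutoff, max_eq_left (by linarith)]
    -- `16 - t (5 - t²)² = (t - 1)² (...)`
    have key : 0 ≤ 16 - t * (5 - t ^ 2) ^ 2 := by
      have : 16 - t * (5 - t ^ 2) ^ 2 = (1 - t) ^ 2 * (16 + 7 * t - 2 * t ^ 2 - t ^ 3) := by ring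
      rw [this]
      have ht3 : t ≤ 9 / 4 := by nlinarith
      have : 0 ≤ 16 + 7 * t - 2 * t ^ 2 - t ^ 3 := by nlinarith [mul_nonneg ht ht]
      positivity
    linarith
  · rw [cutoff_eq_zero h, zero_mul]; exact zero_le_one

lemma hasDerivAt_ramp (δ x : ℝ) : HasDerivAt (ramp δ) (-rampDeriv δ x) x := by
  have h1 : HasDerivAt (fun x : ℝ => (x - 1) / δ) (1 / δ) x :=
    ((hasDerivAt_id x).sub_const 1).div_const δ
  have h2 := (h1.arctan).const_mul (-(1 / Real.pi))
  refine h2.congr_deriv ?_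
  rw [rampDeriv]; ring

lemma contDiff_ramp (δ : ℝ) : ContDiff ℝ 1 (ramp δ) := by
  have h1 : ContDiff ℝ 1 fun x : ℝ => (x - 1) / δ := by fun_prop
  exact contDiff_const.mul h1.arctan

lemma abs_ramp_le (δ x : ℝ) : |ramp δ x| ≤ 1 / 2 := by
  have h : |Real.arctan ((x - 1) / δ)| ≤ Real.pi / 2 :=
    abs_le.2 ⟨(Real.neg_pi_div_two_lt_arctan _).le, (Real.arctan_lt_pi_div_two _).le⟩
  rw [ramp, abs_mul, abs_neg, abs_of_pos (by positivity : 0 < 1 / Real.pi)]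
  calc 1 / Real.pi * |Real.arctan ((x - 1) / δ)| ≤ 1 / Real.pi * (Real.pi / 2) := by gcongr
    _ = 1 / 2 := by field_simp

lemma continuous_rampDeriv (δ : ℝ) : Continuous (rampDeriv δ) := by
  unfold rampDeriv
  refine continuous_const.mul ((continuous_const.div (by fun_prop) fun x => ?_).mul
    continuous_const)
  positivity

lemma rampDeriv_nonneg {δ : ℝ} (hδ : 0 < δ) (x : ℝ) : 0 ≤ rampDeriv δ x := by
  unfold rampDeriv; positivity

/-- The regularised logarithmic derivative `∑ conj (z - ξ) / (|z - ξ|² + r²)`. -/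
noncomputable def smoothLogDeriv {m : ℕ} (ξ : Fin m → ℂ) (r : ℝ) (z : ℂ) : ℂ :=
  ∑ i, conj (z - ξ i) * ((1 / (Complex.normSq (z - ξ i) + r ^ 2) : ℝ) : ℂ)

lemma hasWirtingerAt_smoothLogDeriv {m : ℕ} (ξ : Fin m → ℂ) {r : ℝ} (hr : 0 < r) (z : ℂ) :
    ∃ a b : ℂ, HasWirtingerAt (smoothLogDeriv ξ r) a b z ∧
      ‖a‖ ≤ ∑ i, 1 / (‖z - ξ i‖ ^ 2 + r ^ 2) ∧ ‖b‖ ≤ ∑ i, 1 / (‖z - ξ i‖ ^ 2 + r ^ 2) := by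
  have key : ∀ i, HasWirtingerAt
      (fun z => conj (z - ξ i) * ((1 / (Complex.normSq (z - ξ i) + r ^ 2) : ℝ) : ℂ))
      (-(conj (z - ξ i) ^ 2 / ((‖z - ξ i‖ ^ 2 + r ^ 2 : ℝ) : ℂ) ^ 2))
      ((r ^ 2 / (‖z - ξ i‖ ^ 2 + r ^ 2) ^ 2 : ℝ) : ℂ) z := by
    intro i
    have h1 : HasWirtingerAt (fun z => z - ξ i) 1 0 z :=
      HasWirtingerAt.of_hasDerivAt ((hasDerivAt_id z).sub_const (ξ i))
    have hD : (Complex.normSq (z - ξ i) + r ^ 2) ≠ 0 := by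
      have := Complex.normSq_nonneg (z - ξ i); positivity
    have h2 : HasDerivAt (fun x : ℝ => 1 / (x + r ^ 2))
        (-1 / (Complex.normSq (z - ξ i) + r ^ 2) ^ 2) (Complex.normSq (z - ξ i)) := by
      simpa using (((hasDerivAt_id (Complex.normSq (z - ξ i))).add_const (r ^ 2)).fun_inv hD)
    have h3 := h1.conj_comp.mul ((hasWirtingerAt_normSq_comp h1).comp_real h2)
    have hn : ((Complex.normSq (z - ξ i) : ℝ) : ℂ) = (z - ξ i) * conj (z - ξ i) :=
      (Complex.mul_conj _).symm
    rw [← Complex.normSq_eq_norm_sq]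
    have hDc : ((Complex.normSq (z - ξ i) : ℝ) : ℂ) + (r : ℂ) ^ 2 ≠ 0 := by exact_mod_cast hD
    refine h3.congr_deriv ?_ ?_
    · push_cast
      simp only [map_zero, mul_zero, add_zero, zero_mul, zero_add, one_mul]
      ring
    · push_cast
      simp only [map_one, mul_one, zero_mul, zero_add, one_mul]
      field_simp
      rw [hn]
      ring
  refine ⟨_, _, HasWirtingerAt.sum Finset.univ fun i _ => key i, ?_, ?_⟩
  · refine (norm_sum_le _ _).trans (Finset.sum_le_sum fun i _ => ?_)
    have hD : 0 < ‖z - ξ i‖ ^ 2 + r ^ 2 := by positivity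
    rw [norm_neg, norm_div, norm_pow, norm_pow, RCLike.norm_conj, Complex.norm_real,
      Real.norm_eq_abs, abs_of_pos hD, div_le_div_iff₀ (by positivity) hD]
    nlinarith [mul_nonneg hD.le (sq_nonneg r)]
  · refine (norm_sum_le _ _).trans (Finset.sum_le_sum fun i _ => ?_)
    have hD : 0 < ‖z - ξ i‖ ^ 2 + r ^ 2 := by positivity
    rw [Complex.norm_real, Real.norm_eq_abs, abs_of_nonneg (by positivity),
      div_le_div_iff₀ (by positivity) hD]
    nlinarith [mul_nonneg hD.le (sq_nonneg ‖z - ξ i‖)]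

lemma contDiff_smoothLogDeriv {m : ℕ} (ξ : Fin m → ℂ) {r : ℝ} (hr : 0 < r) :
    ContDiff ℝ 1 (smoothLogDeriv ξ r) := by
  unfold smoothLogDeriv
  refine ContDiff.sum fun i _ => ?_
  have h1 : ContDiff ℝ 1 fun z : ℂ => z - ξ i := by fun_prop
  refine (Complex.conjCLE.contDiff.comp h1).mul (Complex.ofRealCLM.contDiff.comp ?_)
  simp only [Complex.normSq_eq_norm_sq]
  refine contDiff_const.div ((h1.norm_sq ℝ).add contDiff_const) fun z => by positivity

/-- The regularised unit tangent direction `p' / √(|p'|² + ε²)`. -/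
noncomputable def smoothSign (p : ℂ[X]) (ε : ℝ) (z : ℂ) : ℂ :=
  p.derivative.eval z * ((1 / √(Complex.normSq (p.derivative.eval z) + ε ^ 2) : ℝ) : ℂ)

lemma contDiff_eval (p : ℂ[X]) : ContDiff ℝ 1 fun z : ℂ => p.eval z :=
  (p.differentiable.contDiff (n := 1)).restrict_scalars ℝ

lemma contDiff_smoothSign (p : ℂ[X]) {ε : ℝ} (hε : 0 < ε) : ContDiff ℝ 1 (smoothSign p ε) := by
  unfold smoothSign
  refine (contDiff_eval _).mul (Complex.ofRealCLM.contDiff.comp ?_)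
  simp only [Complex.normSq_eq_norm_sq]
  exact contDiff_const.div ((((contDiff_eval p.derivative).norm_sq ℝ).add contDiff_const).sqrt
    fun z => by positivity) fun z => by positivity

lemma norm_smoothSign (p : ℂ[X]) (ε : ℝ) (z : ℂ) : ‖smoothSign p ε z‖ =
    ‖p.derivative.eval z‖ / √(‖p.derivative.eval z‖ ^ 2 + ε ^ 2) := by
  rw [smoothSign, norm_mul, Complex.norm_real, Real.norm_eq_abs, abs_of_nonneg (by positivity),
    Complex.normSq_eq_norm_sq, mul_one_div]

lemma norm_smoothSign_le (p : ℂ[X]) {ε : ℝ} (hε : 0 < ε) (z : ℂ) : ‖smoothSign p ε z‖ ≤ 1 := by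
  rw [norm_smoothSign, div_le_one (by positivity)]
  exact Real.le_sqrt_of_sq_le (by nlinarith [sq_nonneg ε])

/-- For `ε = 0` the function is a local branch of `√(p'/conj p')`, with derivatives `s p''/(2p')`
and `-s conj (p''/p')/2`. Here `ℓ` is the regularised `p''/p'`, and the term with `ε²` is the
remaining error. -/
lemma hasWirtingerAt_smoothSign (p : ℂ[X]) {ε : ℝ} (hε : 0 < ε) (z : ℂ) {P Q N ℓ : ℂ}
    (hP : P = p.derivative.eval z) (hQ : Q = p.derivative.derivative.eval z)
    (hN : N = ((√(‖p.derivative.eval z‖ ^ 2 + ε ^ 2) : ℝ) : ℂ)) (hℓ : ℓ = conj P * Q / N ^ 2) :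
    HasWirtingerAt (smoothSign p ε) (1 / 2 * ℓ * smoothSign p ε z + Q * ε ^ 2 / N ^ 3)
      (-(1 / 2) * smoothSign p ε z * conj ℓ) z := by
  have h1 : HasWirtingerAt (fun z => p.derivative.eval z) Q 0 z := by
    rw [hQ]; exact HasWirtingerAt.of_hasDerivAt (p.derivative.hasDerivAt z)
  set x := Complex.normSq (p.derivative.eval z) with hx
  have hx0 : 0 ≤ x := Complex.normSq_nonneg _
  have hxn : x = ‖p.derivative.eval z‖ ^ 2 := Complex.normSq_eq_norm_sq _
  rw [← hxn] at hN
  set t := √(x + ε ^ 2) with ht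
  have ht0 : 0 < t := by positivity
  have ht2 : t ^ 2 = x + ε ^ 2 := Real.sq_sqrt (by positivity)
  have h2 : HasDerivAt (fun x : ℝ => 1 / √(x + ε ^ 2)) (-(1 / (2 * t ^ 3))) x := by
    have h3 : HasDerivAt (fun x : ℝ => √(x + ε ^ 2)) (1 / (2 * t)) x :=
      ((hasDerivAt_id x).add_const (ε ^ 2)).sqrt (by positivity)
    have h4 := h3.fun_inv ht0.ne'
    simp only [one_div]
    refine h4.congr_deriv ?_
    rw [← ht]
    field_simp
  have h3 := h1.mul ((hasWirtingerAt_normSq_comp h1).comp_real h2)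
  have hs : smoothSign p ε z = P / N := by
    rw [smoothSign, ← hx, ← ht, ← hP, hN]; push_cast; rw [mul_one_div]
  have hN0 : N ≠ 0 := by rw [hN]; exact_mod_cast ht0.ne'
  have hNN : N ^ 2 = P * conj P + (ε : ℂ) ^ 2 := by
    rw [hN, hP, Complex.mul_conj, ← hx]; exact_mod_cast ht2
  have hNconj : conj N = N := by rw [hN, Complex.conj_ofReal]
  rw [hs]
  refine h3.congr_deriv ?_ ?_
  · rw [← hx, ← ht, ← hP, hℓ]
    push_cast
    rw [← hN, map_zero]
    field_simp
    rw [hNN]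
    ring
  · rw [← hx, ← ht, ← hP, hℓ]
    push_cast
    rw [← hN, map_div₀, map_mul, map_pow, hNconj, Complex.conj_conj]
    field_simp
    ring

/-! ### The pointwise estimate of `∂̄` of the test field -/

lemma two_mul_re_le (x : ℂ) : 2 * x.re ≤ 2 * ‖x‖ := by
  linarith [Complex.re_le_norm x]

lemma div_sq_add_sq_le {M : ℝ} (hM : 0 < M) (R : ℝ) : R / (R ^ 2 + M ^ 2) ≤ 1 / (2 * M) := by
  rw [div_le_div_iff₀ (by positivity) (by positivity)]
  nlinarith [sq_nonneg (R - M)]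

lemma mul_div_sq_add_le {M : ℝ} (hM : 0 < M) (R : ℝ) : R * (R / (R ^ 2 + M ^ 2)) ≤ 1 := by
  rw [← mul_div_assoc, div_le_one (by positivity)]
  nlinarith [sq_nonneg M]

/-- The pointwise estimate of `2 Re ∂̄Φ` in terms of the first derivatives of its constituents. -/
lemma two_mul_re_le_of_bounds {w P s Λ Λ₁ Λ₂ ℓ κ α β G μ v : ℂ} {A A' ψ k M : ℝ} (hM : 0 < M)
    (hv : v = conj w * s) (hμ : μ = v * conj Λ) (hw : ‖w‖ ≤ 9 / 4) (hs : ‖s‖ ≤ 1)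
    (hA0 : 0 ≤ A) (hA : A ≤ 25 / 16) (hAw : A * ‖w‖ ≤ 1) (hA' : |A'| ≤ 5 / 8)
    (hψ : |ψ| ≤ 1 / 2) (hG : ‖G‖ ≤ 2)
    (hα : ‖α‖ ≤ 6 * (‖μ‖ / (‖μ‖ ^ 2 + M ^ 2))) (hβ : ‖β‖ ≤ 6 * (‖μ‖ / (‖μ‖ ^ 2 + M ^ 2)))
    (hang : G + μ * α - conj μ * β = -Complex.I * conj μ * k) (hk : ‖μ‖ * |k| ≤ 1 / 2)
    (hmain : |μ.re| / 2 - ‖μ‖ ^ 2 * k ≤ ‖μ‖ / Real.pi + M) :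
    2 * (A' * (w * conj P) * (v * (ψ + Complex.I * G)) +
      A * ((conj P * s + conj w * (-(1 / 2) * s * conj ℓ)) * (ψ + Complex.I * G) +
        v * (Complex.I * (α * ((conj P * s + conj w * (-(1 / 2) * s * conj ℓ)) * conj Λ
          + v * conj Λ₁) + β * conj (conj w * (1 / 2 * ℓ * s + κ) * conj Λ + v * conj Λ₂))))).re ≤
      50 * ‖P‖ + ‖Λ‖ / Real.pi + 2 * M + 14 / M * (‖Λ₁‖ + ‖Λ₂‖) + ‖ℓ - Λ‖ + 12 * ‖κ‖ := by
  have hvw : ‖v‖ ≤ ‖w‖ := by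
    rw [hv, norm_mul, RCLike.norm_conj]
    exact mul_le_of_le_one_right (norm_nonneg _) hs
  have hAv : A * ‖v‖ ≤ 1 := (mul_le_mul_of_nonneg_left hvw hA0).trans hAw
  have hv9 : ‖v‖ ≤ 9 / 4 := hvw.trans hw
  have hμn : ‖μ‖ = ‖v‖ * ‖Λ‖ := by rw [hμ, norm_mul, RCLike.norm_conj]
  have hψG : ‖(ψ : ℂ) + Complex.I * G‖ ≤ 5 / 2 := by
    refine (norm_add_le _ _).trans ?_
    rw [norm_mul, Complex.norm_I, one_mul, Complex.norm_real, Real.norm_eq_abs]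
    linarith
  have hAn : ‖(A : ℂ)‖ = A := by rw [Complex.norm_real, Real.norm_eq_abs, abs_of_nonneg hA0]
  have hA'n : ‖(A' : ℂ)‖ ≤ 5 / 8 := by rwa [Complex.norm_real, Real.norm_eq_abs]
  set ρ := ‖μ‖ / (‖μ‖ ^ 2 + M ^ 2) with hρ
  have hρ0 : 0 ≤ ρ := by positivity
  have hρM : ρ ≤ 1 / (2 * M) := div_sq_add_sq_le hM _
  have hρμ : ‖μ‖ * ρ ≤ 1 := mul_div_sq_add_le hM _
  have hP0 := norm_nonneg P
  -- `T₁` comes from the cutoff, `T₂` and `T₅` from `∂̄ (conj p)`. `T₃` is the main term and `T₄`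
  -- the cost of replacing `ℓ` by its smoothing `Λ`. `T₆` and `T₈` come from differentiating `Λ`,
  -- `T₇` from regularising `p'/|p'|`.
  set T₁ : ℂ := A' * (w * conj P) * (v * (ψ + Complex.I * G)) with hT₁
  set T₂ : ℂ := A * (conj P * s * (ψ + Complex.I * G)) with hT₂
  set T₃ : ℂ := ((-(A / 2) : ℝ) : ℂ) * (ψ * μ + k * (μ * conj μ)) with hT₃
  set T₄ : ℂ := A * (-(1 / 2) * v * conj (ℓ - Λ) * (ψ + conj μ * k)) with hT₄
  set T₅ : ℂ := A * (v * (Complex.I * (α * (conj P * s * conj Λ)))) with hT₅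
  set T₆ : ℂ := A * (v * (Complex.I * (α * (v * conj Λ₁)))) with hT₆
  set T₇ : ℂ := A * (v * (Complex.I * (β * (w * conj κ * Λ)))) with hT₇
  set T₈ : ℂ := A * (v * (Complex.I * (β * (conj v * Λ₂)))) with hT₈
  have hsplit : A' * (w * conj P) * (v * (ψ + Complex.I * G)) +
      A * ((conj P * s + conj w * (-(1 / 2) * s * conj ℓ)) * (ψ + Complex.I * G) +
        v * (Complex.I * (α * ((conj P * s + conj w * (-(1 / 2) * s * conj ℓ)) * conj Λ
          + v * conj Λ₁) + β * conj (conj w * (1 / 2 * ℓ * s + κ) * conj Λ + v * conj Λ₂)))) =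
      T₁ + T₂ + T₃ + T₄ + T₅ + T₆ + T₇ + T₈ := by
    have h2 : conj (2 : ℂ) = 2 := Complex.conj_ofNat 2
    rw [hT₁, hT₂, hT₃, hT₄, hT₅, hT₆, hT₇, hT₈]
    subst hμ hv
    push_cast
    simp only [map_mul, map_add, map_sub, map_div₀, map_one, h2, Complex.conj_conj] at hang ⊢
    -- All terms in `conj ℓ` share the factor `-(A/2) v conj ℓ`. By `hang` the bracket `ψ + i(G + μα
    -- - conj μ · β)` becomes `ψ + conj μ · k`; splitting `v conj ℓ` as `μ + v conj (ℓ - Λ)` gives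
    -- `T₃` and `T₄`.
    linear_combination (-(1 / 2) * A * (conj w * s) * conj ℓ * Complex.I) * hang +
      (1 / 2 * A * (conj w * s) * conj ℓ * (w * conj s * Λ) * k) * Complex.I_sq
  have b₁ : 2 * T₁.re ≤ 16 * ‖P‖ := by
    refine (two_mul_re_le _).trans ?_
    have : ‖T₁‖ ≤ 5 / 8 * (9 / 4 * ‖P‖) * (9 / 4 * (5 / 2)) := by
      rw [hT₁]; simp only [norm_mul, RCLike.norm_conj] at *; gcongr
    linarith
  have b₂ : 2 * T₂.re ≤ 8 * ‖P‖ := by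
    refine (two_mul_re_le _).trans ?_
    have : ‖T₂‖ ≤ 25 / 16 * (‖P‖ * 1 * (5 / 2)) := by
      rw [hT₂]; simp only [norm_mul, RCLike.norm_conj, hAn] at *; gcongr
    linarith
  have b₃ : 2 * T₃.re ≤ ‖Λ‖ / Real.pi + 2 * M := by
    have h1 : T₃.re = -(A / 2) * (ψ * μ.re + k * ‖μ‖ ^ 2) := by
      rw [hT₃, Complex.re_ofReal_mul, Complex.mul_conj, Complex.normSq_eq_norm_sq, Complex.add_re,
        Complex.re_ofReal_mul, ← Complex.ofReal_mul, Complex.ofReal_re]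
    have h2 : -(ψ * μ.re) ≤ |μ.re| / 2 := by
      have := neg_le_abs (ψ * μ.re)
      rw [abs_mul] at this
      have h3 := mul_le_mul_of_nonneg_right hψ (abs_nonneg μ.re)
      linarith
    have h3 : A * ‖μ‖ ≤ ‖Λ‖ := by
      rw [hμn, ← mul_assoc]
      exact mul_le_of_le_one_left (norm_nonneg _) hAv
    calc 2 * T₃.re = A * (-(ψ * μ.re) - ‖μ‖ ^ 2 * k) := by rw [h1]; ring
      _ ≤ A * (‖μ‖ / Real.pi + M) := by
          apply mul_le_mul_of_nonneg_left _ hA0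
          linarith
      _ = A * ‖μ‖ / Real.pi + A * M := by ring
      _ ≤ ‖Λ‖ / Real.pi + 2 * M := by
          gcongr
          linarith
  have b₄ : 2 * T₄.re ≤ ‖ℓ - Λ‖ := by
    refine (two_mul_re_le _).trans ?_
    have h1 : ‖(ψ : ℂ) + conj μ * k‖ ≤ 1 := by
      refine (norm_add_le _ _).trans ?_
      rw [norm_mul, RCLike.norm_conj, Complex.norm_real, Complex.norm_real, Real.norm_eq_abs,
        Real.norm_eq_abs]
      linarith
    have h2 : ‖T₄‖ = 1 / 2 * (A * ‖v‖) * ‖ℓ - Λ‖ * ‖(ψ : ℂ) + conj μ * k‖ := by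
      rw [hT₄, norm_mul, norm_mul, norm_mul, norm_mul, hAn, RCLike.norm_conj, norm_neg]
      norm_num
      ring
    have h3 : ‖T₄‖ ≤ 1 / 2 * 1 * ‖ℓ - Λ‖ * 1 := by rw [h2]; gcongr
    linarith
  have b₅ : 2 * T₅.re ≤ 19 * ‖P‖ := by
    refine (two_mul_re_le _).trans ?_
    have h2 : ‖T₅‖ = A * (‖α‖ * ‖μ‖) * (‖P‖ * ‖s‖) := by
      rw [hT₅, hμn]
      simp only [norm_mul, RCLike.norm_conj, hAn, Complex.norm_I]
      ring
    have h3 : ‖α‖ * ‖μ‖ ≤ 6 := by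
      have := mul_le_mul_of_nonneg_right hα (norm_nonneg μ)
      linarith
    have h4 : ‖T₅‖ ≤ 25 / 16 * 6 * (‖P‖ * 1) := by rw [h2]; gcongr
    linarith
  have b₆ : 2 * T₆.re ≤ 14 / M * ‖Λ₁‖ := by
    refine (two_mul_re_le _).trans ?_
    have h2 : ‖T₆‖ = (A * ‖v‖) * ‖α‖ * (‖v‖ * ‖Λ₁‖) := by
      rw [hT₆]
      simp only [norm_mul, RCLike.norm_conj, hAn, Complex.norm_I]
      ring
    have h4 : ‖T₆‖ ≤ 1 * (6 * (1 / (2 * M))) * (9 / 4 * ‖Λ₁‖) := by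
      rw [h2]; gcongr; linarith
    have h5 : 2 * (1 * (6 * (1 / (2 * M))) * (9 / 4 * ‖Λ₁‖)) = (27 / 2) / M * ‖Λ₁‖ := by
      field_simp; ring
    have h6 : (27 / 2) / M * ‖Λ₁‖ ≤ 14 / M * ‖Λ₁‖ := by gcongr; norm_num
    linarith
  have b₇ : 2 * T₇.re ≤ 12 * ‖κ‖ := by
    refine (two_mul_re_le _).trans ?_
    have h2 : ‖T₇‖ = (A * ‖w‖) * (‖β‖ * ‖μ‖) * ‖κ‖ := by
      rw [hT₇, hμn]
      simp only [norm_mul, RCLike.norm_conj, hAn, Complex.norm_I]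
      ring
    have h3 : ‖β‖ * ‖μ‖ ≤ 6 := by
      have := mul_le_mul_of_nonneg_right hβ (norm_nonneg μ)
      linarith
    have h4 : ‖T₇‖ ≤ 1 * 6 * ‖κ‖ := by rw [h2]; gcongr
    linarith
  have b₈ : 2 * T₈.re ≤ 14 / M * ‖Λ₂‖ := by
    refine (two_mul_re_le _).trans ?_
    have h2 : ‖T₈‖ = (A * ‖v‖) * ‖β‖ * (‖v‖ * ‖Λ₂‖) := by
      rw [hT₈]
      simp only [norm_mul, RCLike.norm_conj, hAn, Complex.norm_I]
      ring
    have h4 : ‖T₈‖ ≤ 1 * (6 * (1 / (2 * M))) * (9 / 4 * ‖Λ₂‖) := by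
      rw [h2]; gcongr; linarith
    have h5 : 2 * (1 * (6 * (1 / (2 * M))) * (9 / 4 * ‖Λ₂‖)) = (27 / 2) / M * ‖Λ₂‖ := by
      field_simp; ring
    have h6 : (27 / 2) / M * ‖Λ₂‖ ≤ 14 / M * ‖Λ₂‖ := by gcongr; norm_num
    linarith
  rw [hsplit]
  simp only [Complex.add_re]
  have hd : 14 / M * (‖Λ₁‖ + ‖Λ₂‖) = 14 / M * ‖Λ₁‖ + 14 / M * ‖Λ₂‖ := by ring
  linarith

/-! ### The test field and its `∂̄` -/

/-- The regularised direction field `conj p · p' / |p'|`. -/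
noncomputable def directionField (p : ℂ[X]) (ε : ℝ) (z : ℂ) : ℂ :=
  conj (p.eval z) * smoothSign p ε z

/-- The compactly supported field to which the Stokes formula is applied. -/
noncomputable def testField (p : ℂ[X]) {m : ℕ} (ξ : Fin m → ℂ) (ε δ M r : ℝ) (z : ℂ) : ℂ :=
  (cutoff (Complex.normSq (p.eval z)) : ℂ) * (directionField p ε z *
    ((ramp δ (Complex.normSq (p.eval z)) : ℂ) +
      Complex.I * phaseFun M (directionField p ε z * conj (smoothLogDeriv ξ r z))))

lemma contDiff_testField (p : ℂ[X]) {m : ℕ} (ξ : Fin m → ℂ) {ε δ M r : ℝ} (hε : 0 < ε)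
    (hM : 0 < M) (hr : 0 < r) : ContDiff ℝ 1 (testField p ξ ε δ M r) := by
  have hn : ContDiff ℝ 1 fun z => Complex.normSq (p.eval z) := by
    simp only [Complex.normSq_eq_norm_sq]; exact (contDiff_eval p).norm_sq ℝ
  have hv : ContDiff ℝ 1 (directionField p ε) :=
    (Complex.conjCLE.contDiff.comp (contDiff_eval p)).mul (contDiff_smoothSign p hε)
  have hμ : ContDiff ℝ 1 fun z => directionField p ε z * conj (smoothLogDeriv ξ r z) :=
    hv.mul (Complex.conjCLE.contDiff.comp (contDiff_smoothLogDeriv ξ hr))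
  exact (Complex.ofRealCLM.contDiff.comp (contDiff_cutoff.comp hn)).mul
    (hv.mul ((Complex.ofRealCLM.contDiff.comp ((contDiff_ramp δ).comp hn)).add
      (contDiff_const.mul ((contDiff_phaseFun hM).comp hμ))))

lemma normSq_le_five_iff (w : ℂ) : Complex.normSq w ≤ 5 ↔ ‖w‖ ≤ √5 := by
  rw [Complex.normSq_eq_norm_sq, Real.le_sqrt (norm_nonneg _) (by norm_num)]

lemma hasCompactSupport_testField {p : ℂ[X]} (hn : p.natDegree ≠ 0) {m : ℕ} (ξ : Fin m → ℂ)
    (ε δ M r : ℝ) : HasCompactSupport (testField p ξ ε δ M r) := by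
  refine HasCompactSupport.intro (isCompact_norm_eval_le hn √5) fun z hz => ?_
  have hz' : 5 < Complex.normSq (p.eval z) := by
    rw [← not_le, normSq_le_five_iff]; exact hz
  rw [testField, cutoff_eq_zero hz', Complex.ofReal_zero, zero_mul]

/-- The density whose integral is compared with the length of the lemniscate. -/
noncomputable def lengthDensity (p : ℂ[X]) (ε δ : ℝ) (z : ℂ) : ℝ :=
  2 * cutoff (‖p.eval z‖ ^ 2) * rampDeriv δ (‖p.eval z‖ ^ 2) * ‖p.eval z‖ ^ 2 *
    (‖p.derivative.eval z‖ ^ 2 / √(‖p.derivative.eval z‖ ^ 2 + ε ^ 2))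

/-- Differentiating the ramp contributes exactly `-lengthDensity` to `2 Re ∂̄Φ`. Adding the density
cancels it, and `two_mul_re_le_of_bounds` handles what remains. -/
lemma two_mul_re_dbar_testField_le (p : ℂ[X]) {m : ℕ} (ξ : Fin m → ℂ) {ε δ M r : ℝ} (hε : 0 < ε)
    (hM : 0 < M) (hr : 0 < r) {z P Q N ℓ : ℂ}
    (hP : P = p.derivative.eval z) (hQ : Q = p.derivative.derivative.eval z)
    (hN : N = ((√(‖p.derivative.eval z‖ ^ 2 + ε ^ 2) : ℝ) : ℂ)) (hℓ : ℓ = conj P * Q / N ^ 2)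
    (hz : ‖p.eval z‖ ≤ √5) :
    2 * (dbar (testField p ξ ε δ M r) z).re + lengthDensity p ε δ z ≤
      50 * ‖P‖ + ‖smoothLogDeriv ξ r z‖ / Real.pi + 2 * M +
        28 / M * ∑ i, 1 / (‖z - ξ i‖ ^ 2 + r ^ 2) + ‖ℓ - smoothLogDeriv ξ r z‖ +
        12 * ‖Q * ε ^ 2 / N ^ 3‖ := by
  obtain ⟨Λ₁, Λ₂, hΛ, hΛ₁, hΛ₂⟩ := hasWirtingerAt_smoothLogDeriv ξ hr z
  have hp : HasWirtingerAt (fun z => p.eval z) P 0 z := by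
    rw [hP]; exact HasWirtingerAt.of_hasDerivAt (p.hasDerivAt z)
  have hs := hasWirtingerAt_smoothSign p hε z hP hQ hN hℓ
  have hv : HasWirtingerAt (directionField p ε) _ _ z := hp.conj_comp.mul hs
  have hμ := hv.mul hΛ.conj_comp
  obtain ⟨α, β, hG, hα, hβ, hang⟩ := exists_hasWirtingerAt_phaseFun hM
    (directionField p ε z * conj (smoothLogDeriv ξ r z))
  have hnsq := hasWirtingerAt_normSq_comp hp
  have hΦ := (hnsq.comp_real (hasDerivAt_cutoff _)).mul (hv.mul
    ((hnsq.comp_real (hasDerivAt_ramp δ _)).add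
      ((HasWirtingerAt.const Complex.I z).mul (HasWirtingerAt.comp
        (f := fun z => directionField p ε z * conj (smoothLogDeriv ξ r z)) hG hμ))))
  have hdb := HasWirtingerAt.dbar_eq (f := testField p ξ ε δ M r) hΦ
  rw [hdb]
  have hw94 : ‖p.eval z‖ ≤ 9 / 4 := hz.trans (Real.sqrt_le_iff.2 ⟨by norm_num, by norm_num⟩)
  have hx : Complex.normSq (p.eval z) = ‖p.eval z‖ ^ 2 := Complex.normSq_eq_norm_sq _
  have hx5 : ‖p.eval z‖ ^ 2 ≤ 5 := by rw [← hx]; exact (normSq_le_five_iff _).2 hz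
  have hA' : |-(max (5 - ‖p.eval z‖ ^ 2) 0) / 8| ≤ 5 / 8 := by
    rw [max_eq_left (by linarith), abs_le]
    constructor <;> nlinarith [sq_nonneg ‖p.eval z‖]
  have hbound := two_mul_re_le_of_bounds (P := P) (Λ₁ := Λ₁) (Λ₂ := Λ₂) (ℓ := ℓ)
    (κ := Q * ε ^ 2 / N ^ 3) (v := directionField p ε z) (w := p.eval z) hM rfl rfl hw94
    (norm_smoothSign_le p hε z) (cutoff_nonneg (‖p.eval z‖ ^ 2)) (cutoff_le (by positivity))
    (cutoff_sq_mul_le (norm_nonneg (p.eval z))) hA' (abs_ramp_le δ (‖p.eval z‖ ^ 2))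
    (norm_phaseFun_le hM _) hα hβ hang (abs_phaseDeriv_mul_le hM _)
    (abs_re_sub_phaseDeriv_le hM _)
  have hld : ((lengthDensity p ε δ z : ℝ) : ℂ) = 2 * (cutoff (‖p.eval z‖ ^ 2) *
      (directionField p ε z * (rampDeriv δ (‖p.eval z‖ ^ 2) * (p.eval z * conj P)))) := by
    have hNn : P * conj P = ((‖P‖ ^ 2 : ℝ) : ℂ) := by
      rw [Complex.mul_conj, Complex.normSq_eq_norm_sq]
    have hwn : p.eval z * conj (p.eval z) = ((‖p.eval z‖ ^ 2 : ℝ) : ℂ) := by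
      rw [Complex.mul_conj, Complex.normSq_eq_norm_sq]
    have hs' : smoothSign p ε z = P * ((1 / √(‖P‖ ^ 2 + ε ^ 2) : ℝ) : ℂ) := by
      rw [smoothSign, Complex.normSq_eq_norm_sq, hP]
    rw [lengthDensity, directionField, hs', ← hP]
    calc _ = 2 * (cutoff (‖p.eval z‖ ^ 2) : ℂ) * rampDeriv δ (‖p.eval z‖ ^ 2) *
          ((‖p.eval z‖ ^ 2 : ℝ) : ℂ) * (((‖P‖ ^ 2 : ℝ) : ℂ) *
            ((1 / √(‖P‖ ^ 2 + ε ^ 2) : ℝ) : ℂ)) := by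
          push_cast; ring
      _ = _ := by rw [← hNn, ← hwn]; ring
  have hldr : lengthDensity p ε δ z = 2 * ((cutoff (‖p.eval z‖ ^ 2) : ℂ) *
      (directionField p ε z * (rampDeriv δ (‖p.eval z‖ ^ 2) * (p.eval z * conj P)))).re := by
    have := congrArg Complex.re hld
    rw [Complex.ofReal_re, Complex.mul_re] at this
    simpa using this
  rw [hldr, ← mul_add, ← Complex.add_re]
  have hM28 : 14 / M * (‖Λ₁‖ + ‖Λ₂‖) ≤ 28 / M * ∑ i, 1 / (‖z - ξ i‖ ^ 2 + r ^ 2) := by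
    calc 14 / M * (‖Λ₁‖ + ‖Λ₂‖) ≤ 14 / M * ((∑ i, 1 / (‖z - ξ i‖ ^ 2 + r ^ 2)) +
          ∑ i, 1 / (‖z - ξ i‖ ^ 2 + r ^ 2)) := by gcongr
      _ = _ := by ring
  refine le_trans (le_of_eq ?_) (hbound.trans (by linarith))
  congr 2
  simp only [hx, map_zero, zero_mul, zero_add, Complex.ofReal_neg]
  ring

lemma norm_inv_sub_smooth_eq {d : ℂ} (hd : d ≠ 0) {r : ℝ} (hr : 0 < r) :
    ‖d⁻¹ - conj d * ((1 / (Complex.normSq d + r ^ 2) : ℝ) : ℂ)‖ =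
      ‖d‖⁻¹ * (r ^ 2 / (‖d‖ ^ 2 + r ^ 2)) := by
  have hD : (0 : ℝ) < ‖d‖ ^ 2 + r ^ 2 := by positivity
  have hDc : ((‖d‖ ^ 2 + r ^ 2 : ℝ) : ℂ) ≠ 0 := by exact_mod_cast hD.ne'
  have h1 : d⁻¹ - conj d * ((1 / (Complex.normSq d + r ^ 2) : ℝ) : ℂ) =
      d⁻¹ * ((r ^ 2 / (‖d‖ ^ 2 + r ^ 2) : ℝ) : ℂ) := by
    have hn : d * conj d = ((‖d‖ ^ 2 : ℝ) : ℂ) := by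
      rw [Complex.mul_conj, Complex.normSq_eq_norm_sq]
    rw [Complex.normSq_eq_norm_sq]
    push_cast at hn hDc ⊢
    field_simp
    linear_combination -hn
  rw [h1, norm_mul, norm_inv, Complex.norm_real, Real.norm_eq_abs, abs_of_nonneg (by positivity)]

lemma norm_smooth_le {d : ℂ} {r : ℝ} (hr : 0 < r) :
    ‖conj d * ((1 / (Complex.normSq d + r ^ 2) : ℝ) : ℂ)‖ ≤ ‖d‖⁻¹ := by
  rcases eq_or_ne d 0 with rfl | hd
  · simp
  have hd0 : 0 < ‖d‖ := norm_pos_iff.2 hd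
  rw [norm_mul, RCLike.norm_conj, Complex.norm_real, Complex.normSq_eq_norm_sq, Real.norm_eq_abs,
    abs_of_nonneg (by positivity), mul_one_div, inv_eq_one_div, div_le_div_iff₀ (by positivity) hd0]
  nlinarith [sq_nonneg r]

lemma one_div_sq_add_sq_le {d r : ℝ} (hd : 0 < d) (hr : 0 < r) :
    1 / (d ^ 2 + r ^ 2) ≤ 1 / (2 * r) * d⁻¹ := by
  rw [inv_eq_one_div, div_mul_div_comm, one_mul, div_le_div_iff₀ (by positivity) (by positivity)]
  nlinarith [sq_nonneg (d - r)]

/-- The pointwise bound for `2 Re ∂̄Φ` in terms of the distances to the critical points. -/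
lemma two_mul_re_dbar_testField_le' (p : ℂ[X]) {m : ℕ} {ξ : Fin m → ℂ} {ε δ M r : ℝ} (hε : 0 < ε)
    (hM : 0 < M) (hr : 0 < r) {z : ℂ} (hz : ‖p.eval z‖ ≤ √5)
    (hreg : p.derivative.eval z ≠ 0) (hξ : ∀ i, z ≠ ξ i)
    (hQ : p.derivative.derivative.eval z = p.derivative.eval z * ∑ i, (z - ξ i)⁻¹) :
    2 * (dbar (testField p ξ ε δ M r) z).re + lengthDensity p ε δ z ≤
      50 * ‖p.derivative.eval z‖ + 2 * M + (1 / Real.pi + 14 / (M * r)) * ∑ i, ‖z - ξ i‖⁻¹ +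
        ∑ i, ‖z - ξ i‖⁻¹ * (r ^ 2 / (‖z - ξ i‖ ^ 2 + r ^ 2)) +
        13 * ((∑ i, ‖z - ξ i‖⁻¹) * (ε ^ 2 / (‖p.derivative.eval z‖ ^ 2 + ε ^ 2))) := by
  have h := two_mul_re_dbar_testField_le p ξ (δ := δ) hε hM hr rfl rfl rfl rfl hz
  rw [hQ] at h
  set P := p.derivative.eval z with hP
  set l := ∑ i, (z - ξ i)⁻¹ with hl
  set t := √(‖P‖ ^ 2 + ε ^ 2) with ht
  set σ := ∑ i, ‖z - ξ i‖⁻¹ with hσ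
  set E := ε ^ 2 / (‖P‖ ^ 2 + ε ^ 2) with hE
  have hpi := Real.pi_pos
  have hE0 : 0 ≤ E := by positivity
  have ht0 : 0 < t := by positivity
  have ht2 : t ^ 2 = ‖P‖ ^ 2 + ε ^ 2 := Real.sq_sqrt (by positivity)
  have htc : (t : ℂ) ≠ 0 := by exact_mod_cast ht0.ne'
  have hPt : ‖P‖ ≤ t := Real.le_sqrt_of_sq_le (by nlinarith [sq_nonneg ε])
  have hlσ : ‖l‖ ≤ σ := (norm_sum_le _ _).trans (le_of_eq (by simp only [norm_inv, hσ]))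
  have hσ0 : 0 ≤ σ := (norm_nonneg _).trans hlσ
  have hΛσ : ‖smoothLogDeriv ξ r z‖ ≤ σ :=
    (norm_sum_le _ _).trans (Finset.sum_le_sum fun i _ => norm_smooth_le hr)
  have h1 : ‖l - smoothLogDeriv ξ r z‖ ≤
      ∑ i, ‖z - ξ i‖⁻¹ * (r ^ 2 / (‖z - ξ i‖ ^ 2 + r ^ 2)) := by
    rw [hl, smoothLogDeriv, ← Finset.sum_sub_distrib]
    exact (norm_sum_le _ _).trans (Finset.sum_le_sum fun i _ =>
      (norm_inv_sub_smooth_eq (sub_ne_zero.2 (hξ i)) hr).le)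
  have h2 : ‖conj P * (P * l) / (t : ℂ) ^ 2 - l‖ ≤ σ * E := by
    have : conj P * (P * l) / (t : ℂ) ^ 2 - l = -(l * ((E : ℝ) : ℂ)) := by
      have hn : P * conj P = ((‖P‖ ^ 2 : ℝ) : ℂ) := by
        rw [Complex.mul_conj, Complex.normSq_eq_norm_sq]
      have ht2c : (t : ℂ) ^ 2 = ((‖P‖ ^ 2 : ℝ) : ℂ) + (ε : ℂ) ^ 2 := by exact_mod_cast ht2
      have hEc : (E : ℂ) = (ε : ℂ) ^ 2 / (t : ℂ) ^ 2 := by rw [hE, ← ht2]; push_cast; rfl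
      rw [hEc]
      field_simp
      rw [ht2c, ← hn]
      ring
    rw [this, norm_neg, norm_mul, Complex.norm_real, Real.norm_eq_abs, abs_of_nonneg hE0]
    gcongr
  have h3 : ‖conj P * (P * l) / (t : ℂ) ^ 2 - smoothLogDeriv ξ r z‖ ≤
      ∑ i, ‖z - ξ i‖⁻¹ * (r ^ 2 / (‖z - ξ i‖ ^ 2 + r ^ 2)) + σ * E := by
    have := norm_add_le (conj P * (P * l) / (t : ℂ) ^ 2 - l) (l - smoothLogDeriv ξ r z)
    rw [sub_add_sub_cancel] at this
    linarith
  have h4 : ‖P * l * (ε : ℂ) ^ 2 / (t : ℂ) ^ 3‖ ≤ σ * E := by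
    rw [norm_div, norm_mul, norm_mul, norm_pow, norm_pow, Complex.norm_real, Complex.norm_real,
      Real.norm_eq_abs, Real.norm_eq_abs, abs_of_pos hε, abs_of_pos ht0, hE, ← ht2]
    calc ‖P‖ * ‖l‖ * ε ^ 2 / t ^ 3 = (‖P‖ / t) * (‖l‖ * (ε ^ 2 / t ^ 2)) := by
          field_simp
      _ ≤ 1 * (σ * (ε ^ 2 / t ^ 2)) := by
          gcongr
          rwa [div_le_one ht0]
      _ = _ := one_mul _
  -- AM–GM turns the second-order kernel into `1/|z - ξ|` at the cost of a factor `1/r`, so it joins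
  -- the main kernel.
  have h5 : 28 / M * ∑ i, 1 / (‖z - ξ i‖ ^ 2 + r ^ 2) ≤ 14 / (M * r) * σ := by
    calc 28 / M * ∑ i, 1 / (‖z - ξ i‖ ^ 2 + r ^ 2)
        ≤ 28 / M * ∑ i, 1 / (2 * r) * ‖z - ξ i‖⁻¹ := by
          gcongr with i
          exact one_div_sq_add_sq_le (norm_pos_iff.2 (sub_ne_zero.2 (hξ i))) hr
      _ = 14 / (M * r) * σ := by rw [← Finset.mul_sum, ← hσ]; field_simp; ring
  have h6 : ‖smoothLogDeriv ξ r z‖ / Real.pi ≤ 1 / Real.pi * σ := by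
    rw [one_div_mul_eq_div]; gcongr
  calc _ ≤ _ := h
    _ ≤ 50 * ‖P‖ + 1 / Real.pi * σ + 2 * M + 14 / (M * r) * σ +
        (∑ i, ‖z - ξ i‖⁻¹ * (r ^ 2 / (‖z - ξ i‖ ^ 2 + r ^ 2)) + σ * E) + 12 * (σ * E) := by
        gcongr
    _ = _ := by ring

/-! ### Integrating the pointwise estimate -/

/-- Used with `q = p'`: the `ξ i` are then the critical points of `p`, with multiplicity. -/
lemma exists_logDeriv_sum {q : ℂ[X]} (hq : q ≠ 0) : ∃ ξ : Fin q.natDegree → ℂ,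
    ∀ z, q.eval z ≠ 0 → (∀ i, z ≠ ξ i) ∧
      q.derivative.eval z = q.eval z * ∑ i, (z - ξ i)⁻¹ := by
  have hs : q.Splits := IsAlgClosed.splits q
  have hcard : q.roots.toList.length = q.natDegree := by
    rw [Multiset.length_toList]; exact (splits_iff_card_roots.1 hs)
  refine ⟨fun i => q.roots.toList.get (i.cast hcard.symm), fun z hz => ⟨fun i h => ?_, ?_⟩⟩
  · have hmem : z ∈ q.roots := by
      rw [h, ← Multiset.mem_toList]
      exact List.get_mem _ _
    exact hz ((mem_roots hq).1 hmem)
  · have h := hs.eval_derivative_div_eval_of_ne_zero hz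
    rw [div_eq_iff hz, mul_comm] at h
    rw [h]
    congr 1
    rw [← Multiset.sum_map_toList, ← Fin.sum_univ_fun_getElem]
    refine Fintype.sum_equiv (finCongr hcard) _ _ fun i => ?_
    simp

/-- By Stokes, adding `2 Re ∂̄Φ` does not change the integral of the density. Both vanish off `{|p|
≤ √5}`, and passing to positive parts only increases the integral. -/
lemma lintegral_lengthDensity_le_dbar {p : ℂ[X]} (hn : p.natDegree ≠ 0) {m : ℕ} (ξ : Fin m → ℂ)
    {ε δ M r : ℝ} (hε : 0 < ε) (hδ : 0 < δ) (hM : 0 < M) (hr : 0 < r) :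
    ∫⁻ z, ENNReal.ofReal (lengthDensity p ε δ z) ≤ ∫⁻ z in {z | ‖p.eval z‖ ≤ √5},
      ENNReal.ofReal (2 * (dbar (testField p ξ ε δ M r) z).re + lengthDensity p ε δ z) := by
  have hC := contDiff_testField p ξ (δ := δ) hε hM hr
  have hS := hasCompactSupport_testField hn ξ ε δ M r
  set Φ := testField p ξ ε δ M r with hΦ
  set K := {z | ‖p.eval z‖ ≤ √5} with hK
  have hKc : IsCompact K := isCompact_norm_eval_le hn √5
  have hcont : Continuous (lengthDensity p ε δ) := by
    have h1 : Continuous cutoff := contDiff_cutoff.continuous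
    have h2 := continuous_rampDeriv δ
    have hp := p.continuous
    have hp' := p.derivative.continuous
    unfold lengthDensity
    refine (((continuous_const.mul (h1.comp (by fun_prop))).mul (h2.comp (by fun_prop))).mul
      (by fun_prop)).mul (Continuous.div (by fun_prop) (by fun_prop) fun z => ?_)
    positivity
  have hnonneg : ∀ z, 0 ≤ lengthDensity p ε δ z := fun z => by
    have := cutoff_nonneg (‖p.eval z‖ ^ 2)
    have := rampDeriv_nonneg hδ (‖p.eval z‖ ^ 2)
    unfold lengthDensity
    positivity
  have hzero : ∀ z, z ∉ K → lengthDensity p ε δ z = 0 := fun z hz => by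
    have hz' : 5 < ‖p.eval z‖ ^ 2 := by
      rw [← Complex.normSq_eq_norm_sq, ← not_le, normSq_le_five_iff]; exact hz
    rw [lengthDensity, cutoff_eq_zero hz']; ring
  have hInt : Integrable (lengthDensity p ε δ) :=
    hcont.integrable_of_hasCompactSupport (HasCompactSupport.intro hKc hzero)
  have hdb := integrable_dbar hC hS
  have hre : ∫ z, (dbar Φ z).re = 0 := by
    have := integral_re hdb
    simp only [RCLike.re_to_complex] at this
    rw [this, integral_dbar_eq_zero hC hS, Complex.zero_re]
  have hreint : Integrable fun z => (dbar Φ z).re := hdb.re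
  have hsum : ∫ z, (2 * (dbar Φ z).re + lengthDensity p ε δ z) = ∫ z, lengthDensity p ε δ z := by
    rw [integral_add (hreint.const_mul 2) hInt, integral_const_mul, hre, mul_zero, zero_add]
  rw [← ofReal_integral_eq_lintegral_ofReal hInt (Eventually.of_forall hnonneg), ← hsum]
  refine (ofReal_integral_le_lintegral_ofReal _).trans ?_
  rw [← lintegral_indicator hKc.measurableSet]
  refine lintegral_mono fun z => ?_
  by_cases hz : z ∈ K
  · rw [indicator_of_mem hz]
  · rw [indicator_of_notMem hz, hzero z hz, add_zero]
    have hd0 : dbar Φ z = 0 := by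
      have hopen : IsOpen Kᶜ := hKc.isClosed.isOpen_compl
      have hev : Φ =ᶠ[𝓝 z] fun _ => 0 := by
        filter_upwards [hopen.mem_nhds hz] with y hy
        have hy' : 5 < Complex.normSq (p.eval y) := by
          rw [← not_le, normSq_le_five_iff]; exact hy
        rw [hΦ, testField, cutoff_eq_zero hy', Complex.ofReal_zero, zero_mul]
      rw [dbar, hev.fderiv_eq]
      simp
    rw [hd0]
    simp

/-- The cost of smoothing one pole. The excess of `1/|z - ξ|` over `c` has integral at most `π/c`;
the rest is at most `c` times `r²/(d² + r²) ≤ r/(2d)`, with `d = |z - ξ|`. -/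
lemma lintegral_inv_norm_mul_le {K : Set ℂ} {A : ℝ} (hA : 0 < A)
    (hK : volume K ≤ ENNReal.ofReal A) (ξ : ℂ) {c r : ℝ} (hc : 0 < c) (hr : 0 < r) :
    ∫⁻ z in K, ENNReal.ofReal (‖z - ξ‖⁻¹ * (r ^ 2 / (‖z - ξ‖ ^ 2 + r ^ 2))) ≤
      ENNReal.ofReal (Real.pi / c + c * r * √(Real.pi * A)) := by
  have hpi := Real.pi_pos
  have hpt : ∀ z : ℂ, ‖z - ξ‖⁻¹ * (r ^ 2 / (‖z - ξ‖ ^ 2 + r ^ 2)) ≤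
      max (‖z - ξ‖⁻¹ - c) 0 + c * r / 2 * ‖z - ξ‖⁻¹ := by
    intro z
    rcases eq_or_ne z ξ with rfl | hz
    · simp
    set d := ‖z - ξ‖ with hd
    have hd0 : 0 < d := norm_pos_iff.2 (sub_ne_zero.2 hz)
    have h1 : r ^ 2 / (d ^ 2 + r ^ 2) ≤ 1 := by
      rw [div_le_one (by positivity)]; nlinarith [sq_nonneg d]
    have h2 : r ^ 2 / (d ^ 2 + r ^ 2) ≤ r / 2 * d⁻¹ := by
      have := one_div_sq_add_sq_le hd0 hr
      calc r ^ 2 / (d ^ 2 + r ^ 2) = r ^ 2 * (1 / (d ^ 2 + r ^ 2)) := by ring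
        _ ≤ r ^ 2 * (1 / (2 * r) * d⁻¹) := by gcongr
        _ = r / 2 * d⁻¹ := by field_simp
    have h0 : 0 ≤ r ^ 2 / (d ^ 2 + r ^ 2) := by positivity
    have h3 : d⁻¹ ≤ max (d⁻¹ - c) 0 + c := by linarith [le_max_left (d⁻¹ - c) 0]
    calc d⁻¹ * (r ^ 2 / (d ^ 2 + r ^ 2)) ≤ (max (d⁻¹ - c) 0 + c) * (r ^ 2 / (d ^ 2 + r ^ 2)) := by
          gcongr
      _ = max (d⁻¹ - c) 0 * (r ^ 2 / (d ^ 2 + r ^ 2)) + c * (r ^ 2 / (d ^ 2 + r ^ 2)) := by ring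
      _ ≤ max (d⁻¹ - c) 0 * 1 + c * (r / 2 * d⁻¹) := by gcongr
      _ = _ := by ring
  calc _ ≤ ∫⁻ z in K, (ENNReal.ofReal (‖z - ξ‖⁻¹ - c) +
        ENNReal.ofReal (c * r / 2) * ENNReal.ofReal ‖z - ξ‖⁻¹) := by
        refine lintegral_mono fun z => ?_
        refine (ENNReal.ofReal_le_ofReal (hpt z)).trans (ENNReal.ofReal_add_le.trans ?_)
        rw [ENNReal.ofReal_mul (by positivity), ENNReal.ofReal_max, ENNReal.ofReal_zero]
        simp
    _ ≤ ENNReal.ofReal (Real.pi / c) +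
        ENNReal.ofReal (c * r / 2) * ENNReal.ofReal (2 * √(Real.pi * A)) := by
        rw [lintegral_add_left (by fun_prop), lintegral_const_mul _ (by fun_prop)]
        gcongr
        · rw [← lintegral_ofReal_inv_norm_sub hc ξ]
          exact setLIntegral_le_lintegral _ _
        · exact lintegral_inv_norm_le hA hK ξ
    _ = _ := by
        rw [← ENNReal.ofReal_mul (by positivity), ← ENNReal.ofReal_add (by positivity)
          (by positivity)]
        congr 1
        ring

/-- The bound for the length obtained from the Stokes formula. -/
noncomputable def lengthBound (n : ℕ) (A M r c : ℝ) : ℝ :=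
  25 * √n * (A + 5 * Real.pi) + 2 * M * A +
    (1 / Real.pi + 14 / (M * r)) * (n * (2 * √(Real.pi * A))) +
    n * (Real.pi / c + c * r * √(Real.pi * A))

/-- From `50x ≤ 25√n + 25x²/√n`, which balances the area `A` against the Dirichlet integral `5πn`
and leaves a term of order `√n` when `A` is bounded. -/
lemma setLIntegral_norm_derivative_le {p : ℂ[X]} (hn : p.natDegree ≠ 0) {A : ℝ} (hA : 0 < A)
    (hK : volume {z | ‖p.eval z‖ ≤ √5} ≤ ENNReal.ofReal A) :
    ∫⁻ z in {z | ‖p.eval z‖ ≤ √5}, ENNReal.ofReal (50 * ‖p.derivative.eval z‖) ≤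
      ENNReal.ofReal (25 * √p.natDegree * (A + 5 * Real.pi)) := by
  set n := p.natDegree with hndef
  have hn0 : (0 : ℝ) < n := by exact_mod_cast Nat.pos_of_ne_zero hn
  have hs : 0 < √(n : ℝ) := Real.sqrt_pos.2 hn0
  have hs2 : √(n : ℝ) * √(n : ℝ) = n := Real.mul_self_sqrt hn0.le
  have hpi := Real.pi_pos
  have h5 := lintegral_norm_derivative_sq_le hn (Real.sqrt_nonneg 5)
  rw [Real.sq_sqrt (by norm_num), ← hndef] at h5
  calc _ ≤ ∫⁻ z in {z | ‖p.eval z‖ ≤ √5}, (ENNReal.ofReal (25 * √n) +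
        ENNReal.ofReal (25 / √n) * ENNReal.ofReal (‖p.derivative.eval z‖ ^ 2)) := by
        refine lintegral_mono fun z => ?_
        rw [← ENNReal.ofReal_mul (by positivity), ← ENNReal.ofReal_add (by positivity)
          (by positivity)]
        apply ENNReal.ofReal_le_ofReal
        set x := ‖p.derivative.eval z‖
        have : 25 * √n + 25 / √n * x ^ 2 - 50 * x = 25 / √n * (x - √n) ^ 2 := by
          field_simp
          ring
        have h0 : 0 ≤ 25 / √n * (x - √n) ^ 2 := by positivity
        linarith
    _ ≤ ENNReal.ofReal (25 * √n) * ENNReal.ofReal A +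
        ENNReal.ofReal (25 / √n) * ENNReal.ofReal (Real.pi * 5 * n) := by
        have hm := p.derivative.continuous.measurable
        rw [lintegral_add_left measurable_const, setLIntegral_const,
          lintegral_const_mul _ (by fun_prop)]
        gcongr
    _ = _ := by
        rw [← ENNReal.ofReal_mul (by positivity), ← ENNReal.ofReal_mul (by positivity),
          ← ENNReal.ofReal_add (by positivity) (by positivity)]
        congr 1
        nth_rw 3 [← hs2]
        field_simp

lemma setLIntegral_sum_le {K : Set ℂ} {m n : ℕ} (hmn : m ≤ n) {f : Fin m → ℂ → ℝ} {a b : ℝ}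
    (ha : 0 ≤ a) (hb : 0 ≤ b) (hf0 : ∀ i z, 0 ≤ f i z) (hfm : ∀ i, Measurable (f i))
    (h : ∀ i, ∫⁻ z in K, ENNReal.ofReal (f i z) ≤ ENNReal.ofReal b) :
    ∫⁻ z in K, ENNReal.ofReal (a * ∑ i, f i z) ≤ ENNReal.ofReal (a * (n * b)) := by
  simp_rw [ENNReal.ofReal_mul ha, ENNReal.ofReal_sum_of_nonneg fun i _ => hf0 i _]
  rw [lintegral_const_mul _ (Finset.measurable_sum _ fun i _ => (hfm i).ennreal_ofReal),
    lintegral_finsetSum _ fun i _ => (hfm i).ennreal_ofReal]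
  gcongr
  calc ∑ i, ∫⁻ z in K, ENNReal.ofReal (f i z) ≤ ∑ _i : Fin m, ENNReal.ofReal b :=
        Finset.sum_le_sum fun i _ => h i
    _ = ENNReal.ofReal (m * b) := by
        rw [Finset.sum_const, Finset.card_univ, Fintype.card_fin, nsmul_eq_mul,
          ENNReal.ofReal_mul (by positivity), ENNReal.ofReal_natCast]
    _ ≤ _ := by gcongr

/-- The summands of the pointwise bound, integrated one by one, are those of `lengthBound`. The `ε`
error stays an integral because it is sent to `0` for fixed `p`, with no uniformity needed. -/
lemma lintegral_lengthDensity_le {p : ℂ[X]} (hn : p.natDegree ≠ 0) {ξ : Fin p.derivative.natDegree → ℂ}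
    (hξ : ∀ z, p.derivative.eval z ≠ 0 → (∀ i, z ≠ ξ i) ∧
      p.derivative.derivative.eval z = p.derivative.eval z * ∑ i, (z - ξ i)⁻¹)
    {ε δ M r c A : ℝ} (hε : 0 < ε) (hδ : 0 < δ) (hM : 0 < M) (hr : 0 < r) (hc : 0 < c)
    (hA : 0 < A) (hK : volume {z | ‖p.eval z‖ ≤ √5} ≤ ENNReal.ofReal A) :
    ∫⁻ z, ENNReal.ofReal (lengthDensity p ε δ z) ≤
      ENNReal.ofReal (lengthBound p.natDegree A M r c) +
      ∫⁻ z in {z | ‖p.eval z‖ ≤ √5}, ENNReal.ofReal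
        (13 * ((∑ i, ‖z - ξ i‖⁻¹) * (ε ^ 2 / (‖p.derivative.eval z‖ ^ 2 + ε ^ 2)))) := by
  set K := {z | ‖p.eval z‖ ≤ √5} with hKdef
  have hKm : MeasurableSet K := (isCompact_norm_eval_le hn √5).measurableSet
  have hpi := Real.pi_pos
  have hm := p.derivative.continuous.measurable
  have hdeg : p.derivative.natDegree ≤ p.natDegree := natDegree_derivative_le p |>.trans (Nat.sub_le _ _)
  refine (lintegral_lengthDensity_le_dbar hn ξ hε hδ hM hr).trans ?_
  have hae : ∀ᵐ z : ℂ, z ∈ regularSet p :=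
    (measure_eq_zero_iff_ae_notMem.1 (volume_compl_regularSet hn)).mono fun z hz => by simpa using hz
  set f₁ : ℂ → ℝ := fun z => 50 * ‖p.derivative.eval z‖ with hf₁
  set f₃ : ℂ → ℝ := fun z => (1 / Real.pi + 14 / (M * r)) * ∑ i, ‖z - ξ i‖⁻¹ with hf₃
  set f₄ : ℂ → ℝ := fun z => 1 * ∑ i, ‖z - ξ i‖⁻¹ * (r ^ 2 / (‖z - ξ i‖ ^ 2 + r ^ 2)) with hf₄
  set f₅ : ℂ → ℝ := fun z =>
    13 * ((∑ i, ‖z - ξ i‖⁻¹) * (ε ^ 2 / (‖p.derivative.eval z‖ ^ 2 + ε ^ 2))) with hf₅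
  have m₁ : Measurable fun z => ENNReal.ofReal (f₁ z) := by fun_prop
  have m₃ : Measurable fun z => ENNReal.ofReal (f₃ z) := by fun_prop
  have m₄ : Measurable fun z => ENNReal.ofReal (f₄ z) := by fun_prop
  have hle : ∫⁻ z in K, ENNReal.ofReal (2 * (dbar (testField p ξ ε δ M r) z).re +
      lengthDensity p ε δ z) ≤ ∫⁻ z in K, (ENNReal.ofReal (f₁ z) + (ENNReal.ofReal (2 * M) +
        (ENNReal.ofReal (f₃ z) + (ENNReal.ofReal (f₄ z) + ENNReal.ofReal (f₅ z))))) := by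
    refine setLIntegral_mono_ae' hKm (hae.mono fun z hz hzK => ?_)
    have h := two_mul_re_dbar_testField_le' p (δ := δ) hε hM hr hzK hz (hξ z hz).1 (hξ z hz).2
    have p₁ : 0 ≤ f₁ z := by positivity
    have p₃ : 0 ≤ f₃ z := by positivity
    have p₄ : 0 ≤ f₄ z := by positivity
    have p₅ : 0 ≤ f₅ z := by positivity
    rw [← ENNReal.ofReal_add p₄ p₅, ← ENNReal.ofReal_add p₃ (by positivity),
      ← ENNReal.ofReal_add (by positivity) (by positivity),
      ← ENNReal.ofReal_add p₁ (by positivity)]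
    apply ENNReal.ofReal_le_ofReal
    refine h.trans (le_of_eq ?_)
    rw [hf₁, hf₃, hf₄, hf₅]
    ring
  refine hle.trans ?_
  rw [lintegral_add_left m₁, lintegral_add_left measurable_const, lintegral_add_left m₃,
    lintegral_add_left m₄, setLIntegral_const]
  have i₁ := setLIntegral_norm_derivative_le hn hA hK
  have i₃ : ∫⁻ z in K, ENNReal.ofReal (f₃ z) ≤
      ENNReal.ofReal ((1 / Real.pi + 14 / (M * r)) * (p.natDegree * (2 * √(Real.pi * A)))) :=
    setLIntegral_sum_le hdeg (by positivity) (by positivity) (fun i z => by positivity)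
      (fun i => by fun_prop) fun i => lintegral_inv_norm_le hA hK (ξ i)
  have i₄ : ∫⁻ z in K, ENNReal.ofReal (f₄ z) ≤
      ENNReal.ofReal (1 * (p.natDegree * (Real.pi / c + c * r * √(Real.pi * A)))) :=
    setLIntegral_sum_le hdeg zero_le_one (by positivity) (fun i z => by positivity)
      (fun i => by fun_prop) fun i => lintegral_inv_norm_mul_le hA hK (ξ i) hc hr
  have i₂ : ENNReal.ofReal (2 * M) * volume K ≤ ENNReal.ofReal (2 * M * A) := by
    rw [ENNReal.ofReal_mul (p := 2 * M) (by positivity)]; gcongr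
  calc _ ≤ ENNReal.ofReal (25 * √p.natDegree * (A + 5 * Real.pi)) + (ENNReal.ofReal (2 * M * A) +
        (ENNReal.ofReal ((1 / Real.pi + 14 / (M * r)) * (p.natDegree * (2 * √(Real.pi * A)))) +
        (ENNReal.ofReal (1 * (p.natDegree * (Real.pi / c + c * r * √(Real.pi * A)))) +
          ∫⁻ z in K, ENNReal.ofReal (f₅ z)))) := by gcongr
    _ = _ := by
        rw [one_mul, lengthBound, ENNReal.ofReal_add (by positivity) (by positivity),
          ENNReal.ofReal_add (by positivity) (by positivity),
          ENNReal.ofReal_add (by positivity) (by positivity)]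
        simp only [add_assoc]
        rfl

/-! ### Removing the regularisation of `p'/|p'|` -/

/-- The error produced by regularising `p' / |p'|` disappears in the limit. -/
lemma tendsto_regularisation_error {p : ℂ[X]} (hn : p.natDegree ≠ 0) {m : ℕ} (ξ : Fin m → ℂ)
    {A : ℝ} (hA : 0 < A) (hK : volume {z | ‖p.eval z‖ ≤ √5} ≤ ENNReal.ofReal A)
    {e : ℕ → ℝ} (he : ∀ k, 0 < e k) (he0 : Tendsto e atTop (𝓝 0)) :
    Tendsto (fun k => ∫⁻ z in {z | ‖p.eval z‖ ≤ √5}, ENNReal.ofReal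
        (13 * ((∑ i, ‖z - ξ i‖⁻¹) * (e k ^ 2 / (‖p.derivative.eval z‖ ^ 2 + e k ^ 2)))))
      atTop (𝓝 0) := by
  set K := {z | ‖p.eval z‖ ≤ √5} with hKdef
  have hm := p.derivative.continuous.measurable
  have hae : ∀ᵐ z : ℂ, z ∈ regularSet p :=
    (measure_eq_zero_iff_ae_notMem.1 (volume_compl_regularSet hn)).mono fun z hz => by simpa using hz
  have h := tendsto_lintegral_of_dominated_convergence (μ := volume.restrict K)
    (F := fun k z => ENNReal.ofReal
        (13 * ((∑ i, ‖z - ξ i‖⁻¹) * (e k ^ 2 / (‖p.derivative.eval z‖ ^ 2 + e k ^ 2)))))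
    (f := fun _ => 0) (fun z => ENNReal.ofReal (13 * ∑ i, ‖z - ξ i‖⁻¹))
    (fun k => by fun_prop) (fun k => Eventually.of_forall fun z => ?_) ?_ ?_
  · simpa using h
  · apply ENNReal.ofReal_le_ofReal
    have h1 : e k ^ 2 / (‖p.derivative.eval z‖ ^ 2 + e k ^ 2) ≤ 1 := by
      have := he k
      rw [div_le_one (by positivity)]
      nlinarith [sq_nonneg ‖p.derivative.eval z‖]
    gcongr
    exact mul_le_of_le_one_right (by positivity) h1
  · exact ne_top_of_le_ne_top ENNReal.ofReal_ne_top (setLIntegral_sum_le le_rfl (by norm_num)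
      (by positivity) (fun i z => by positivity) (fun i => by fun_prop)
      fun i => lintegral_inv_norm_le hA hK (ξ i))
  · refine ae_restrict_of_ae (hae.mono fun z hz => ?_)
    have hP : 0 < ‖p.derivative.eval z‖ := norm_pos_iff.2 hz
    have h1 : Tendsto (fun k => 13 * ((∑ i, ‖z - ξ i‖⁻¹) *
        (e k ^ 2 / (‖p.derivative.eval z‖ ^ 2 + e k ^ 2)))) atTop (𝓝 (13 * ((∑ i, ‖z - ξ i‖⁻¹) *
        (0 ^ 2 / (‖p.derivative.eval z‖ ^ 2 + 0 ^ 2))))) := by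
      refine ((Tendsto.div (he0.pow 2) ((he0.pow 2).const_add _) ?_).const_mul _).const_mul _
      positivity
    have h2 := (ENNReal.continuous_ofReal.tendsto _).comp h1
    rw [zero_pow two_ne_zero, zero_div, mul_zero, mul_zero, ENNReal.ofReal_zero] at h2
    exact h2

/-- The Stokes bound after removing the regularisation. -/
lemma lintegral_cutoff_rampDeriv_le {p : ℂ[X]} (hn : p.natDegree ≠ 0)
    {δ M r c A : ℝ} (hδ : 0 < δ) (hM : 0 < M) (hr : 0 < r) (hc : 0 < c)
    (hA : 0 < A) (hK : volume {z | ‖p.eval z‖ ≤ √5} ≤ ENNReal.ofReal A) :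
    ∫⁻ z, ENNReal.ofReal (2 * cutoff (‖p.eval z‖ ^ 2) * rampDeriv δ (‖p.eval z‖ ^ 2) *
        ‖p.eval z‖ ^ 2) * ENNReal.ofReal ‖p.derivative.eval z‖ ≤
      ENNReal.ofReal (lengthBound p.natDegree A M r c) := by
  obtain ⟨ξ, hξ⟩ := exists_logDeriv_sum (derivative_ne_zero_of_natDegree hn)
  set e : ℕ → ℝ := fun k => 1 / ((k : ℝ) + 1) with he
  have hepos : ∀ k, 0 < e k := fun k => by positivity
  have he0 : Tendsto e atTop (𝓝 0) := tendsto_one_div_add_atTop_nhds_zero_nat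
  have hpt : ∀ z, Tendsto (fun k => ENNReal.ofReal (lengthDensity p (e k) δ z)) atTop
      (𝓝 (ENNReal.ofReal (2 * cutoff (‖p.eval z‖ ^ 2) * rampDeriv δ (‖p.eval z‖ ^ 2) *
        ‖p.eval z‖ ^ 2) * ENNReal.ofReal ‖p.derivative.eval z‖)) := by
    intro z
    have hc0 := cutoff_nonneg (‖p.eval z‖ ^ 2)
    have hr0 := rampDeriv_nonneg hδ (‖p.eval z‖ ^ 2)
    rw [← ENNReal.ofReal_mul (by positivity)]
    refine (ENNReal.continuous_ofReal.tendsto _).comp ?_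
    unfold lengthDensity
    refine Tendsto.const_mul _ ?_
    rcases eq_or_ne ‖p.derivative.eval z‖ 0 with h0 | h0
    · simp [h0]
    · have hP : 0 < ‖p.derivative.eval z‖ := lt_of_le_of_ne (norm_nonneg _) h0.symm
      have h1 : Tendsto (fun k => ‖p.derivative.eval z‖ ^ 2 /
          √(‖p.derivative.eval z‖ ^ 2 + e k ^ 2)) atTop
          (𝓝 (‖p.derivative.eval z‖ ^ 2 / √(‖p.derivative.eval z‖ ^ 2 + 0 ^ 2))) := by
        refine Tendsto.div tendsto_const_nhds ((Real.continuous_sqrt.tendsto _).comp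
          ((he0.pow 2).const_add _)) ?_
        positivity
      have h2 : ‖p.derivative.eval z‖ ^ 2 / √(‖p.derivative.eval z‖ ^ 2 + 0 ^ 2) =
          ‖p.derivative.eval z‖ := by
        rw [zero_pow two_ne_zero, add_zero, Real.sqrt_sq hP.le]
        field_simp
      rwa [h2] at h1
  have hmeas : ∀ k, Measurable fun z => ENNReal.ofReal (lengthDensity p (e k) δ z) := by
    intro k
    have h1 : Measurable cutoff := contDiff_cutoff.continuous.measurable
    have h2 : Measurable (rampDeriv δ) := by unfold rampDeriv; fun_prop
    have hp := p.continuous.measurable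
    have hp' := p.derivative.continuous.measurable
    unfold lengthDensity
    refine Measurable.ennreal_ofReal ?_
    exact (((measurable_const.mul (h1.comp (by fun_prop))).mul (h2.comp (by fun_prop))).mul
      (by fun_prop)).mul (by fun_prop)
  have herr := tendsto_regularisation_error hn ξ hA hK hepos he0
  -- Fatou suffices, as only an upper bound for the limit density is needed.
  calc _ = ∫⁻ z, liminf (fun k => ENNReal.ofReal (lengthDensity p (e k) δ z)) atTop :=
        lintegral_congr fun z => (hpt z).liminf_eq.symm
    _ ≤ liminf (fun k => ∫⁻ z, ENNReal.ofReal (lengthDensity p (e k) δ z)) atTop :=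
        lintegral_liminf_le hmeas
    _ ≤ liminf (fun k => ENNReal.ofReal (lengthBound p.natDegree A M r c) +
        ∫⁻ z in {z | ‖p.eval z‖ ≤ √5}, ENNReal.ofReal
          (13 * ((∑ i, ‖z - ξ i‖⁻¹) * (e k ^ 2 / (‖p.derivative.eval z‖ ^ 2 + e k ^ 2))))) atTop :=
        liminf_le_liminf (Eventually.of_forall fun k =>
          lintegral_lengthDensity_le hn hξ (hepos k) hδ hM hr hc hA hK)
    _ = _ := by
        rw [(herr.const_add _).liminf_eq, add_zero]

/-! ### Concentration on the unit circle -/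

lemma tendsto_ramp_of_lt {x : ℝ} (hx : x < 1) : Tendsto (fun δ => ramp δ x) (𝓝[>] 0) (𝓝 (1 / 2)) := by
  have h1 : Tendsto (fun δ : ℝ => (x - 1) / δ) (𝓝[>] 0) atBot := by
    simp only [div_eq_mul_inv]
    exact tendsto_inv_nhdsGT_zero.const_mul_atTop_of_neg (by linarith)
  have h2 := ((Real.tendsto_arctan_atBot.mono_right nhdsWithin_le_nhds).comp h1).const_mul
    (-(1 / Real.pi))
  have h3 : -(1 / Real.pi) * -(Real.pi / 2) = 1 / 2 := by field_simp
  rw [h3] at h2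
  exact h2

lemma tendsto_ramp_of_gt {x : ℝ} (hx : 1 < x) :
    Tendsto (fun δ => ramp δ x) (𝓝[>] 0) (𝓝 (-(1 / 2))) := by
  have h1 : Tendsto (fun δ : ℝ => (x - 1) / δ) (𝓝[>] 0) atTop := by
    simp only [div_eq_mul_inv]
    exact tendsto_inv_nhdsGT_zero.const_mul_atTop (by linarith)
  have h2 := ((Real.tendsto_arctan_atTop.mono_right nhdsWithin_le_nhds).comp h1).const_mul
    (-(1 / Real.pi))
  have h3 : -(1 / Real.pi) * (Real.pi / 2) = -(1 / 2) := by field_simp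
  rw [h3] at h2
  exact h2

lemma integral_two_mul_rampDeriv (δ a b : ℝ) :
    ∫ ρ in a..b, 2 * ρ * rampDeriv δ (ρ ^ 2) = ramp δ (a ^ 2) - ramp δ (b ^ 2) := by
  have hd : ∀ ρ ∈ uIcc a b, HasDerivAt (fun ρ => -ramp δ (ρ ^ 2)) (2 * ρ * rampDeriv δ (ρ ^ 2)) ρ := by
    intro ρ _
    have h1 : HasDerivAt (fun ρ : ℝ => ρ ^ 2) (2 * ρ) ρ := by simpa using hasDerivAt_pow 2 ρ
    refine ((hasDerivAt_ramp δ (ρ ^ 2)).comp ρ h1).neg.congr_deriv ?_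
    ring
  have hc := continuous_rampDeriv δ
  rw [intervalIntegral.integral_eq_sub_of_hasDerivAt hd
    (Continuous.intervalIntegrable (by fun_prop) _ _)]
  ring

/-- Integration in polar coordinates against a radial weight. -/
lemma lintegral_radial_mul {g : ℝ → ℝ≥0∞} (hg : Measurable g) {S : ℂ → ℝ≥0∞} (hS : Measurable S) :
    ∫⁻ w, g ‖w‖ * S w = ∫⁻ ρ in Ioi (0 : ℝ), ENNReal.ofReal ρ * g ρ *
      ∫⁻ θ in Ioc (-Real.pi) Real.pi, S (ρ * Complex.exp (θ * Complex.I)) := by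
  rw [lintegral_polar _ (by fun_prop), setLIntegral_congr Ioo_ae_eq_Ioc]
  rw [lintegral_lintegral_swap]
  · refine setLIntegral_congr_fun measurableSet_Ioi fun ρ hρ => ?_
    have hρ' : 0 < ρ := hρ
    have hn : ∀ θ : ℝ, ‖(ρ : ℂ) * Complex.exp (θ * Complex.I)‖ = ρ := fun θ => by
      rw [norm_mul, Complex.norm_exp_ofReal_mul_I, mul_one, Complex.norm_real, Real.norm_eq_abs,
        abs_of_pos hρ']
    simp only [hn, ← mul_assoc]
    exact lintegral_const_mul _ (hS.comp (by fun_prop))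
  · refine Measurable.aemeasurable ?_
    have h1 : Measurable fun q : ℝ × ℝ => (q.2 : ℂ) * Complex.exp (q.1 * Complex.I) := by fun_prop
    exact (measurable_snd.ennreal_ofReal).mul ((hg.comp h1.norm).mul (hS.comp h1))

/-- As `δ → 0` the weights `2ρ · rampDeriv δ (ρ²) dρ` put mass tending to `1` near `ρ = 1`. By lower
semicontinuity in the radius, an angular integral exceeding `B` at `ρ = 1` would exceed `B` at
nearby radii, hence in the weighted average. -/
lemma lintegral_fiberLength_le {p : ℂ[X]} (hn : p.natDegree ≠ 0) {B : ℝ} (hB : 0 ≤ B)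
    (h : ∀ δ : ℝ, 0 < δ → ∫⁻ z, ENNReal.ofReal (2 * cutoff (‖p.eval z‖ ^ 2) *
      rampDeriv δ (‖p.eval z‖ ^ 2) * ‖p.eval z‖ ^ 2) * ENNReal.ofReal ‖p.derivative.eval z‖ ≤
        ENNReal.ofReal B) :
    ∫⁻ θ in Ioc (-Real.pi) Real.pi, fiberLength p (Complex.exp (θ * Complex.I)) ≤
      ENNReal.ofReal B := by
  by_contra hlt
  rw [not_le] at hlt
  obtain ⟨b, hb0, hBb, hbf⟩ := ENNReal.lt_iff_exists_real_btwn.1 hlt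
  rw [ENNReal.ofReal_lt_ofReal_iff_of_nonneg hB] at hBb
  have hbpos : 0 < b := hB.trans_lt hBb
  -- One factor `q` pays for `cutoff (ρ²) · ρ²` near `ρ = 1`, the other for the ramp mass falling
  -- short of `1`.
  obtain ⟨q, hq1, hqB⟩ : ∃ q : ℝ, (0 < q ∧ q < 1) ∧ B < q * q * b := by
    have ht : Tendsto (fun q : ℝ => q * q * b) (𝓝[<] 1) (𝓝 (1 * 1 * b)) :=
      (Continuous.tendsto (by fun_prop) 1).mono_left nhdsWithin_le_nhds
    have h1 := ht.eventually (lt_mem_nhds (by linarith : B < 1 * 1 * b))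
    have h2 : ∀ᶠ q : ℝ in 𝓝[<] 1, 0 < q ∧ q < 1 := by
      filter_upwards [self_mem_nhdsWithin, mem_nhdsWithin_of_mem_nhds (lt_mem_nhds zero_lt_one)]
        with q h1 h2 using ⟨h2, h1⟩
    exact (h2.and h1).exists
  have hev1 := eventually_lt_lintegral_fiberLength hn hbf
  have hev2 : ∀ᶠ ρ : ℝ in 𝓝 1, q < cutoff (ρ ^ 2) * ρ ^ 2 := by
    have hc := contDiff_cutoff.continuous
    have ht : Tendsto (fun ρ : ℝ => cutoff (ρ ^ 2) * ρ ^ 2) (𝓝 1) (𝓝 (cutoff (1 ^ 2) * 1 ^ 2)) :=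
      Continuous.tendsto (by fun_prop) 1
    refine ht.eventually (lt_mem_nhds ?_)
    rw [one_pow, cutoff_one]
    linarith [hq1.2]
  obtain ⟨η, hη, hηb⟩ := Metric.eventually_nhds_iff.1 (hev1.and hev2)
  set t := min (η / 2) (1 / 2) with ht
  have ht0 : 0 < t := by positivity
  have ht1 : t ≤ 1 / 2 := min_le_right _ _
  have htη : t < η := (min_le_left _ _).trans_lt (by linarith)
  have hramp : ∀ᶠ δ : ℝ in 𝓝[>] 0, q < ramp δ ((1 - t) ^ 2) - ramp δ ((1 + t) ^ 2) := by
    have h1 := (tendsto_ramp_of_lt (x := (1 - t) ^ 2) (by nlinarith)).sub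
      (tendsto_ramp_of_gt (x := (1 + t) ^ 2) (by nlinarith))
    exact h1.eventually (lt_mem_nhds (by linarith [hq1.2]))
  obtain ⟨δ, hδq, hδ⟩ := (hramp.and self_mem_nhdsWithin).exists
  have hδ0 : 0 < δ := hδ
  have hcm : Measurable cutoff := contDiff_cutoff.continuous.measurable
  have hrm : Measurable (rampDeriv δ) := (continuous_rampDeriv δ).measurable
  have hrc := continuous_rampDeriv δ
  set g : ℝ → ℝ≥0∞ := fun ρ => ENNReal.ofReal (2 * cutoff (ρ ^ 2) * rampDeriv δ (ρ ^ 2) * ρ ^ 2)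
    with hg
  have hgm : Measurable g := by
    refine Measurable.ennreal_ofReal ?_
    exact ((measurable_const.mul (hcm.comp (by fun_prop))).mul (hrm.comp (by fun_prop))).mul
      (by fun_prop)
  have hmain := h δ hδ0
  rw [lintegral_coarea hn (H := fun w => g ‖w‖) (hgm.comp measurable_norm),
    lintegral_radial_mul hgm (lowerSemicontinuous_fiberLength hn).measurable] at hmain
  have hsub : Ioc (1 - t) (1 + t) ⊆ Ioi (0 : ℝ) := fun ρ hρ => by
    have := hρ.1
    rw [mem_Ioi]; linarith
  have hlow : ENNReal.ofReal (q * b * (ramp δ ((1 - t) ^ 2) - ramp δ ((1 + t) ^ 2))) ≤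
      ENNReal.ofReal B := by
    calc _ = ∫⁻ ρ in Ioc (1 - t) (1 + t), ENNReal.ofReal (q * b * (2 * ρ * rampDeriv δ (ρ ^ 2))) := by
          rw [← integral_two_mul_rampDeriv, ← intervalIntegral.integral_const_mul,
            intervalIntegral.integral_of_le (by linarith), ofReal_integral_eq_lintegral_ofReal]
          · exact Continuous.integrableOn_Ioc (by fun_prop)
          · rw [EventuallyLE, ae_restrict_iff' measurableSet_Ioc]
            refine Eventually.of_forall fun ρ hρ => ?_
            have h1 : 0 < ρ := hsub hρ
            have h2 := rampDeriv_nonneg hδ0 (ρ ^ 2)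
            have h3 := hq1.1
            simp only [Pi.zero_apply]
            positivity
      _ ≤ ∫⁻ ρ in Ioc (1 - t) (1 + t), ENNReal.ofReal ρ * g ρ *
            ∫⁻ θ in Ioc (-Real.pi) Real.pi, fiberLength p (ρ * Complex.exp (θ * Complex.I)) := by
          refine setLIntegral_mono_ae' measurableSet_Ioc (Eventually.of_forall fun ρ hρ => ?_)
          have h1 : 0 < ρ := hsub hρ
          have h2 := rampDeriv_nonneg hδ0 (ρ ^ 2)
          have hd : dist ρ 1 < η := by
            rw [Real.dist_eq, abs_lt]
            constructor <;> linarith [hρ.1, hρ.2]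
          obtain ⟨hb1, hb2⟩ := hηb hd
          have hc0 := cutoff_nonneg (ρ ^ 2)
          calc ENNReal.ofReal (q * b * (2 * ρ * rampDeriv δ (ρ ^ 2)))
              ≤ ENNReal.ofReal (ρ * (2 * cutoff (ρ ^ 2) * rampDeriv δ (ρ ^ 2) * ρ ^ 2) * b) := by
                apply ENNReal.ofReal_le_ofReal
                have h3 : 0 ≤ b * (2 * ρ * rampDeriv δ (ρ ^ 2)) := by positivity
                have h4 := mul_le_mul_of_nonneg_right hb2.le h3
                linarith
            _ = ENNReal.ofReal ρ * g ρ * ENNReal.ofReal b := by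
                rw [ENNReal.ofReal_mul (by positivity), ENNReal.ofReal_mul h1.le]
            _ ≤ _ := by gcongr
      _ ≤ _ := (lintegral_mono_set hsub).trans hmain
  rw [ENNReal.ofReal_le_ofReal_iff hB] at hlow
  have hq0 := hq1.1
  have h1 : q * b * q < q * b * (ramp δ ((1 - t) ^ 2) - ramp δ ((1 + t) ^ 2)) :=
    mul_lt_mul_of_pos_left hδq (by positivity)
  linarith

/-! ### Choice of parameters and conclusion -/

/-- The length of a lemniscate in terms of the free parameters of the construction. -/
lemma lemniscateLength_le_lengthBound {p : ℂ[X]} (hn : p.natDegree ≠ 0) {M r c A : ℝ}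
    (hM : 0 < M) (hr : 0 < r) (hc : 0 < c) (hA : 0 < A)
    (hK : volume {z | ‖p.eval z‖ ≤ √5} ≤ ENNReal.ofReal A) :
    lemniscateLength p ≤ ENNReal.ofReal (lengthBound p.natDegree A M r c) := by
  have hpi := Real.pi_pos
  refine (lemniscateLength_le_lintegral hn).trans (lintegral_fiberLength_le hn ?_ fun δ hδ =>
    lintegral_cutoff_rampDeriv_le hn hδ hM hr hc hA hK)
  unfold lengthBound
  positivity

/-- Bernoulli's inequality, with `√5 ≤ 3 = 1 + n · (2/n)`. -/
lemma sqrt_five_rpow_le {n : ℕ} (hn : 1 ≤ n) : √5 ^ (1 / n : ℝ) ≤ 1 + 2 / n := by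
  have hn0 : (0 : ℝ) < n := by exact_mod_cast hn
  have h1 : √5 ≤ (1 + 2 / (n : ℝ)) ^ n := by
    have h2 := one_add_mul_le_pow (a := 2 / (n : ℝ)) (by have : 0 ≤ 2 / (n : ℝ) := by positivity
                                                         linarith) n
    have h3 : (n : ℝ) * (2 / n) = 2 := by field_simp
    have h4 : √5 ≤ 3 := Real.sqrt_le_iff.2 ⟨by norm_num, by norm_num⟩
    linarith
  calc √5 ^ (1 / n : ℝ) ≤ ((1 + 2 / (n : ℝ)) ^ n) ^ (1 / n : ℝ) :=
        Real.rpow_le_rpow (Real.sqrt_nonneg _) h1 (by positivity)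
    _ = 1 + 2 / n := by
        rw [← Real.rpow_natCast, ← Real.rpow_mul (by positivity), mul_one_div_cancel hn0.ne',
          Real.rpow_one]

/-- With `X = n^(1/8)`, the choice `M = X⁷`, `r = X⁻²`, `c = X` makes `MA`, `n/c` and `ncr` all of
order `X⁷`. The terms `√n = X⁴` and `n/(Mr) = X³` are smaller. The leading term `(1/π) · n · 2πt`
exceeds `2n` by at most `4`, since `t ≤ 1 + 2/n`. -/
lemma lengthBound_le {X : ℝ} (hX : 1 ≤ X) {n : ℕ} (hn : (n : ℝ) = X ^ 8) {t : ℝ} (ht0 : 0 ≤ t)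
    (ht : t ≤ 1 + 2 / n) :
    lengthBound n (Real.pi * t ^ 2) (X ^ 7) (1 / X ^ 2) X ≤ 2 * n + 2000 * X ^ 7 := by
  have hX0 : 0 < X := by linarith
  have hpi := Real.pi_pos
  have hpi4 := Real.pi_le_four
  have hs : √(n : ℝ) = X ^ 4 := by
    rw [hn, show X ^ 8 = (X ^ 4) ^ 2 by ring, Real.sqrt_sq (by positivity)]
  have hsA : √(Real.pi * (Real.pi * t ^ 2)) = Real.pi * t := by
    rw [show Real.pi * (Real.pi * t ^ 2) = (Real.pi * t) ^ 2 by ring, Real.sqrt_sq (by positivity)]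
  have hX8 : 1 ≤ X ^ 8 := one_le_pow₀ hX
  have hnt : X ^ 8 * t ≤ X ^ 8 + 2 := by
    rw [hn] at ht
    calc X ^ 8 * t ≤ X ^ 8 * (1 + 2 / X ^ 8) := by gcongr
      _ = X ^ 8 + 2 := by field_simp
  have ht3 : t ≤ 3 := by nlinarith
  have hX4 : X ^ 4 ≤ X ^ 7 := pow_le_pow_right₀ hX (by norm_num)
  have hX3 : X ^ 3 ≤ X ^ 7 := pow_le_pow_right₀ hX (by norm_num)
  have hX7 : 1 ≤ X ^ 7 := one_le_pow₀ hX
  have ht9 : Real.pi * t ^ 2 ≤ 36 := by nlinarith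
  have hpt : Real.pi * t ≤ 12 := by nlinarith
  rw [lengthBound, hsA, hs, hn]
  have e1 : 25 * X ^ 4 * (Real.pi * t ^ 2 + 5 * Real.pi) ≤ 25 * X ^ 7 * (36 + 5 * 4) := by gcongr
  have e2 : 2 * X ^ 7 * (Real.pi * t ^ 2) ≤ 2 * X ^ 7 * 36 := by gcongr
  have e3 : (1 / Real.pi + 14 / (X ^ 7 * (1 / X ^ 2))) * (X ^ 8 * (2 * (Real.pi * t))) =
      2 * (X ^ 8 * t) + 28 * X ^ 3 * (Real.pi * t) := by
    field_simp
    ring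
  have e3' : 28 * X ^ 3 * (Real.pi * t) ≤ 28 * X ^ 7 * 12 := by gcongr
  have e4 : X ^ 8 * (Real.pi / X + X * (1 / X ^ 2) * (Real.pi * t)) = X ^ 7 * (Real.pi + Real.pi * t) := by
    field_simp
  have e4' : X ^ 7 * (Real.pi + Real.pi * t) ≤ X ^ 7 * (4 + 12) := by gcongr
  rw [e3, e4]
  -- The coefficients of `X⁷` sum to `1400 + 72 + 336 + 16 + 4`, below `2000`.
  linarith

lemma lemniscateLength_le {p : ℂ[X]} (hp : p.Monic) {n : ℕ} (hn : 1 ≤ n) (hpn : p.natDegree = n) :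
    lemniscateLength p ≤ ENNReal.ofReal (2 * (n : ℝ) + 2000 * (n : ℝ) ^ (7 / 8 : ℝ)) := by
  have hn0 : p.natDegree ≠ 0 := by omega
  have hnr : (1 : ℝ) ≤ n := by exact_mod_cast hn
  have h5 : (0 : ℝ) < √5 := by positivity
  set t := √5 ^ (1 / n : ℝ) with ht
  have ht0 : 0 < t := by positivity
  set X : ℝ := (n : ℝ) ^ (1 / 8 : ℝ) with hX
  have hX1 : 1 ≤ X := Real.one_le_rpow hnr (by norm_num)
  have hX0 : 0 < X := by linarith
  have hX8 : (n : ℝ) = X ^ 8 := by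
    rw [hX, ← Real.rpow_natCast, ← Real.rpow_mul (by linarith)]; norm_num
  have hX7 : (n : ℝ) ^ (7 / 8 : ℝ) = X ^ 7 := by
    rw [hX, ← Real.rpow_natCast, ← Real.rpow_mul (by linarith)]; norm_num
  have hK := volume_norm_eval_le hp hn0 h5
  rw [hpn, ← ht] at hK
  have hpi := Real.pi_pos
  have h := lemniscateLength_le_lengthBound hn0 (M := X ^ 7) (r := 1 / X ^ 2) (c := X)
    (by positivity) (by positivity) hX0 (by positivity) hK
  rw [hpn] at h
  refine h.trans (ENNReal.ofReal_le_ofReal ?_)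
  rw [hX7]
  exact lengthBound_le hX1 hX8 ht0.le (sqrt_five_rpow_le hn)

theorem mainTheorem2 :
    (∃ C : ℝ, ∀ n : ℕ, 1 ≤ n → ∀ p : Polynomial ℂ, p.Monic → p.natDegree = n →
      lemniscateLength p ≤ ENNReal.ofReal (2 * (n : ℝ) + C * (n : ℝ) ^ (7 / 8 : ℝ))) ∧
    (∀ ε : ℝ, 0 < ε → ∃ N : ℕ, ∀ n : ℕ, N ≤ n → ∀ p : Polynomial ℂ, p.Monic →
      p.natDegree = n →
      lemniscateLength p ≤ ENNReal.ofReal (2 * (n : ℝ) + ε * (n : ℝ))) := by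
  refine ⟨⟨2000, fun n hn p hp hpn => lemniscateLength_le hp hn hpn⟩, fun ε hε => ?_⟩
  have ht : Tendsto (fun n : ℕ => 2000 * (n : ℝ) ^ (-(1 / 8) : ℝ)) atTop (𝓝 (2000 * 0)) :=
    ((tendsto_rpow_neg_atTop (by norm_num)).comp tendsto_natCast_atTop_atTop).const_mul _
  rw [mul_zero] at ht
  obtain ⟨N, hN⟩ := Filter.eventually_atTop.1 ((ht.eventually (gt_mem_nhds hε)).and
    (eventually_ge_atTop 1))
  refine ⟨N, fun n hn p hp hpn => ?_⟩
  obtain ⟨h1, h2⟩ := hN n hn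
  have hn0 : (0 : ℝ) < n := by exact_mod_cast h2
  refine (lemniscateLength_le hp h2 hpn).trans (ENNReal.ofReal_le_ofReal ?_)
  have h3 : (n : ℝ) ^ (7 / 8 : ℝ) = (n : ℝ) ^ (-(1 / 8) : ℝ) * n := by
    nth_rw 3 [← Real.rpow_one (n : ℝ)]
    rw [← Real.rpow_add hn0]
    norm_num
  rw [h3, ← mul_assoc]
  gcongr
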